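/- All manifolds are smooth, Hausdorff, second countable 3-manifolds without boundary (not assumed connected). Cauchy data $(M^3,g,h)$ consist of such a manifold, a smooth Riemannian metric $g$ and a smooth symmetric $(0,2)$-tensor field $h$; put $$\mu=\tfrac1{16\pi}\big[R-h^{ij}h_{ij}+(h_k{}^k)^2\big],\qquad J^i=\tfrac1{8\pi}\nabla_j\big[h^{ij}-(h_k{}^k)g^{ij}\big].$$ The data are asymptotically flat if, outside a compact set, $M$ is the disjoint union of finitely many (at least one) ends, each with a chart onto the exterior of a closed ball of $\mathbb R^3$ in which, for some $\alpha>1/2$, near infinity, $g_{ij}-\delta_{ij}=O(|x|^{-\alpha})$, $\partial_k g_{ij}=O(|x|^{-\alpha-1})$, $h_{ij}=O(|x|^{-\alpha-1})$ and $R$ is integrable. One end is chosen, and $m$ denotes its ADM mass $$m=\frac1{16\pi}\lim_{\sigma\to\infty}\int_{S_\sigma}\sum_{i,j}(\partial_i g_{ij}-\partial_j g_{ii})\,\nu_j\,d\mu .$$ A surface is the boundary $\Sigma=\partial\Omega$ of an open region $\Omega$ with piecewise smooth boundary that contains all ends other than the chosen one and is disjoint from a neighbourhood of infinity of the chosen end;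 $\partial\Omega'$ encloses $\partial\Omega$ if $\Omega\subseteq\Omega'$. A surface is outer-minimising if every surface enclosing it has at least as much area. For given data let $A$ be the infimum of the areas of all surfaces (the minimum area required to enclose all the other ends; $A=0$ if there are none). Let $\Sigma=\partial\Omega$ be a smooth outer-minimising surface in complete, asymptotically flat data $(M^3,g,h)$ with $\mu\ge|J|$. An extension is a complete, asymptotically flat Cauchy data set with $\mu\ge|J|$ everywhere and a chosen end, obtained from $(M,g,h)$ by replacing the outside of $\Sigma$ and keeping the closed inside region with its data, such that the kept inside region contains all ends of the new data except the chosen one. A fill-in is defined in the same way, replacing the inside of $\Sigma$ and keeping the closed outside region with its data, where the new inside region contains all ends of the new data except the chosen one. Let $m_{outer}(\Sigma)$ be the infimum of the total mass $m$ over all extensions in which $\Sigma$ remains outer-minimising, and let $m_{inner}(\Sigma)$ be the supremum of $\sqrt{A/16\pi}$ over all fill-ins (both in the extended reals). Theorem. Suppose that the following conjecture holds: for all complete, asymptotically flat Cauchy data with $\mu\ge|J|$ and more than one end, and every choice of one of the ends, $m\ge\sqrt{A/16\pi}$. Then for all complete, asymptotically flat Cauchy data $(M^3,g,h)$ with $\mu\ge|J|$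 (and a chosen end) and every smooth outer-minimising surface $\Sigma$ in it, $$m_{outer}(\Sigma)\ge m_{inner}(\Sigma).$$ -/

import Mathlib

open scoped Manifold ContDiff ENNReal Topology Bundle
open MeasureTheory

noncomputable section

namespace Penrose

/-- The model space `ℝ³` with its Euclidean norm. -/
abbrev E3 : Type := EuclideanSpace ℝ (Fin 3)

/-! ### Tensor calculus in coordinates

`G` and `K` are the matrices of components, in some coordinate system, of a Riemannian metric and
of a symmetric `(0,2)`-tensor field. -/

/-- The `i`-th coordinate vector of `ℝ³`. -/
def basisVec (i : Fin 3) : E3 := EuclideanSpace.single i 1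

/-- The partial derivative `∂ᵢ f`. -/
def pd (i : Fin 3) (f : E3 → ℝ) (y : E3) : ℝ := fderiv ℝ f y (basisVec i)

/-- The Christoffel symbol `Γᵏᵢⱼ = ½ gᵏˡ (∂ᵢ gⱼₗ + ∂ⱼ gᵢₗ - ∂ₗ gᵢⱼ)`. -/
def christoffel (G : E3 → Matrix (Fin 3) (Fin 3) ℝ) (k i j : Fin 3) (y : E3) : ℝ :=
  (1 / 2) * ∑ l, (G y)⁻¹ k l *
    (pd i (fun z => G z j l) y + pd j (fun z => G z i l) y - pd l (fun z => G z i j) y)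

/-- The Ricci tensor `Rᵢⱼ = ∂ₖ Γᵏᵢⱼ - ∂ⱼ Γᵏᵢₖ + Γᵏₖₗ Γˡᵢⱼ - Γᵏⱼₗ Γˡᵢₖ`. -/
def ricci (G : E3 → Matrix (Fin 3) (Fin 3) ℝ) (i j : Fin 3) (y : E3) : ℝ :=
  ∑ k, (pd k (christoffel G k i j) y - pd j (christoffel G k i k) y
    + ∑ l, (christoffel G k k l y * christoffel G l i j y
      - christoffel G k j l y * christoffel G l i k y))

/-- The scalar curvature `R = gⁱʲ Rᵢⱼ`. -/
def scalarCurv (G : E3 → Matrix (Fin 3) (Fin 3) ℝ) (y : E3) : ℝ :=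
  ∑ i, ∑ j, (G y)⁻¹ i j * ricci G i j y

/-- The tensor with both indices raised, `hⁱʲ`. -/
def raise (G K : E3 → Matrix (Fin 3) (Fin 3) ℝ) (i j : Fin 3) (y : E3) : ℝ :=
  ∑ a, ∑ b, (G y)⁻¹ i a * (G y)⁻¹ j b * K y a b

/-- The trace `hᵢⁱ`. -/
def traceK (G K : E3 → Matrix (Fin 3) (Fin 3) ℝ) (y : E3) : ℝ :=
  ∑ i, ∑ j, (G y)⁻¹ i j * K y i j

/-- The energy density `μ = (1/16π) (R - hⁱʲ hᵢⱼ + (hᵢⁱ)²)`. -/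
def energyDensity (G K : E3 → Matrix (Fin 3) (Fin 3) ℝ) (y : E3) : ℝ :=
  1 / (16 * Real.pi) *
    (scalarCurv G y - ∑ i, ∑ j, raise G K i j y * K y i j + traceK G K y ^ 2)

/-- The tensor `hⁱʲ - (hₖᵏ) gⁱʲ`. -/
def momentumTensor (G K : E3 → Matrix (Fin 3) (Fin 3) ℝ) (i j : Fin 3) (y : E3) : ℝ :=
  raise G K i j y - traceK G K y * (G y)⁻¹ i j

/-- The current density `Jⁱ = (1/8π) ∇ⱼ (hⁱʲ - (hₖᵏ) gⁱʲ)`. -/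
def currentDensity (G K : E3 → Matrix (Fin 3) (Fin 3) ℝ) (i : Fin 3) (y : E3) : ℝ :=
  1 / (8 * Real.pi) * ∑ j, (pd j (momentumTensor G K i j) y
    + ∑ k, (christoffel G i j k y * momentumTensor G K k j y
      + christoffel G j j k y * momentumTensor G K i k y))

/-- The length `|J|` of the current density with respect to the metric. -/
def currentNorm (G K : E3 → Matrix (Fin 3) (Fin 3) ℝ) (y : E3) : ℝ :=
  Real.sqrt (∑ i, ∑ j, G y i j * currentDensity G K i y * currentDensity G K j y)

/-- The flux
`(1/16π) ∫_{S_σ} ∑ᵢⱼ (∂ᵢ gᵢⱼ - ∂ⱼ gᵢᵢ) νⱼ dμ`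
through the coordinate sphere of radius `σ`, written as an integral over the unit sphere. -/
def massFlux (G : E3 → Matrix (Fin 3) (Fin 3) ℝ) (σ : ℝ) : ℝ :=
  1 / (16 * Real.pi) * ∫ ν : Metric.sphere (0 : E3) 1,
    (∑ i, ∑ j, (pd i (fun z => G z i j) (σ • (ν : E3)) - pd j (fun z => G z i i) (σ • (ν : E3)))
      * (ν : E3) j) * σ ^ 2 ∂((volume : Measure E3).toSphere)

/-- Asymptotic flatness of the components `G`, `K` near infinity, outside the ball of radius `r`:
for some `α > 1/2`, `gᵢⱼ - δᵢⱼ = O(|y|^{-α})`, `∂ₖ gᵢⱼ = O(|y|^{-α-1})`, `hᵢⱼ = O(|y|^{-α-1})`,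
and the scalar curvature is integrable. These conditions ensure that the ADM mass exists. -/
def AsymptoticallyFlatAt (G K : E3 → Matrix (Fin 3) (Fin 3) ℝ) (r : ℝ) : Prop :=
  ∃ α C R : ℝ, 1 / 2 < α ∧ r < R ∧
    (∀ y : E3, R < ‖y‖ → ∀ i j : Fin 3,
      |G y i j - (1 : Matrix (Fin 3) (Fin 3) ℝ) i j| ≤ C * ‖y‖ ^ (-α) ∧
      (∀ k : Fin 3, |pd k (fun z => G z i j) y| ≤ C * ‖y‖ ^ (-α - 1)) ∧
      |K y i j| ≤ C * ‖y‖ ^ (-α - 1)) ∧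
    IntegrableOn (scalarCurv G) {y : E3 | R < ‖y‖} volume

/-! ### Cauchy data -/

/-- Cauchy data `(M³, g, h)`: a smooth Hausdorff second countable 3-manifold (without boundary)
with a smooth Riemannian metric `g` and a smooth symmetric `(0,2)`-tensor field `h`. -/
structure CauchyData where
  /-- The manifold `M`. -/
  carrier : Type
  [top : TopologicalSpace carrier]
  [charted : ChartedSpace E3 carrier]
  [mfd : IsManifold 𝓘(ℝ, E3) ∞ carrier]
  [t2 : T2Space carrier]
  [sc : SecondCountableTopology carrier]
  /-- The metric `g`. -/
  g : Bundle.ContMDiffRiemannianMetric 𝓘(ℝ, E3) ∞ E3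
    (fun x : carrier => TangentSpace 𝓘(ℝ, E3) x)
  /-- The second fundamental form `h`. -/
  h : ∀ x : carrier, TangentSpace 𝓘(ℝ, E3) x →L[ℝ] TangentSpace 𝓘(ℝ, E3) x →L[ℝ] ℝ
  h_symm : ∀ (x : carrier) (v w : TangentSpace 𝓘(ℝ, E3) x), h x v w = h x w v
  h_smooth : ContMDiff 𝓘(ℝ, E3) (𝓘(ℝ, E3).prod 𝓘(ℝ, E3 →L[ℝ] E3 →L[ℝ] ℝ)) ∞
    (fun x => Bundle.TotalSpace.mk' (E3 →L[ℝ] E3 →L[ℝ] ℝ)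
      (E := fun x : carrier =>
        TangentSpace 𝓘(ℝ, E3) x →L[ℝ] TangentSpace 𝓘(ℝ, E3) x →L[ℝ] ℝ) x (h x))

attribute [instance] CauchyData.top CauchyData.charted CauchyData.mfd CauchyData.t2 CauchyData.sc

namespace CauchyData

variable (D : CauchyData)

/-- The distance of `(M, g)`: the infimum of the lengths of curves (infinite between different
connected components). -/
@[reducible] def emetric : EMetricSpace D.carrier :=
  letI : Bundle.RiemannianBundle (fun x : D.carrier => TangentSpace 𝓘(ℝ, E3) x) :=
    ⟨D.g.toRiemannianMetric⟩
  haveI : LocallyCompactSpace D.carrier := ChartedSpace.locallyCompactSpace E3 D.carrier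
  haveI : IsContinuousRiemannianBundle E3 (fun x : D.carrier => TangentSpace 𝓘(ℝ, E3) x) :=
    ⟨⟨D.g.inner, D.g.contMDiff.continuous, fun _ _ _ => rfl⟩⟩
  EMetricSpace.ofRiemannianMetric 𝓘(ℝ, E3) D.carrier

/-- `(M, g)` is complete. -/
def IsComplete : Prop :=
  @CompleteSpace D.carrier D.emetric.toPseudoEMetricSpace.toUniformSpace

/-- The area of a set: its two-dimensional Hausdorff measure for the distance of `g`, normalized
so as to be the usual area for smooth surfaces. -/
def area (S : Set D.carrier) : ℝ≥0∞ :=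
  letI := D.emetric
  letI : MeasurableSpace D.carrier := borel D.carrier
  haveI : BorelSpace D.carrier := ⟨rfl⟩
  (Measure.euclideanHausdorffMeasure 2 : Measure D.carrier) S

/-- The components of a `(0,2)`-tensor field in a coordinate system. -/
def components (T : ∀ x : D.carrier,
    TangentSpace 𝓘(ℝ, E3) x →L[ℝ] TangentSpace 𝓘(ℝ, E3) x →L[ℝ] ℝ)
    (e : OpenPartialHomeomorph D.carrier E3) (y : E3) : Matrix (Fin 3) (Fin 3) ℝ :=
  Matrix.of fun i j =>
    T (e.symm y) (mfderiv 𝓘(ℝ, E3) 𝓘(ℝ, E3) e.symm y (basisVec i))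
      (mfderiv 𝓘(ℝ, E3) 𝓘(ℝ, E3) e.symm y (basisVec j))

/-- The dominant energy condition `μ ≥ |J|`, at every point and in every smooth coordinate
system (both sides are independent of the coordinates). -/
def DominantEnergy : Prop :=
  ∀ e ∈ IsManifold.maximalAtlas 𝓘(ℝ, E3) ∞ D.carrier, ∀ y ∈ e.target,
    currentNorm (D.components D.g.inner e) (D.components D.h e) y ≤
      energyDensity (D.components D.g.inner e) (D.components D.h e) y

/-- `f` is a smooth function without critical points on the set `U`. -/
def RegularOn (f : D.carrier → ℝ) (U : Set D.carrier) : Prop :=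
  ContMDiffOn 𝓘(ℝ, E3) 𝓘(ℝ, ℝ) ∞ f U ∧
    ∀ x ∈ U, mfderiv 𝓘(ℝ, E3) 𝓘(ℝ, ℝ) f x ≠ 0

/-- `Ω` has smooth boundary: near each boundary point it is `{f < 0}` with `f` smooth and
`df ≠ 0`. -/
def SmoothBoundary (Ω : Set D.carrier) : Prop :=
  ∀ p ∈ frontier Ω, ∃ U : Set D.carrier, IsOpen U ∧ p ∈ U ∧ ∃ f : D.carrier → ℝ,
    D.RegularOn f U ∧ Ω ∩ U = {x | f x < 0} ∩ U

/-- `Ω` has piecewise smooth boundary: near each boundary point it is a finite union of finite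
intersections of sets `{f < 0}` with `f` smooth and `df ≠ 0`. -/
def PiecewiseSmoothBoundary (Ω : Set D.carrier) : Prop :=
  ∀ p ∈ frontier Ω, ∃ U : Set D.carrier, IsOpen U ∧ p ∈ U ∧
    ∃ S : Set (Set (D.carrier → ℝ)), S.Finite ∧
      (∀ T ∈ S, T.Finite ∧ ∀ f ∈ T, D.RegularOn f U) ∧
      Ω ∩ U = {x | ∃ T ∈ S, ∀ f ∈ T, f x < 0} ∩ U

end CauchyData

/-! ### Asymptotically flat Cauchy data with a chosen end -/

/-- Asymptotically flat Cauchy data with a chosen end: outside a compact set, `M` is the disjoint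
union of finitely many ends, each with a chart onto the exterior of a closed ball of `ℝ³` in which
the data are asymptotically flat. -/
structure AFData extends CauchyData where
  /-- The set of ends. -/
  ι : Type
  [finite_ends : Finite ι]
  /-- The chosen end. -/
  chosen : ι
  /-- The asymptotic coordinates of an end. -/
  chart : ι → OpenPartialHomeomorph carrier E3
  radius : ι → ℝ
  radius_pos : ∀ i, 0 < radius i
  chart_mem : ∀ i, chart i ∈ IsManifold.maximalAtlas 𝓘(ℝ, E3) ∞ carrier
  chart_target : ∀ i, (chart i).target = {y | radius i < ‖y‖}
  disjoint_ends : ∀ i j, i ≠ j → Disjoint (chart i).source (chart j).source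
  compact_core : ∃ R : ℝ, (∀ i, radius i < R) ∧
    IsCompact {p : carrier | ∀ i, p ∈ (chart i).source → ‖chart i p‖ ≤ R}
  asymptotically_flat : ∀ i, AsymptoticallyFlatAt
    (toCauchyData.components toCauchyData.g.inner (chart i))
    (toCauchyData.components toCauchyData.h (chart i)) (radius i)

namespace AFData

variable (D : AFData)

/-- The total (ADM) mass of the chosen end. -/
def mass : ℝ :=
  Filter.limUnder Filter.atTop (massFlux (D.components D.g.inner (D.chart D.chosen)))

/-- `Ω` contains the end `i`, i.e. contains a neighbourhood of infinity in it. -/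
def ContainsEnd (Ω : Set D.carrier) (i : D.ι) : Prop :=
  ∃ R : ℝ, ∀ y ∈ (D.chart i).target, R < ‖y‖ → (D.chart i).symm y ∈ Ω

/-- An open region which contains all of the ends other than the chosen one, but not the chosen
end (it stays away from a neighbourhood of infinity there). The surfaces under consideration are
the boundaries of such regions, and a surface `∂Ω'` encloses `∂Ω` when `Ω ⊆ Ω'`. -/
def IsRegion (Ω : Set D.carrier) : Prop :=
  IsOpen Ω ∧ (∀ i, i ≠ D.chosen → D.ContainsEnd Ω i) ∧ D.ContainsEnd Ωᶜ D.chosen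

/-- `∂Ω` is outer-minimising: every surface which encloses it has at least as much area. -/
def OuterMinimising (Ω : Set D.carrier) : Prop :=
  ∀ Ω' : Set D.carrier, D.IsRegion Ω' → D.PiecewiseSmoothBoundary Ω' → Ω ⊆ Ω' →
    D.area (frontier Ω) ≤ D.area (frontier Ω')

/-- The minimum area `A` required to enclose all of the ends other than the chosen one. -/
def enclosingArea : ℝ≥0∞ :=
  ⨅ (Ω : Set D.carrier) (_ : D.IsRegion Ω) (_ : D.PiecewiseSmoothBoundary Ω), D.area (frontier Ω)

/-- The quantity `√(A / 16π)`, computed in `[0, ∞]`. -/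
def penroseMass : EReal :=
  (((D.enclosingArea / ENNReal.ofReal (16 * Real.pi)) ^ (1 / 2 : ℝ) : ℝ≥0∞) : EReal)

end AFData

/-- The Penrose conjecture for data with more than one end: `m ≥ √(A / 16π)` for the chosen end,
where `A` is the minimum area required to enclose all of the other ends. -/
def MultiEndPenroseConjecture : Prop :=
  ∀ D : AFData, D.IsComplete → D.DominantEnergy → Nontrivial D.ι → D.penroseMass ≤ (D.mass : EReal)

/-! ### Extensions, fill-ins, outer and inner mass -/

/-- The closed set `S`, with its Cauchy data as a part of `D`, is identified with the closed set
`S'` of `D'`: there is a diffeomorphism `φ` between neighbourhoods of `S` and `S'` which takes the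
part of `Ω` in its domain onto the part of `Ω'` in its range and which, at the points of `S`,
carries the metric and the second fundamental form of `D` to those of `D'`. Off `S` nothing is
required of the data. (Used with `S`, `S'` the closed inside or the closed outside regions, which
`φ` then takes onto each other.) -/
def SameDataOn (D D' : CauchyData) (Ω : Set D.carrier) (Ω' : Set D'.carrier)
    (S : Set D.carrier) (S' : Set D'.carrier) : Prop :=
  ∃ φ : OpenPartialHomeomorph D.carrier D'.carrier,
    ContMDiffOn 𝓘(ℝ, E3) 𝓘(ℝ, E3) ∞ φ φ.source ∧
    ContMDiffOn 𝓘(ℝ, E3) 𝓘(ℝ, E3) ∞ φ.symm φ.target ∧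
    S ⊆ φ.source ∧ S' ⊆ φ.target ∧ (∀ x ∈ φ.source, φ x ∈ Ω' ↔ x ∈ Ω) ∧
    ∀ x ∈ S, ∀ v w : TangentSpace 𝓘(ℝ, E3) x,
      D'.g.inner (φ x) (mfderiv 𝓘(ℝ, E3) 𝓘(ℝ, E3) φ x v) (mfderiv 𝓘(ℝ, E3) 𝓘(ℝ, E3) φ x w)
        = D.g.inner x v w ∧
      D'.h (φ x) (mfderiv 𝓘(ℝ, E3) 𝓘(ℝ, E3) φ x v) (mfderiv 𝓘(ℝ, E3) 𝓘(ℝ, E3) φ x w)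
        = D.h x v w

/-- `(D', Ω')` is an extension of `D` from `∂Ω`: it results from replacing the outside of `∂Ω`,
the inside region together with its data being kept. -/
def IsExtension (D : AFData) (Ω : Set D.carrier) (D' : AFData) (Ω' : Set D'.carrier) : Prop :=
  D'.IsComplete ∧ D'.DominantEnergy ∧ D'.IsRegion Ω' ∧
    SameDataOn D.toCauchyData D'.toCauchyData Ω Ω' (closure Ω) (closure Ω')

/-- `(D', Ω')` is a fill-in of `D` inside `∂Ω`: it results from replacing the inside of `∂Ω`,
the outside region together with its data being kept. -/
def IsFillIn (D : AFData) (Ω : Set D.carrier) (D' : AFData) (Ω' : Set D'.carrier) : Prop :=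
  D'.IsComplete ∧ D'.DominantEnergy ∧ D'.IsRegion Ω' ∧
    SameDataOn D.toCauchyData D'.toCauchyData Ω Ω' Ωᶜ Ω'ᶜ

/-- The Bartnik outer mass of `∂Ω`: the infimum of the total mass over all extensions in which
`∂Ω` remains outer-minimising. -/
def outerMass (D : AFData) (Ω : Set D.carrier) : EReal :=
  sInf {m | ∃ (D' : AFData) (Ω' : Set D'.carrier),
    IsExtension D Ω D' Ω' ∧ D'.OuterMinimising Ω' ∧ m = (D'.mass : EReal)}

/-- The inner mass of `∂Ω`: the supremum of `√(A / 16π)` over all fill-ins, where `A` is the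
minimum area required to enclose all of the ends of the fill-in other than the chosen one. -/
def innerMass (D : AFData) (Ω : Set D.carrier) : EReal :=
  sSup {m | ∃ (D' : AFData) (Ω' : Set D'.carrier), IsFillIn D Ω D' Ω' ∧ m = D'.penroseMass}

end Penrose

end

open scoped Manifold ContDiff ENNReal Topology Bundle
open MeasureTheory

noncomputable section

namespace Penrose

/-! The supremum and the infimum are compared member by member: for each fill-in `A` and each
extension `B` of the same surface, the Penrose mass of `A` is at most the ADM mass of `B`
(`IsFillIn.penroseMass_le_mass`). The inside of `A` is joined along the surface to the outside of
`B`, and the conjecture is applied to the result `Q`.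

`Q` is an admissible competitor. Near the surface `A` agrees with the original data on the outer
side and `B` on the inner side. So if `S`, `T`, `R` are the tensors of `A`, `B` and the original
data, the glued tensor is `S + T - R` on a collar, hence smooth (`IsSeam.smoothTensorAt`). The
dominant energy condition holds off the seam because the data there are locally those of `A` or `B`,
and on the seam by continuity (`Glued.dominantEnergy`). Completeness follows from asymptotic
flatness alone (`AFData.isComplete`). The ends of `Q` are those of `A` inside the surface and the
chosen end of `B`; the mass is that of `B` (`Glued.mass_afData`).

It remains to see that enclosing the inner ends costs at least as much area in `Q` as in `A`
(`Glued.enclosingArea_le`). A region `Θ` of `Q` is cut down to its part inside the surface. This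
exchanges the part of `∂Θ` lying outside for the part of the surface covered by `Θ`. The exchange
does not increase area: otherwise the union of `Θ` with the inside would give, in `B`, an enclosing
surface of smaller area, against outer-minimality (`Glued.area_frontier_inner_le`). The comparison
needs the surface to have finite area and areas to be unaffected by identifications that preserve
the metric only at the points of the set measured; area being Hausdorff measure, the latter is a
local Lipschitz estimate with constants tending to 1 (`CauchyData.area_image_le`).

If `A` has a single end, its enclosing area vanishes and the claim is that the mass of `B` is
nonnegative. This is the conjecture for the disjoint union of two copies of `B`
(`AFData.mass_nonneg`). -/

/-- Fields of bilinear forms on the tangent spaces of a manifold modelled on `ℝ³`. -/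
abbrev TensorField (M : Type) [TopologicalSpace M] [ChartedSpace E3 M] : Type :=
  ∀ x : M, TangentSpace 𝓘(ℝ, E3) x →L[ℝ] TangentSpace 𝓘(ℝ, E3) x →L[ℝ] ℝ

/-! ### Pullback and smoothness of tensor fields -/

section Tensors

variable {M N P : Type} [TopologicalSpace M] [ChartedSpace E3 M]
  [TopologicalSpace N] [ChartedSpace E3 N] [TopologicalSpace P] [ChartedSpace E3 P]

/-- The pullback of a bilinear form under a linear map. -/
def pullForm (B : E3 →L[ℝ] E3 →L[ℝ] ℝ) (L : E3 →L[ℝ] E3) : E3 →L[ℝ] E3 →L[ℝ] ℝ :=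
  B.bilinearComp L L

/-- The pullback `F^* T` of a tensor field. -/
def pull (F : M → N) (T : TensorField N) : TensorField M := fun x =>
  pullForm (T (F x)) (mfderiv 𝓘(ℝ, E3) 𝓘(ℝ, E3) F x)

theorem pull_apply (F : M → N) (T : TensorField N) (x : M) (v w : TangentSpace 𝓘(ℝ, E3) x) :
    pull F T x v w = T (F x) (mfderiv 𝓘(ℝ, E3) 𝓘(ℝ, E3) F x v)
      (mfderiv 𝓘(ℝ, E3) 𝓘(ℝ, E3) F x w) := rfl

theorem pull_congr {F F' : M → N} (T : TensorField N) {x : M} (h : F =ᶠ[𝓝 x] F') :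
    pull F T x = pull F' T x := by
  ext v w
  rw [pull_apply, pull_apply]
  have h1 := h.mfderiv_eq (I := 𝓘(ℝ, E3)) (I' := 𝓘(ℝ, E3))
  have h2 := h.self_of_nhds
  -- The type of the derivative mentions `F x`, so it is replaced before the base point is
  -- rewritten.
  generalize mfderiv 𝓘(ℝ, E3) 𝓘(ℝ, E3) F x = L at h1
  subst h1
  rw [h2]

theorem pull_comp {F : M → N} {G : N → P} (T : TensorField P) {x : M}
    (hG : MDifferentiableAt 𝓘(ℝ, E3) 𝓘(ℝ, E3) G (F x))
    (hF : MDifferentiableAt 𝓘(ℝ, E3) 𝓘(ℝ, E3) F x) :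
    pull (G ∘ F) T x = pull F (pull G T) x := by
  ext v w
  simp only [pull_apply]
  rw [mfderiv_comp x hG hF]
  rfl

theorem pull_congr_tensor (F : M → N) {T T' : TensorField N} {x : M} (h : T (F x) = T' (F x)) :
    pull F T x = pull F T' x := by
  ext v w; rw [pull_apply, pull_apply, h]

theorem pull_id (T : TensorField M) (x : M) : pull id T x = T x := by
  ext v w; rw [pull_apply, mfderiv_id]; rfl

/-- `T` is smooth at `x`. -/
def SmoothTensorAt (T : TensorField M) [IsManifold 𝓘(ℝ, E3) ∞ M] (x : M) : Prop :=
  ContMDiffAt 𝓘(ℝ, E3) (𝓘(ℝ, E3).prod 𝓘(ℝ, E3 →L[ℝ] E3 →L[ℝ] ℝ)) ∞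
    (fun x => Bundle.TotalSpace.mk' (E3 →L[ℝ] E3 →L[ℝ] ℝ)
      (E := fun x : M =>
        TangentSpace 𝓘(ℝ, E3) x →L[ℝ] TangentSpace 𝓘(ℝ, E3) x →L[ℝ] ℝ) x (T x)) x

theorem eq_sum_basisVec (v : E3) : v = ∑ i, v i • basisVec i := by
  ext k
  simp [basisVec, Pi.single_apply]

/-- A bilinear form on `ℝ³` is a combination of the nine products of coordinate functionals, its
coefficients being its values on basis vectors. -/
theorem contMDiffAt_of_forall_apply {f : M → E3 →L[ℝ] E3 →L[ℝ] ℝ} {x : M}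
    (h : ∀ v w, ContMDiffAt 𝓘(ℝ, E3) 𝓘(ℝ, ℝ) ∞ (fun y => f y v w) x) :
    ContMDiffAt 𝓘(ℝ, E3) 𝓘(ℝ, E3 →L[ℝ] E3 →L[ℝ] ℝ) ∞ f x := by
  let β : Fin 3 → Fin 3 → E3 →L[ℝ] E3 →L[ℝ] ℝ := fun i j =>
    (EuclideanSpace.proj i : E3 →L[ℝ] ℝ).smulRight (EuclideanSpace.proj j : E3 →L[ℝ] ℝ)
  have hf : f = fun y => ∑ i, ∑ j, f y (basisVec i) (basisVec j) • β i j := by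
    ext y v w
    conv_lhs => rw [eq_sum_basisVec v, eq_sum_basisVec w]
    simp only [map_sum, map_smul, FunLike.coe_sum, Finset.sum_apply, smul_eq_mul, β,
      ContinuousLinearMap.smulRight_apply, FunLike.coe_smul, Pi.smul_apply]
    rw [Finset.sum_comm]
    refine Finset.sum_congr rfl fun i _ => ?_
    rw [Finset.mul_sum]
    refine Finset.sum_congr rfl fun j _ => ?_
    simp
    ring
  rw [hf]
  refine contMDiffAt_finsetSum fun i _ => contMDiffAt_finsetSum fun j _ => ?_
  exact (h _ _).smul contMDiffAt_const

variable [IsManifold 𝓘(ℝ, E3) ∞ M] [IsManifold 𝓘(ℝ, E3) ∞ N] [IsManifold 𝓘(ℝ, E3) ∞ P]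

/-- The vector field near `x₀` with constant components in the chart at `x₀`. -/
def frame (x₀ x : M) (v : E3) : TangentSpace 𝓘(ℝ, E3) x :=
  (trivializationAt E3 (TangentSpace 𝓘(ℝ, E3) : M → Type) x₀).symmL ℝ x v

theorem contMDiffAt_frame (x₀ : M) (v : E3) :
    ContMDiffAt 𝓘(ℝ, E3) (𝓘(ℝ, E3).prod 𝓘(ℝ, E3)) ∞
      (fun x => Bundle.TotalSpace.mk' E3 (E := (TangentSpace 𝓘(ℝ, E3) : M → Type)) x
        (frame x₀ x v)) x₀ := by
  have h := (trivializationAt E3 (TangentSpace 𝓘(ℝ, E3) : M → Type) x₀).contMDiffAt_symmL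
    (n := ∞) (IB := 𝓘(ℝ, E3)) (FiberBundle.mem_baseSet_trivializationAt' x₀)
  have hv : ContMDiffAt 𝓘(ℝ, E3) (𝓘(ℝ, E3).prod 𝓘(ℝ, E3)) ∞
      (fun x : M => Bundle.TotalSpace.mk' E3 (E := Bundle.Trivial M E3) x v) x₀ := by
    rw [Bundle.contMDiffAt_section]
    exact contMDiffAt_const
  exact h.clm_bundle_apply hv

/-- Reduces smoothness of a section of a bundle of forms to smoothness of real functions: near `x`,
the coordinate expression of `T` in the trivialization at `x` is its evaluation on the frame. -/
theorem smoothTensorAt_iff {T : TensorField M} {x : M} :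
    SmoothTensorAt T x ↔
      ∀ v w, ContMDiffAt 𝓘(ℝ, E3) 𝓘(ℝ, ℝ) ∞ (fun y => T y (frame x y v) (frame x y w)) x := by
  constructor
  · intro h v w
    have := h.clm_bundle_apply₂ (contMDiffAt_frame x v) (contMDiffAt_frame x w)
      (E₃ := Bundle.Trivial M ℝ)
    rw [Bundle.contMDiffAt_section] at this
    exact this
  · intro h
    unfold SmoothTensorAt
    rw [contMDiffAt_hom_bundle]
    refine ⟨contMDiffAt_id, ?_⟩
    refine contMDiffAt_of_forall_apply ?_
    intro v w
    refine (h v w).congr_of_eventuallyEq ?_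
    have : (trivializationAt E3 (TangentSpace 𝓘(ℝ, E3) : M → Type) x).baseSet ∈ 𝓝 x :=
      (Bundle.Trivialization.open_baseSet _).mem_nhds
        (FiberBundle.mem_baseSet_trivializationAt' x)
    filter_upwards [this] with y hy
    rw [inCoordinates_apply_eq₂ hy hy (by simp)]
    simp only [frame, Bundle.Trivialization.symmL_apply _ hy]
    simp

theorem contMDiffAt_mfderiv_frame {F : M → N} {x : M}
    (hF : ContMDiffAt 𝓘(ℝ, E3) 𝓘(ℝ, E3) ∞ F x) (v : E3) :
    ContMDiffAt 𝓘(ℝ, E3) (𝓘(ℝ, E3).prod 𝓘(ℝ, E3)) ∞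
      (fun y => Bundle.TotalSpace.mk' E3 (E := (TangentSpace 𝓘(ℝ, E3) : N → Type)) (F y)
        (mfderiv 𝓘(ℝ, E3) 𝓘(ℝ, E3) F y (frame x y v))) x :=
  ContMDiffAt.clm_apply_of_inCoordinates (b₁ := id) (hF.mfderiv_const (m := ∞) (by simp))
    (contMDiffAt_frame x v) hF

/-- On frame vectors the pullback is `T ∘ F` evaluated on two smooth vector fields along `F`, the
images of the frame under the differential. -/
theorem SmoothTensorAt.pull {F : M → N} {T : TensorField N} {x : M}
    (hT : SmoothTensorAt T (F x)) (hF : ContMDiffAt 𝓘(ℝ, E3) 𝓘(ℝ, E3) ∞ F x) :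
    SmoothTensorAt (pull F T) x := by
  rw [smoothTensorAt_iff]
  intro v w
  have := (hT.comp x hF).clm_bundle_apply₂ (contMDiffAt_mfderiv_frame hF v)
    (contMDiffAt_mfderiv_frame hF w) (E₃ := Bundle.Trivial N ℝ)
  rw [Bundle.contMDiffAt_totalSpace] at this
  exact this.2

theorem SmoothTensorAt.add {S T : TensorField M} {x : M} (hS : SmoothTensorAt S x)
    (hT : SmoothTensorAt T x) : SmoothTensorAt (fun y => S y + T y) x :=
  ContMDiffAt.add_section hS hT

theorem SmoothTensorAt.sub {S T : TensorField M} {x : M} (hS : SmoothTensorAt S x)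
    (hT : SmoothTensorAt T x) : SmoothTensorAt (fun y => S y - T y) x :=
  ContMDiffAt.sub_section hS hT

theorem SmoothTensorAt.congr {S T : TensorField M} {x : M} (hS : SmoothTensorAt S x)
    (h : ∀ᶠ y in 𝓝 x, T y = S y) : SmoothTensorAt T x :=
  ContMDiffAt.congr_of_eventuallyEq hS (h.mono fun y hy => by simp only [hy])

/-- On `ℝ³` itself the frame is constant, so bundle smoothness is smoothness of the usual
components. -/
theorem SmoothTensorAt.contDiffAt {T : TensorField E3} {y : E3} (hT : SmoothTensorAt T y)
    (v w : E3) : ContDiffAt ℝ ∞ (fun z => T z v w) y := by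
  rw [← contMDiffAt_iff_contDiffAt]
  refine (smoothTensorAt_iff.1 hT v w).congr_of_eventuallyEq (Filter.Eventually.of_forall ?_)
  intro z
  simp [frame]
  rfl

end Tensors
end Penrose

namespace Penrose

/-! ### Locality and continuity of the constraint quantities -/

section Germs

variable {G G' K K' : E3 → Matrix (Fin 3) (Fin 3) ℝ} {y : E3}

/-- Equality of germs, not merely of values, is propagated because the curvature differentiates the
metric twice. -/
theorem pd_congr {f f' : E3 → ℝ} (i : Fin 3) (h : f =ᶠ[𝓝 y] f') : pd i f =ᶠ[𝓝 y] pd i f' :=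
  h.fderiv.fun_comp (fun L => L (basisVec i))

theorem entry_congr (h : G =ᶠ[𝓝 y] G') (i j : Fin 3) :
    (fun z => G z i j) =ᶠ[𝓝 y] fun z => G' z i j :=
  h.mono fun z hz => by simp only [hz]

theorem christoffel_congr (h : G =ᶠ[𝓝 y] G') (k i j : Fin 3) :
    christoffel G k i j =ᶠ[𝓝 y] christoffel G' k i j := by
  have hp : ∀ a b c, pd a (fun z => G z b c) =ᶠ[𝓝 y] pd a (fun z => G' z b c) :=
    fun a b c => pd_congr a (entry_congr h b c)
  simp only [← Filter.eventually_all, Filter.EventuallyEq] at hp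
  filter_upwards [h, hp] with z hz hz'
  simp only [christoffel, hz, hz']

theorem ricci_congr (h : G =ᶠ[𝓝 y] G') (i j : Fin 3) : ricci G i j =ᶠ[𝓝 y] ricci G' i j := by
  have hc := christoffel_congr h
  have hp : ∀ a b c d, pd a (christoffel G b c d) =ᶠ[𝓝 y] pd a (christoffel G' b c d) :=
    fun a b c d => pd_congr a (hc b c d)
  simp only [← Filter.eventually_all, Filter.EventuallyEq] at hp hc
  filter_upwards [hc, hp] with z hz hz'
  simp only [ricci, hz, hz']

theorem scalarCurv_congr (h : G =ᶠ[𝓝 y] G') : scalarCurv G =ᶠ[𝓝 y] scalarCurv G' := by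
  have hp := ricci_congr h
  simp only [← Filter.eventually_all, Filter.EventuallyEq] at hp
  filter_upwards [h, hp] with z hz hz'
  simp only [scalarCurv, hz, hz']

theorem momentumTensor_congr (h : G =ᶠ[𝓝 y] G') (hK : K =ᶠ[𝓝 y] K') (i j : Fin 3) :
    momentumTensor G K i j =ᶠ[𝓝 y] momentumTensor G' K' i j := by
  filter_upwards [h, hK] with z hz hz'
  simp only [momentumTensor, raise, traceK, hz, hz']

theorem energyDensity_congr (h : G =ᶠ[𝓝 y] G') (hK : K =ᶠ[𝓝 y] K') :
    energyDensity G K y = energyDensity G' K' y := by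
  simp only [energyDensity, raise, traceK, h.self_of_nhds, hK.self_of_nhds,
    (scalarCurv_congr h).self_of_nhds]

theorem currentNorm_congr (h : G =ᶠ[𝓝 y] G') (hK : K =ᶠ[𝓝 y] K') :
    currentNorm G K y = currentNorm G' K' y := by
  have h1 : ∀ a b, momentumTensor G K a b y = momentumTensor G' K' a b y :=
    fun a b => (momentumTensor_congr h hK a b).self_of_nhds
  have h2 : ∀ a b c, pd a (momentumTensor G K b c) y = pd a (momentumTensor G' K' b c) y :=
    fun a b c => (pd_congr a (momentumTensor_congr h hK b c)).self_of_nhds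
  have h3 : ∀ a b c, christoffel G a b c y = christoffel G' a b c y :=
    fun a b c => (christoffel_congr h a b c).self_of_nhds
  simp only [currentNorm, currentDensity, h.self_of_nhds, h1, h2, h3]

end Germs

section Smoothness

variable {G K : E3 → Matrix (Fin 3) (Fin 3) ℝ} {y : E3}

theorem contDiffAt_pd {f : E3 → ℝ} (i : Fin 3) (hf : ContDiffAt ℝ ∞ f y) :
    ContDiffAt ℝ ∞ (pd i f) y :=
  (hf.fderiv_right (m := ∞) (by simp)).clm_apply contDiffAt_const

theorem contDiffAt_det (hG : ∀ i j, ContDiffAt ℝ ∞ (fun z => G z i j) y) :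
    ContDiffAt ℝ ∞ (fun z => (G z).det) y := by
  simp only [Matrix.det_fin_three]
  have h := hG
  fun_prop

/-- Cramer's rule: an entry of the adjugate is the determinant of the matrix with one row replaced
by a constant basis vector. -/
theorem contDiffAt_inv (hG : ∀ i j, ContDiffAt ℝ ∞ (fun z => G z i j) y) (hd : (G y).det ≠ 0)
    (i j : Fin 3) : ContDiffAt ℝ ∞ (fun z => (G z)⁻¹ i j) y := by
  simp only [Matrix.inv_def, Ring.inverse_eq_inv', Matrix.smul_apply, smul_eq_mul,
    Matrix.adjugate_apply]
  refine ((contDiffAt_det hG).inv hd).mul (contDiffAt_det fun a b => ?_)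
  by_cases h : a = j
  · subst h
    simpa using contDiffAt_const
  · simpa [Matrix.updateRow_ne h] using hG a b

theorem contDiffAt_christoffel (hG : ∀ i j, ContDiffAt ℝ ∞ (fun z => G z i j) y)
    (hd : (G y).det ≠ 0) (k i j : Fin 3) : ContDiffAt ℝ ∞ (christoffel G k i j) y := by
  unfold christoffel
  have h1 := contDiffAt_inv hG hd
  have h2 : ∀ a b c, ContDiffAt ℝ ∞ (pd a (fun z => G z b c)) y :=
    fun a b c => contDiffAt_pd a (hG b c)
  exact contDiffAt_const.mul (ContDiffAt.sum fun l _ =>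
    (h1 k l).mul (((h2 _ _ _).add (h2 _ _ _)).sub (h2 _ _ _)))

theorem contDiffAt_ricci (hG : ∀ i j, ContDiffAt ℝ ∞ (fun z => G z i j) y)
    (hd : (G y).det ≠ 0) (i j : Fin 3) : ContDiffAt ℝ ∞ (ricci G i j) y := by
  unfold ricci
  have h1 := contDiffAt_christoffel hG hd
  have h2 : ∀ a b c d, ContDiffAt ℝ ∞ (pd a (christoffel G b c d)) y :=
    fun a b c d => contDiffAt_pd a (h1 b c d)
  exact ContDiffAt.sum fun k _ => ((h2 _ _ _ _).sub (h2 _ _ _ _)).add (ContDiffAt.sum fun l _ =>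
    ((h1 _ _ _).mul (h1 _ _ _)).sub ((h1 _ _ _).mul (h1 _ _ _)))

theorem contDiffAt_scalarCurv (hG : ∀ i j, ContDiffAt ℝ ∞ (fun z => G z i j) y)
    (hd : (G y).det ≠ 0) : ContDiffAt ℝ ∞ (scalarCurv G) y :=
  ContDiffAt.sum fun i _ => ContDiffAt.sum fun j _ =>
    (contDiffAt_inv hG hd i j).mul (contDiffAt_ricci hG hd i j)

variable (hG : ∀ i j, ContDiffAt ℝ ∞ (fun z => G z i j) y) (hd : (G y).det ≠ 0)
  (hK : ∀ i j, ContDiffAt ℝ ∞ (fun z => K z i j) y)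

include hG hd hK

theorem contDiffAt_raise (i j : Fin 3) : ContDiffAt ℝ ∞ (raise G K i j) y :=
  ContDiffAt.sum fun a _ => ContDiffAt.sum fun b _ =>
    ((contDiffAt_inv hG hd i a).mul (contDiffAt_inv hG hd j b)).mul (hK a b)

theorem contDiffAt_traceK : ContDiffAt ℝ ∞ (traceK G K) y :=
  ContDiffAt.sum fun a _ => ContDiffAt.sum fun b _ => (contDiffAt_inv hG hd a b).mul (hK a b)

theorem contDiffAt_momentumTensor (i j : Fin 3) : ContDiffAt ℝ ∞ (momentumTensor G K i j) y :=
  (contDiffAt_raise hG hd hK i j).sub ((contDiffAt_traceK hG hd hK).mul (contDiffAt_inv hG hd i j))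

theorem contDiffAt_currentDensity (i : Fin 3) : ContDiffAt ℝ ∞ (currentDensity G K i) y := by
  have h1 := contDiffAt_momentumTensor hG hd hK
  have h2 := contDiffAt_christoffel hG hd
  exact contDiffAt_const.mul (ContDiffAt.sum fun j _ => (contDiffAt_pd j (h1 i j)).add
    (ContDiffAt.sum fun k _ => ((h2 _ _ _).mul (h1 _ _)).add ((h2 _ _ _).mul (h1 _ _))))

/-- Continuity of both sides is what carries the dominant energy condition to the points of a seam.
-/
theorem continuousAt_energyDensity : ContinuousAt (energyDensity G K) y := by
  have : ContDiffAt ℝ ∞ (energyDensity G K) y :=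
    contDiffAt_const.mul (((contDiffAt_scalarCurv hG hd).sub
      (ContDiffAt.sum fun i _ => ContDiffAt.sum fun j _ =>
        (contDiffAt_raise hG hd hK i j).mul (hK i j))).add
      ((contDiffAt_traceK hG hd hK).pow 2))
  exact this.continuousAt

theorem continuousAt_currentNorm : ContinuousAt (currentNorm G K) y := by
  have h := contDiffAt_currentDensity hG hd hK
  have : ContDiffAt ℝ ∞ (fun y => ∑ i, ∑ j, G y i j * currentDensity G K i y *
      currentDensity G K j y) y :=
    ContDiffAt.sum fun i _ => ContDiffAt.sum fun j _ => ((hG i j).mul (h i)).mul (h j)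
  exact this.continuousAt.sqrt

end Smoothness

/-! ### Smooth partial diffeomorphisms -/

section Diffeos

variable {M N P : Type} [TopologicalSpace M] [ChartedSpace E3 M]
  [TopologicalSpace N] [ChartedSpace E3 N] [TopologicalSpace P] [ChartedSpace E3 P]

/-- `φ` is a diffeomorphism between its source and its target. -/
def IsDiffeo (φ : OpenPartialHomeomorph M N) : Prop :=
  ContMDiffOn 𝓘(ℝ, E3) 𝓘(ℝ, E3) ∞ φ φ.source ∧ ContMDiffOn 𝓘(ℝ, E3) 𝓘(ℝ, E3) ∞ φ.symm φ.target

theorem IsDiffeo.symm {φ : OpenPartialHomeomorph M N} (h : IsDiffeo φ) : IsDiffeo φ.symm :=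
  ⟨h.2, h.1⟩

theorem IsDiffeo.trans {φ : OpenPartialHomeomorph M N} {ψ : OpenPartialHomeomorph N P}
    (h : IsDiffeo φ) (h' : IsDiffeo ψ) : IsDiffeo (φ ≫ₕ ψ) :=
  ⟨h'.1.comp (h.1.mono fun _ hx => hx.1) fun _ hx => hx.2,
    h.2.comp (h'.2.mono fun _ hx => hx.1) fun _ hx => hx.2⟩

theorem IsDiffeo.restr {φ : OpenPartialHomeomorph M N} (h : IsDiffeo φ) {s : Set M}
    (hs : IsOpen s) : IsDiffeo (φ.restrOpen s hs) :=
  ⟨h.1.mono fun _ hx => hx.1, h.2.mono fun _ hx => hx.1⟩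

theorem IsDiffeo.contMDiffAt {φ : OpenPartialHomeomorph M N} (h : IsDiffeo φ) {x : M}
    (hx : x ∈ φ.source) : ContMDiffAt 𝓘(ℝ, E3) 𝓘(ℝ, E3) ∞ φ x :=
  h.1.contMDiffAt (φ.open_source.mem_nhds hx)

theorem IsDiffeo.mdifferentiableAt {φ : OpenPartialHomeomorph M N} (h : IsDiffeo φ) {x : M}
    (hx : x ∈ φ.source) : MDifferentiableAt 𝓘(ℝ, E3) 𝓘(ℝ, E3) φ x :=
  (h.contMDiffAt hx).mdifferentiableAt (by simp)

theorem IsDiffeo.mfderiv_symm_mfderiv {φ : OpenPartialHomeomorph M N} (h : IsDiffeo φ) {x : M}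
    (hx : x ∈ φ.source) (v : TangentSpace 𝓘(ℝ, E3) x) :
    mfderiv 𝓘(ℝ, E3) 𝓘(ℝ, E3) φ.symm (φ x) (mfderiv 𝓘(ℝ, E3) 𝓘(ℝ, E3) φ x v) = v := by
  have h1 := mfderiv_comp x (h.symm.mdifferentiableAt (φ.map_source hx)) (h.mdifferentiableAt hx)
  have h2 : φ.symm ∘ φ =ᶠ[𝓝 x] id := by
    filter_upwards [φ.open_source.mem_nhds hx] with z hz using φ.left_inv hz
  rw [h2.mfderiv_eq, mfderiv_id] at h1
  exact (DFunLike.congr_fun h1 v).symm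

theorem IsDiffeo.mfderiv_injective {φ : OpenPartialHomeomorph M N} (h : IsDiffeo φ) {x : M}
    (hx : x ∈ φ.source) : Function.Injective (mfderiv 𝓘(ℝ, E3) 𝓘(ℝ, E3) φ x) :=
  Function.LeftInverse.injective
    (g := mfderiv 𝓘(ℝ, E3) 𝓘(ℝ, E3) φ.symm (φ x)) (h.mfderiv_symm_mfderiv hx)

theorem IsDiffeo.pull_symm_pull {φ : OpenPartialHomeomorph M N} (h : IsDiffeo φ)
    (T : TensorField M) {x : M} (hx : x ∈ φ.source) : pull φ (pull φ.symm T) x = T x := by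
  rw [← pull_comp T (h.symm.mdifferentiableAt (φ.map_source hx)) (h.mdifferentiableAt hx),
    pull_congr (F' := id), pull_id]
  filter_upwards [φ.open_source.mem_nhds hx] with z hz using φ.left_inv hz

theorem isDiffeo_of_mem_maximalAtlas [IsManifold 𝓘(ℝ, E3) ∞ M] {e : OpenPartialHomeomorph M E3}
    (he : e ∈ IsManifold.maximalAtlas 𝓘(ℝ, E3) ∞ M) : IsDiffeo e :=
  (IsManifold.mem_maximalAtlas_iff_contMDiffOn e).1 he

theorem IsDiffeo.mem_maximalAtlas [IsManifold 𝓘(ℝ, E3) ∞ M] {e : OpenPartialHomeomorph M E3}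
    (he : IsDiffeo e) : e ∈ IsManifold.maximalAtlas 𝓘(ℝ, E3) ∞ M :=
  (IsManifold.mem_maximalAtlas_iff_contMDiffOn e).2 he

end Diffeos

namespace CauchyData

variable (D : CauchyData)

theorem components_apply (T : TensorField D.carrier) (e : OpenPartialHomeomorph D.carrier E3)
    (y : E3) (i j : Fin 3) :
    D.components T e y i j = pull e.symm T y (basisVec i) (basisVec j) := rfl

theorem components_congr {D' : CauchyData} {T : TensorField D.carrier}
    {T' : TensorField D'.carrier} {e : OpenPartialHomeomorph D.carrier E3}
    {e' : OpenPartialHomeomorph D'.carrier E3} {y : E3}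
    (h : pull e.symm T y = pull e'.symm T' y) : D.components T e y = D'.components T' e' y := by
  ext i j
  rw [components_apply, components_apply, h]

theorem smooth_g (x : D.carrier) : SmoothTensorAt D.g.inner x := D.g.contMDiff x

theorem smooth_h (x : D.carrier) : SmoothTensorAt D.h x := D.h_smooth x

variable {D} {e : OpenPartialHomeomorph D.carrier E3} (he : IsDiffeo e) {y : E3}
  (hy : y ∈ e.target)

include he hy

theorem contDiffAt_components {T : TensorField D.carrier} (hT : SmoothTensorAt T (e.symm y))
    (i j : Fin 3) : ContDiffAt ℝ ∞ (fun z => D.components T e z i j) y :=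
  (hT.pull (he.symm.contMDiffAt hy)).contDiffAt _ _

/-- A kernel vector of the Gram matrix would be the coordinate vector of a nonzero tangent vector of
length zero. -/
theorem det_components_ne_zero : (D.components D.g.inner e y).det ≠ 0 := by
  intro h0
  obtain ⟨v, hv, hv0⟩ := Matrix.exists_mulVec_eq_zero_iff.2 h0
  let w : E3 := WithLp.toLp 2 v
  have hw : w ≠ 0 := fun h => hv (by
    ext i
    exact congrArg (fun u : E3 => u i) h)
  have h1 : mfderiv 𝓘(ℝ, E3) 𝓘(ℝ, E3) e.symm y w ≠ 0 := fun h =>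
    hw (he.symm.mfderiv_injective hy (h.trans (map_zero _).symm))
  have h2 := D.g.pos _ _ h1
  have h3 : pull e.symm D.g.inner y w w = 0 := by
    have hB : ∀ B : E3 →L[ℝ] E3 →L[ℝ] ℝ,
        B w w = ∑ i, w i * ∑ j, B (basisVec i) (basisVec j) * w j := by
      intro B
      conv_lhs => rw [eq_sum_basisVec w]
      simp only [map_sum, map_smul, FunLike.coe_sum, Finset.sum_apply, smul_eq_mul,
        FunLike.coe_smul, Pi.smul_apply, Finset.mul_sum]
      rw [Finset.sum_comm]
      exact Finset.sum_congr rfl fun i _ => Finset.sum_congr rfl fun j _ => by ring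
    refine (hB (pull e.symm D.g.inner y)).trans ?_
    exact Finset.sum_eq_zero fun i _ => mul_eq_zero_of_right _ (congrFun hv0 i)
  exact h2.ne' h3

theorem continuousAt_energyDensity_components :
    ContinuousAt (energyDensity (D.components D.g.inner e) (D.components D.h e)) y :=
  continuousAt_energyDensity (contDiffAt_components he hy (D.smooth_g _))
    (det_components_ne_zero he hy) (contDiffAt_components he hy (D.smooth_h _))

theorem continuousAt_currentNorm_components :
    ContinuousAt (currentNorm (D.components D.g.inner e) (D.components D.h e)) y :=
  continuousAt_currentNorm (contDiffAt_components he hy (D.smooth_g _))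
    (det_components_ne_zero he hy) (contDiffAt_components he hy (D.smooth_h _))

end CauchyData

end Penrose

namespace Penrose

/-! ### Gluing two spaces along open subsets -/

section Gluing

/-- Open subsets `U`, `V` of two spaces, glued along a homeomorphism between open parts of them. -/
theorem exists_glued_space {A B : Type} [TopologicalSpace A] [TopologicalSpace B] [T2Space A]
    [T2Space B] [SecondCountableTopology A] [SecondCountableTopology B]
    (ψ : OpenPartialHomeomorph A B) {U : Set A} {V : Set B} (hU : IsOpen U) (hV : IsOpen V)
    (hUne : U.Nonempty) (hVne : V.Nonempty) (hψU : ψ.source ⊆ U) (hψV : ψ.target ⊆ V)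
    (hsep : ∀ a ∈ U, ∀ b ∈ V, ¬ (a ∈ ψ.source ∧ ψ a = b) →
      ∃ O ∈ 𝓝 a, ∃ W ∈ 𝓝 b, ∀ a' ∈ O, a' ∈ ψ.source → ψ a' ∉ W) :
    ∃ (Q : Type) (_ : TopologicalSpace Q) (_ : T2Space Q) (_ : SecondCountableTopology Q)
      (j : OpenPartialHomeomorph A Q) (k : OpenPartialHomeomorph B Q),
      j.source = U ∧ k.source = V ∧ j.target ∪ k.target = Set.univ ∧
      ∀ a ∈ U, ∀ b ∈ V, j a = k b ↔ a ∈ ψ.source ∧ ψ a = b := by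
  classical
  -- `f` picks a canonical representative, moving points of `ψ.target` back to `A`. The gluing
  -- relation is the kernel of `f`, hence automatically an equivalence relation.
  let f : U ⊕ V → A ⊕ B := Sum.elim (fun a => Sum.inl a)
    (fun b => if (b : B) ∈ ψ.target then Sum.inl (ψ.symm b) else Sum.inr b)
  let Q := Quotient (Setoid.ker f)
  let mk : U ⊕ V → Q := Quotient.mk _
  have hmk : ∀ x y, mk x = mk y ↔ f x = f y := fun x y => Quotient.eq (r := Setoid.ker f)
  have hll : ∀ a a' : U, mk (Sum.inl a) = mk (Sum.inl a') ↔ a = a' := by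
    intro a a'
    simp [hmk, f, Subtype.ext_iff]
  have hlr : ∀ (a : U) (b : V), mk (Sum.inl a) = mk (Sum.inr b) ↔
      (a : A) ∈ ψ.source ∧ ψ a = b := by
    intro a b
    rw [hmk]
    by_cases hb : (b : B) ∈ ψ.target
    · simp only [f, Sum.elim_inl, Sum.elim_inr, hb, if_true, Sum.inl.injEq]
      constructor
      · intro h
        rw [h]
        exact ⟨ψ.map_target hb, ψ.right_inv hb⟩
      · rintro ⟨h1, h2⟩
        rw [← h2, ψ.left_inv h1]
    · simp only [f, Sum.elim_inl, Sum.elim_inr, hb, if_false, reduceCtorEq, false_iff]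
      rintro ⟨h1, h2⟩
      exact hb (h2 ▸ ψ.map_source h1)
  have hrr : ∀ b b' : V, mk (Sum.inr b) = mk (Sum.inr b') ↔ b = b' := by
    intro b b'
    rw [hmk]
    simp only [f, Sum.elim_inr]
    refine ⟨fun h => ?_, fun h => by rw [h]⟩
    split_ifs at h with h1 h2 h2
    · exact Subtype.ext (ψ.symm.injOn h1 h2 (Sum.inl.inj h))
    · exact Subtype.ext (Sum.inr.inj h)
  have hcont : Continuous mk := continuous_quot_mk
  have hjc : Continuous (fun a => mk (Sum.inl a)) := hcont.comp continuous_inl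
  have hkc : Continuous (fun b => mk (Sum.inr b)) := hcont.comp continuous_inr
  have hjo : IsOpenMap (fun a => mk (Sum.inl a)) := by
    intro O hO
    refine isOpen_coinduced.2 (isOpen_sum_iff.2 ⟨?_, ?_⟩)
    · convert hO using 1
      ext a
      simp only [Set.mem_preimage, Set.mem_image]
      exact ⟨fun ⟨a', ha', h⟩ => (hll _ _).1 h ▸ ha', fun h => ⟨a, h, rfl⟩⟩
    · obtain ⟨O', hO', rfl⟩ := isOpen_induced_iff.1 hO
      have h1 : IsOpen (ψ.target ∩ ψ.symm ⁻¹' O') := ψ.symm.isOpen_inter_preimage hO'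
      convert h1.preimage continuous_subtype_val using 1
      ext b
      simp only [Set.mem_preimage, Set.mem_image, Set.mem_inter_iff]
      constructor
      · rintro ⟨a, ha, h⟩
        obtain ⟨h1, h2⟩ := (hlr _ _).1 h
        rw [← h2, ψ.left_inv h1]
        exact ⟨ψ.map_source h1, ha⟩
      · rintro ⟨hb, h⟩
        exact ⟨⟨ψ.symm b, hψU (ψ.map_target hb)⟩, h,
          (hlr _ _).2 ⟨ψ.map_target hb, ψ.right_inv hb⟩⟩
  have hko : IsOpenMap (fun b => mk (Sum.inr b)) := by
    intro O hO
    refine isOpen_coinduced.2 (isOpen_sum_iff.2 ⟨?_, ?_⟩)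
    · obtain ⟨O', hO', rfl⟩ := isOpen_induced_iff.1 hO
      have h1 : IsOpen (ψ.source ∩ ψ ⁻¹' O') := ψ.isOpen_inter_preimage hO'
      convert h1.preimage continuous_subtype_val using 1
      ext a
      simp only [Set.mem_preimage, Set.mem_image, Set.mem_inter_iff]
      constructor
      · rintro ⟨b, hb, h⟩
        obtain ⟨h1, h2⟩ := (hlr _ _).1 h.symm
        rw [h2]
        exact ⟨h1, hb⟩
      · rintro ⟨ha, h⟩
        exact ⟨⟨ψ a, hψV (ψ.map_source ha)⟩, h, ((hlr _ _).2 ⟨ha, rfl⟩).symm⟩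
    · convert hO using 1
      ext a
      simp only [Set.mem_preimage, Set.mem_image]
      exact ⟨fun ⟨a', ha', h⟩ => (hrr _ _).1 h ▸ ha', fun h => ⟨a, h, rfl⟩⟩
  have hje : Topology.IsOpenEmbedding (fun a => mk (Sum.inl a)) :=
    .of_continuous_injective_isOpenMap hjc (fun a a' h => (hll a a').1 h) hjo
  have hke : Topology.IsOpenEmbedding (fun b => mk (Sum.inr b)) :=
    .of_continuous_injective_isOpenMap hkc (fun a a' h => (hrr a a').1 h) hko
  -- Openness of the quotient map is what makes the quotient second countable.
  have hopen : IsOpenMap mk := by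
    intro O hO
    have : mk '' O = (fun a => mk (Sum.inl a)) '' (Sum.inl ⁻¹' O) ∪
        (fun b => mk (Sum.inr b)) '' (Sum.inr ⁻¹' O) := by
      ext q
      constructor
      · rintro ⟨a | b, h, rfl⟩
        · exact Or.inl ⟨a, h, rfl⟩
        · exact Or.inr ⟨b, h, rfl⟩
      · rintro (⟨a, h, rfl⟩ | ⟨b, h, rfl⟩)
        · exact ⟨_, h, rfl⟩
        · exact ⟨_, h, rfl⟩
    rw [this]
    exact (hjo _ (hO.preimage continuous_inl)).union (hko _ (hO.preimage continuous_inr))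
  -- A partial homeomorphism has a total inverse, so inverting the inclusions of `U` and `V`
  -- requires points in them.
  have : Nonempty U := hUne.to_subtype
  have : Nonempty V := hVne.to_subtype
  let j : OpenPartialHomeomorph A Q :=
    (TopologicalSpace.Opens.openPartialHomeomorphSubtypeCoe ⟨U, hU⟩ ‹_›).symm ≫ₕ
      hje.toOpenPartialHomeomorph
  let k : OpenPartialHomeomorph B Q :=
    (TopologicalSpace.Opens.openPartialHomeomorphSubtypeCoe ⟨V, hV⟩ ‹_›).symm ≫ₕ
      hke.toOpenPartialHomeomorph
  have hj : ∀ a : U, j a = mk (Sum.inl a) := fun a => by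
    have := (TopologicalSpace.Opens.openPartialHomeomorphSubtypeCoe ⟨U, hU⟩ ‹_›).left_inv
      (x := a) (by simp)
    exact congrArg (fun a => mk (Sum.inl a)) this
  have hk : ∀ b : V, k b = mk (Sum.inr b) := fun b => by
    have := (TopologicalSpace.Opens.openPartialHomeomorphSubtypeCoe ⟨V, hV⟩ ‹_›).left_inv
      (x := b) (by simp)
    exact congrArg (fun a => mk (Sum.inr a)) this
  have hjs : j.source = U := by simp [j]
  have hks : k.source = V := by simp [k]
  have hmixed : ∀ (a : U) (b : V), mk (Sum.inl a) ≠ mk (Sum.inr b) →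
      ∃ O W : Set Q, IsOpen O ∧ IsOpen W ∧ mk (Sum.inl a) ∈ O ∧ mk (Sum.inr b) ∈ W ∧
        Disjoint O W := by
    intro a b hab
    obtain ⟨O, hO, W, hW, h⟩ := hsep a a.2 b b.2 (mt (hlr a b).2 hab)
    obtain ⟨O', hO', hO'o, haO⟩ := mem_nhds_iff.1 hO
    obtain ⟨W', hW', hW'o, hbW⟩ := mem_nhds_iff.1 hW
    refine ⟨_, _, hjo _ (hO'o.preimage continuous_subtype_val),
      hko _ (hW'o.preimage continuous_subtype_val), ⟨a, haO, rfl⟩, ⟨b, hbW, rfl⟩, ?_⟩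
    rw [Set.disjoint_left]
    rintro _ ⟨a', ha', rfl⟩ ⟨b', hb', h'⟩
    obtain ⟨h1, h2⟩ := (hlr _ _).1 h'.symm
    exact h a' (hO' ha') h1 (h2 ▸ hW' hb')
  refine ⟨Q, inferInstance, ⟨?_⟩, TopologicalSpace.Quotient.secondCountableTopology hopen, j, k, hjs, hks, ?_, ?_⟩
  · intro p q hpq
    obtain ⟨x, rfl⟩ := Quotient.exists_rep p
    obtain ⟨y, rfl⟩ := Quotient.exists_rep q
    rcases x with a | b <;> rcases y with a' | b'
    · obtain ⟨O, W, hO, hW, h1, h2, h3⟩ := t2_separation (fun h => hpq (congrArg (fun a => mk (Sum.inl a)) h))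
      exact ⟨_, _, hjo _ hO, hjo _ hW, ⟨_, h1, rfl⟩, ⟨_, h2, rfl⟩,
        (Set.disjoint_image_iff hje.injective).2 h3⟩
    · exact hmixed a b' hpq
    · obtain ⟨O, W, hO, hW, h1, h2, h3⟩ := hmixed a' b (Ne.symm hpq)
      exact ⟨W, O, hW, hO, h2, h1, h3.symm⟩
    · obtain ⟨O, W, hO, hW, h1, h2, h3⟩ := t2_separation (fun h => hpq (congrArg (fun a => mk (Sum.inr a)) h))
      exact ⟨_, _, hko _ hO, hko _ hW, ⟨_, h1, rfl⟩, ⟨_, h2, rfl⟩,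
        (Set.disjoint_image_iff hke.injective).2 h3⟩
  · refine Set.eq_univ_of_forall fun q => ?_
    obtain ⟨x, rfl⟩ := Quotient.exists_rep q
    rcases x with a | b
    · have := j.map_source (x := a) (hjs.symm ▸ a.2 : (a : A) ∈ j.source)
      rw [hj a] at this
      exact Or.inl this
    · have := k.map_source (x := b) (hks.symm ▸ b.2 : (b : B) ∈ k.source)
      rw [hk b] at this
      exact Or.inr this
  · intro a ha b hb
    rw [hj ⟨a, ha⟩, hk ⟨b, hb⟩, hlr]

variable {A B Q : Type} [TopologicalSpace A] [TopologicalSpace B] [TopologicalSpace Q]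
  [ChartedSpace E3 A] [ChartedSpace E3 B]

open Classical in
/-- The charts of a space covered by open parts of two manifolds. -/
@[reducible] def gluedCharts (j : OpenPartialHomeomorph A Q) (k : OpenPartialHomeomorph B Q)
    (hcov : j.target ∪ k.target = Set.univ) : ChartedSpace E3 Q where
  atlas := {e | ∃ e' ∈ atlas E3 A, e = j.symm ≫ₕ e'} ∪ {e | ∃ e' ∈ atlas E3 B, e = k.symm ≫ₕ e'}
  chartAt q := if q ∈ j.target then j.symm ≫ₕ chartAt E3 (j.symm q)
    else k.symm ≫ₕ chartAt E3 (k.symm q)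
  mem_chart_source q := by
    split_ifs with h
    · simp [h]
    · have : q ∈ k.target := ((Set.eq_univ_iff_forall.1 hcov q).resolve_left h)
      simp [this]
  chart_mem_atlas q := by
    split_ifs with h
    · exact Or.inl ⟨_, chart_mem_atlas _ _, rfl⟩
    · exact Or.inr ⟨_, chart_mem_atlas _ _, rfl⟩

/-- Locally `j` is a chart of `A` followed by the inverse of a chart of `Q`. -/
theorem isDiffeo_of_atlas_trans [ChartedSpace E3 Q] [IsManifold 𝓘(ℝ, E3) ∞ A]
    [IsManifold 𝓘(ℝ, E3) ∞ Q] (j : OpenPartialHomeomorph A Q)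
    (h : ∀ e ∈ atlas E3 A, j.symm ≫ₕ e ∈ atlas E3 Q) : IsDiffeo j := by
  constructor
  · intro x hx
    have he := isDiffeo_of_mem_maximalAtlas (IsManifold.chart_mem_maximalAtlas
      (I := 𝓘(ℝ, E3)) (n := ∞) x)
    have hc := isDiffeo_of_mem_maximalAtlas (IsManifold.subset_maximalAtlas
      (I := 𝓘(ℝ, E3)) (n := ∞) (h _ (chart_mem_atlas E3 x)))
    have hxs := mem_chart_source E3 x
    have h1 := hc.symm.contMDiffAt (x := chartAt E3 x x) (by simp [hx])
    refine ((h1.comp x (he.contMDiffAt hxs)).congr_of_eventuallyEq ?_).contMDiffWithinAt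
    filter_upwards [(chartAt E3 x).open_source.mem_nhds hxs] with z hz
    simp [hz]
  · intro q hq
    have he := isDiffeo_of_mem_maximalAtlas (IsManifold.chart_mem_maximalAtlas
      (I := 𝓘(ℝ, E3)) (n := ∞) (j.symm q))
    have hc := isDiffeo_of_mem_maximalAtlas (IsManifold.subset_maximalAtlas
      (I := 𝓘(ℝ, E3)) (n := ∞) (h _ (chart_mem_atlas E3 (j.symm q))))
    have hxs := mem_chart_source E3 (j.symm q)
    have h1 := hc.contMDiffAt (x := q) (by simp [hq])
    have h2 := he.symm.contMDiffAt (x := chartAt E3 (j.symm q) (j.symm q)) (by simp)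
    refine ((ContMDiffAt.comp q h2 h1).congr_of_eventuallyEq ?_).contMDiffWithinAt
    filter_upwards [(j.symm.continuousAt hq).preimage_mem_nhds
      ((chartAt E3 (j.symm q)).open_source.mem_nhds hxs)] with z hz
    simp [(chartAt E3 (j.symm q)).left_inv hz]

/-- Open parts of two manifolds, glued along a diffeomorphism. -/
theorem exists_glued_manifold [T2Space A] [T2Space B] [SecondCountableTopology A]
    [SecondCountableTopology B] [IsManifold 𝓘(ℝ, E3) ∞ A] [IsManifold 𝓘(ℝ, E3) ∞ B]
    (ψ : OpenPartialHomeomorph A B) (hψ : IsDiffeo ψ) {U : Set A} {V : Set B} (hU : IsOpen U)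
    (hV : IsOpen V) (hUne : U.Nonempty) (hVne : V.Nonempty) (hψU : ψ.source ⊆ U)
    (hψV : ψ.target ⊆ V)
    (hsep : ∀ a ∈ U, ∀ b ∈ V, ¬ (a ∈ ψ.source ∧ ψ a = b) →
      ∃ O ∈ 𝓝 a, ∃ W ∈ 𝓝 b, ∀ a' ∈ O, a' ∈ ψ.source → ψ a' ∉ W) :
    ∃ (Q : Type) (_ : TopologicalSpace Q) (_ : T2Space Q) (_ : SecondCountableTopology Q)
      (_ : ChartedSpace E3 Q) (_ : IsManifold 𝓘(ℝ, E3) ∞ Q)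
      (j : OpenPartialHomeomorph A Q) (k : OpenPartialHomeomorph B Q),
      IsDiffeo j ∧ IsDiffeo k ∧
      j.source = U ∧ k.source = V ∧ j.target ∪ k.target = Set.univ ∧
      ∀ a ∈ U, ∀ b ∈ V, j a = k b ↔ a ∈ ψ.source ∧ ψ a = b := by
  obtain ⟨Q, _, h1, h2, j, k, hj, hk, hcov, hjk⟩ :=
    exists_glued_space ψ hU hV hUne hVne hψU hψV hsep
  let _ := gluedCharts j k hcov
  have hA : ∀ e ∈ atlas E3 A, IsDiffeo e := fun e he =>
    isDiffeo_of_mem_maximalAtlas (IsManifold.subset_maximalAtlas he)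
  have hB : ∀ e ∈ atlas E3 B, IsDiffeo e := fun e he =>
    isDiffeo_of_mem_maximalAtlas (IsManifold.subset_maximalAtlas he)
  have hjk' : ∀ x ∈ j.source, j x ∈ k.target → x ∈ ψ.source ∧ k.symm (j x) = ψ x := by
    intro x hx hxk
    have := (hjk x (hj ▸ hx) (k.symm (j x)) (hk ▸ k.map_target hxk)).1 (k.right_inv hxk).symm
    exact ⟨this.1, this.2.symm⟩
  have hkj' : ∀ x ∈ k.source, k x ∈ j.target → x ∈ ψ.target ∧ j.symm (k x) = ψ.symm x := by
    intro x hx hxj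
    have := (hjk (j.symm (k x)) (hj ▸ j.map_target hxj) x (hk ▸ hx)).1 (j.right_inv hxj)
    exact ⟨this.2 ▸ ψ.map_source this.1, by rw [← ψ.left_inv this.1, this.2]⟩
  have hmf : IsManifold 𝓘(ℝ, E3) ∞ Q := by
    refine isManifold_of_contDiffOn _ _ _ ?_
    simp only [modelWithCornersSelf_coe, modelWithCornersSelf_coe_symm, Function.id_comp,
      Function.comp_id, Set.range_id, Set.preimage_id, Set.inter_univ]
    simp only [← contMDiffOn_iff_contDiffOn]
    -- Transition maps between charts from the same side are those of that manifold; the mixed ones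
    -- pass through `ψ` or its inverse.
    rintro _ _ (⟨e, he, rfl⟩ | ⟨e, he, rfl⟩) (⟨e', he', rfl⟩ | ⟨e', he', rfl⟩)
    · refine ContMDiffOn.congr (f := e' ∘ e.symm) (((hA e' he').1.comp ((hA e he).2.mono ?_) ?_)) ?_
      · intro y hy
        simp only [mfld_simps] at hy
        exact hy.1.1
      · intro y hy
        simp only [mfld_simps] at hy
        have := hy.2.2
        rwa [j.left_inv hy.1.2] at this
      · intro y hy
        simp only [mfld_simps] at hy ⊢
        rw [j.left_inv hy.1.2]
    · refine ContMDiffOn.congr (f := e' ∘ ψ ∘ e.symm)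
        ((hB e' he').1.comp (hψ.1.comp ((hA e he).2.mono ?_) ?_) ?_) ?_
      all_goals
        intro y hy
        simp only [mfld_simps] at hy ⊢
      · exact hy.1.1
      · exact (hjk' _ hy.1.2 hy.2.1).1
      · rw [← (hjk' _ hy.1.2 hy.2.1).2]
        exact hy.2.2
      · rw [(hjk' _ hy.1.2 hy.2.1).2]
    · refine ContMDiffOn.congr (f := e' ∘ ψ.symm ∘ e.symm)
        ((hA e' he').1.comp (hψ.2.comp ((hB e he).2.mono ?_) ?_) ?_) ?_
      all_goals
        intro y hy
        simp only [mfld_simps] at hy ⊢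
      · exact hy.1.1
      · exact (hkj' _ hy.1.2 hy.2.1).1
      · rw [← (hkj' _ hy.1.2 hy.2.1).2]
        exact hy.2.2
      · rw [(hkj' _ hy.1.2 hy.2.1).2]
    · refine ContMDiffOn.congr (f := e' ∘ e.symm) (((hB e' he').1.comp ((hB e he).2.mono ?_) ?_)) ?_
      · intro y hy
        simp only [mfld_simps] at hy
        exact hy.1.1
      · intro y hy
        simp only [mfld_simps] at hy
        have := hy.2.2
        rwa [k.left_inv hy.1.2] at this
      · intro y hy
        simp only [mfld_simps] at hy ⊢
        rw [k.left_inv hy.1.2]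
  exact ⟨Q, _, h1, h2, _, hmf, j, k,
    isDiffeo_of_atlas_trans j fun e he => Or.inl ⟨e, he, rfl⟩,
    isDiffeo_of_atlas_trans k fun e he => Or.inr ⟨e, he, rfl⟩, hj, hk, hcov, hjk⟩

end Gluing

end Penrose

namespace Penrose

/-! ### Gluing Cauchy data -/

/-- The constant is the minimum of the form over the compact unit sphere. -/
theorem exists_le_form_of_pos (B : E3 →L[ℝ] E3 →L[ℝ] ℝ) (hB : ∀ v, v ≠ 0 → 0 < B v v) :
    ∃ c > 0, ∀ v, c * ‖v‖ ^ 2 ≤ B v v := by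
  have hcont : Continuous fun v : E3 => B v v := by fun_prop
  obtain ⟨u, hu, hmin⟩ := (isCompact_sphere (0 : E3) 1).exists_isMinOn
    (NormedSpace.sphere_nonempty.2 zero_le_one) hcont.continuousOn
  have hu1 : ‖u‖ = 1 := by simpa using hu
  refine ⟨B u u, hB u (fun h => by simp [h] at hu1), fun v => ?_⟩
  rcases eq_or_ne v 0 with rfl | hv
  · simp
  have hv' : ‖v‖ ≠ 0 := norm_ne_zero_iff.2 hv
  have h1 : B u u ≤ B (‖v‖⁻¹ • v) (‖v‖⁻¹ • v) :=
    hmin (by simp [norm_smul, hv'])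
  simp only [map_smul, FunLike.coe_smul, Pi.smul_apply, smul_eq_mul] at h1
  calc B u u * ‖v‖ ^ 2 ≤ (‖v‖⁻¹ * (‖v‖⁻¹ * B v v)) * ‖v‖ ^ 2 := by gcongr
    _ = B v v := by field_simp

theorem isVonNBounded_of_pos (B : E3 →L[ℝ] E3 →L[ℝ] ℝ) (hB : ∀ v, v ≠ 0 → 0 < B v v) :
    Bornology.IsVonNBounded ℝ {v : E3 | B v v < 1} := by
  obtain ⟨c, hc, h⟩ := exists_le_form_of_pos B hB
  rw [NormedSpace.isVonNBounded_iff, isBounded_iff_forall_norm_le]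
  refine ⟨1 + c⁻¹, fun v hv => ?_⟩
  have h1 : ‖v‖ ^ 2 ≤ c⁻¹ := by
    rw [← one_div, le_div_iff₀' hc]
    exact (h v).trans (le_of_lt hv)
  nlinarith [sq_nonneg (‖v‖ - 1), inv_pos.2 hc]

/-- The inside `Ω` of a surface in one manifold fits the outside of `Ω'` in another one: near the
surface, both continue the data of a third one. -/
structure Fitting (A B C : CauchyData) (Ω : Set A.carrier) (Ω' : Set B.carrier)
    (Ω₀ : Set C.carrier) where
  isOpen_left : IsOpen Ω
  φ : OpenPartialHomeomorph C.carrier A.carrier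
  φ' : OpenPartialHomeomorph C.carrier B.carrier
  diffeo_left : IsDiffeo φ
  diffeo_right : IsDiffeo φ'
  mem_left : ∀ x ∈ φ.source, φ x ∈ Ω ↔ x ∈ Ω₀
  mem_right : ∀ x ∈ φ'.source, φ' x ∈ Ω' ↔ x ∈ Ω₀
  pull_left_g : ∀ x ∈ φ.source, x ∉ Ω₀ → pull φ A.g.inner x = C.g.inner x
  pull_left_h : ∀ x ∈ φ.source, x ∉ Ω₀ → pull φ A.h x = C.h x
  pull_right_g : ∀ x ∈ φ'.source, x ∈ closure Ω₀ → pull φ' B.g.inner x = C.g.inner x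
  pull_right_h : ∀ x ∈ φ'.source, x ∈ closure Ω₀ → pull φ' B.h x = C.h x
  frontier_left : frontier Ω ⊆ (φ.symm ≫ₕ φ').source
  frontier_right : frontier Ω' ⊆ (φ.symm ≫ₕ φ').target

/-- Cauchy data consisting of the inside of `Ω` in `A` and the outside of `Ω'` in `B`. -/
structure Glued (A B : CauchyData) (Ω : Set A.carrier) (Ω' : Set B.carrier) where
  Q : CauchyData
  j : OpenPartialHomeomorph A.carrier Q.carrier
  k : OpenPartialHomeomorph B.carrier Q.carrier
  diffeo_left : IsDiffeo j
  diffeo_right : IsDiffeo k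
  closure_subset : closure Ω ⊆ j.source
  compl_subset : Ω'ᶜ ⊆ k.source
  cover : ∀ q, (∃ a ∈ Ω, j a = q) ∨ ∃ b ∉ Ω', k b = q
  mem_iff : ∀ a ∈ j.source, ∀ b ∈ k.source, j a = k b → (a ∈ Ω ↔ b ∈ Ω')
  frontier_left : ∀ a ∈ frontier Ω, ∃ b ∈ k.source, j a = k b
  frontier_right : ∀ b ∈ frontier Ω', ∃ a ∈ j.source, k b = j a
  pull_left_g : ∀ a ∈ closure Ω, pull j Q.g.inner a = A.g.inner a
  pull_left_h : ∀ a ∈ closure Ω, pull j Q.h a = A.h a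
  pull_right_g : ∀ b ∉ Ω', pull k Q.g.inner b = B.g.inner b
  pull_right_h : ∀ b ∉ Ω', pull k Q.h b = B.h b

section Seam

variable {A B C Q : Type} [TopologicalSpace A] [TopologicalSpace B] [TopologicalSpace C]
  [TopologicalSpace Q] [ChartedSpace E3 A] [ChartedSpace E3 B] [ChartedSpace E3 C]
  [ChartedSpace E3 Q]
  {φ : OpenPartialHomeomorph C A} {φ' : OpenPartialHomeomorph C B}
  {j : OpenPartialHomeomorph A Q} {k : OpenPartialHomeomorph B Q}

open Classical in
/-- The tensor field which is `S` on the inside `j Ω` and `T` elsewhere. -/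
def gluedTensor (j : OpenPartialHomeomorph A Q) (k : OpenPartialHomeomorph B Q) (Ω : Set A)
    (S : TensorField A) (T : TensorField B) : TensorField Q := fun q =>
  if q ∈ j.target ∩ j.symm ⁻¹' Ω then pull j.symm S q else pull k.symm T q

/-- Where `φ` pulls `S` back to `R`, the composite `φ ∘ φ.symm ∘ j.symm` is `j.symm` near `q`, so
the two transports to `Q` agree. -/
theorem pull_seam_eq (hφ : IsDiffeo φ) (hj : IsDiffeo j) {S : TensorField A} {R : TensorField C}
    {q : Q} (hq : q ∈ j.target) (hqφ : j.symm q ∈ φ.target)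
    (h : pull φ S (φ.symm (j.symm q)) = R (φ.symm (j.symm q))) :
    pull (φ.symm ∘ j.symm) R q = pull j.symm S q := by
  have h1 := hj.symm.mdifferentiableAt hq
  have h2 := hφ.symm.mdifferentiableAt hqφ
  have h3 := hφ.mdifferentiableAt (φ.map_target hqφ)
  rw [pull_congr_tensor (φ.symm ∘ j.symm) (T' := pull φ S) h.symm,
    ← pull_comp (F := φ.symm ∘ j.symm) S h3 (h2.comp q h1)]
  refine pull_congr S ?_
  filter_upwards [(j.symm.continuousAt hq).preimage_mem_nhds (φ.open_target.mem_nhds hqφ)] with z hz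
  exact φ.right_inv hz

/-- The two continuations of the data of the third manifold near the seam. -/
structure IsSeam (φ : OpenPartialHomeomorph C A) (φ' : OpenPartialHomeomorph C B)
    (j : OpenPartialHomeomorph A Q) (k : OpenPartialHomeomorph B Q) (Ω : Set A) (Ω' : Set B)
    (Ω₀ : Set C) : Prop where
  left : IsDiffeo φ
  right : IsDiffeo φ'
  hj : IsDiffeo j
  hk : IsDiffeo k
  isOpen : IsOpen Ω
  mem_left : ∀ x ∈ φ.source, φ x ∈ Ω ↔ x ∈ Ω₀
  mem_right : ∀ x ∈ φ'.source, φ' x ∈ Ω' ↔ x ∈ Ω₀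
  source_j : j.source = Ω ∪ (φ.symm ≫ₕ φ').source
  source_k : k.source = (closure Ω')ᶜ ∪ (φ.symm ≫ₕ φ').target
  cover : j.target ∪ k.target = Set.univ
  eq_iff : ∀ a ∈ j.source, ∀ b ∈ k.source, j a = k b ↔ a ∈ (φ.symm ≫ₕ φ').source ∧
    (φ.symm ≫ₕ φ') a = b

variable {Ω : Set A} {Ω' : Set B} {Ω₀ : Set C} (h : IsSeam φ φ' j k Ω Ω' Ω₀)

include h

theorem IsSeam.mem_iff {a : A} (ha : a ∈ j.source) {b : B} (hb : b ∈ k.source) (hab : j a = k b) :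
    a ∈ Ω ↔ b ∈ Ω' := by
  obtain ⟨h1, h2⟩ := (h.eq_iff a ha b hb).1 hab
  simp only [mfld_simps] at h1 h2
  rw [← h2, h.mem_right _ h1.2, ← h.mem_left _ (φ.map_target h1.1), φ.right_inv h1.1]

/-- Points of the part which the two manifolds have in common. -/
theorem IsSeam.symm_apply {q : Q} (hq : q ∈ j.target) (hqs : j.symm q ∈ (φ.symm ≫ₕ φ').source) :
    q ∈ k.target ∧ k.symm q = φ' (φ.symm (j.symm q)) := by
  have hb : (φ.symm ≫ₕ φ') (j.symm q) ∈ k.source := by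
    rw [h.source_k]
    exact Or.inr ((φ.symm ≫ₕ φ').map_source hqs)
  have := (h.eq_iff _ (j.map_target hq) _ hb).2 ⟨hqs, rfl⟩
  rw [j.right_inv hq] at this
  rw [this]
  exact ⟨k.map_source hb, by rw [k.left_inv hb, ← this]; rfl⟩

variable {S : TensorField A} {T : TensorField B} {R : TensorField C}
  (hS : ∀ x ∈ φ.source, x ∉ Ω₀ → pull φ S x = R x)
  (hT : ∀ x ∈ φ'.source, x ∈ closure Ω₀ → pull φ' T x = R x)

include hS in
theorem IsSeam.pull_outside {q : Q} (hq : q ∈ j.target)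
    (hqs : j.symm q ∈ (φ.symm ≫ₕ φ').source) (hqΩ : j.symm q ∉ Ω) :
    pull (φ.symm ∘ j.symm) R q = pull j.symm S q := by
  simp only [mfld_simps] at hqs
  refine pull_seam_eq h.left h.hj hq hqs.1 (hS _ (φ.map_target hqs.1) ?_)
  rw [← h.mem_left _ (φ.map_target hqs.1), φ.right_inv hqs.1]
  exact hqΩ

include hT in
-- Reached through `A` or through `B`, a collar point comes from the same point of the third
-- manifold, and `B` carries the third manifold's tensor on `closure Ω₀`. That this point lies in
-- `closure Ω₀` follows from continuity of `φ.symm`.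
theorem IsSeam.pull_inside {q : Q} (hq : q ∈ j.target)
    (hqs : j.symm q ∈ (φ.symm ≫ₕ φ').source) (hqΩ : j.symm q ∈ closure Ω) :
    pull (φ.symm ∘ j.symm) R q = pull k.symm T q := by
  have hs := h.symm_apply hq hqs
  have hqs' := hqs
  simp only [mfld_simps] at hqs
  have hinv : φ'.symm (k.symm q) = φ.symm (j.symm q) := by rw [hs.2, φ'.left_inv hqs.2]
  have h1 : pull (φ'.symm ∘ k.symm) R q = pull k.symm T q := by
    refine pull_seam_eq h.right h.hk hs.1 (hs.2 ▸ φ'.map_source hqs.2) ?_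
    rw [hinv]
    refine hT _ hqs.2 ?_
    have hc : ContinuousWithinAt φ.symm (Ω ∩ φ.target) (j.symm q) :=
      (φ.symm.continuousAt hqs.1).continuousWithinAt
    have hmem : j.symm q ∈ closure (Ω ∩ φ.target) := by
      rw [Set.inter_comm]
      exact φ.open_target.inter_closure ⟨hqs.1, hqΩ⟩
    refine hc.mem_closure hmem ?_
    rintro z ⟨hz, hzt⟩
    rw [← h.mem_left _ (φ.map_target hzt), φ.right_inv hzt]
    exact hz
  rw [← h1]
  refine pull_congr R ?_
  have hopen : IsOpen (j.target ∩ j.symm ⁻¹' (φ.symm ≫ₕ φ').source) :=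
    j.symm.isOpen_inter_preimage (φ.symm ≫ₕ φ').open_source
  filter_upwards [hopen.mem_nhds ⟨hq, hqs'⟩] with z hz
  have hz2 := hz.2
  simp only [mfld_simps] at hz2
  simp only [Function.comp_apply]
  rw [(h.symm_apply hz.1 hz.2).2, φ'.left_inv hz2.2]

include hS hT in
-- The definition uses `T` on the seam itself, but there both `S` and `T` equal `R`: a frontier
-- point of the open set `Ω` lies outside `Ω` and in its closure.
theorem IsSeam.gluedTensor_left {q : Q} (hq : q ∈ j.target) (hqΩ : j.symm q ∈ closure Ω) :
    gluedTensor j k Ω S T q = pull j.symm S q := by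
  by_cases hΩ : j.symm q ∈ Ω
  · exact if_pos ⟨hq, hΩ⟩
  · have hqs : j.symm q ∈ (φ.symm ≫ₕ φ').source := by
      have := j.map_target hq
      rw [h.source_j] at this
      exact this.resolve_left hΩ
    rw [gluedTensor, if_neg (fun hh => hΩ hh.2), ← h.pull_inside hT hq hqs hqΩ,
      h.pull_outside hS hq hqs hΩ]

theorem IsSeam.gluedTensor_right {q : Q} (hq : q ∈ k.target) (hqΩ : k.symm q ∉ Ω') :
    gluedTensor j k Ω S T q = pull k.symm T q := by
  refine if_neg fun hh => hqΩ ?_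
  rw [← h.mem_iff (j.map_target hh.1) (k.map_target hq) (by rw [j.right_inv hh.1, k.right_inv hq])]
  exact hh.2

include hS hT in
-- Three open sets cover `Q`: the inside, where the tensor is `S`, the exterior, where it is `T`,
-- and the collar. On the collar `T = R` inside and `S = R` outside, so the tensor is `S + T - R` on
-- both sides, with all three terms smooth across the seam.
theorem IsSeam.smoothTensorAt [IsManifold 𝓘(ℝ, E3) ∞ A] [IsManifold 𝓘(ℝ, E3) ∞ B]
    [IsManifold 𝓘(ℝ, E3) ∞ C] [IsManifold 𝓘(ℝ, E3) ∞ Q] (sS : ∀ a, SmoothTensorAt S a)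
    (sT : ∀ b, SmoothTensorAt T b) (sR : ∀ c, SmoothTensorAt R c) (q : Q) :
    SmoothTensorAt (gluedTensor j k Ω S T) q := by
  have hI : IsOpen (j.target ∩ j.symm ⁻¹' Ω) := j.symm.isOpen_inter_preimage h.isOpen
  by_cases h1 : q ∈ j.target ∩ j.symm ⁻¹' Ω
  · refine ((sS _).pull (h.hj.symm.contMDiffAt h1.1)).congr ?_
    filter_upwards [hI.mem_nhds h1] with z hz using if_pos hz
  have hW : IsOpen (j.target ∩ j.symm ⁻¹' (φ.symm ≫ₕ φ').source) :=
    j.symm.isOpen_inter_preimage (φ.symm ≫ₕ φ').open_source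
  by_cases h2 : q ∈ j.target ∩ j.symm ⁻¹' (φ.symm ≫ₕ φ').source
  · have hq2 := h2.2
    simp only [mfld_simps] at hq2
    have e1 := (sS _).pull (h.hj.symm.contMDiffAt h2.1)
    have e2 := (sT _).pull (h.hk.symm.contMDiffAt (h.symm_apply h2.1 h2.2).1)
    have e3 := (sR _).pull (F := φ.symm ∘ j.symm)
      ((h.left.symm.contMDiffAt hq2.1).comp q (h.hj.symm.contMDiffAt h2.1))
    refine ((e1.add e2).sub e3).congr ?_
    filter_upwards [hW.mem_nhds h2] with z hz
    by_cases hzΩ : j.symm z ∈ Ω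
    · rw [gluedTensor, if_pos ⟨hz.1, hzΩ⟩, h.pull_inside hT hz.1 hz.2 (subset_closure hzΩ)]
      exact (add_sub_cancel_right (G := E3 →L[ℝ] E3 →L[ℝ] ℝ) _ _).symm
    · rw [gluedTensor, if_neg (fun hh => hzΩ hh.2), h.pull_outside hS hz.1 hz.2 hzΩ]
      exact (add_sub_cancel_left (G := E3 →L[ℝ] E3 →L[ℝ] ℝ) _ _).symm
  · have hqj : q ∉ j.target := fun hq => by
      have := j.map_target hq
      rw [h.source_j] at this
      exact this.elim (fun hh => h1 ⟨hq, hh⟩) (fun hh => h2 ⟨hq, hh⟩)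
    have hqk : q ∈ k.target := (Set.eq_univ_iff_forall.1 h.cover q).resolve_left hqj
    have hkq : k.symm q ∈ (closure Ω')ᶜ := by
      have := k.map_target hqk
      rw [h.source_k] at this
      refine this.resolve_right fun hh => hqj ?_
      have h3 := (φ.symm ≫ₕ φ').map_target hh
      have h4 : (φ.symm ≫ₕ φ').symm (k.symm q) ∈ j.source := by
        rw [h.source_j]
        exact Or.inr h3
      have := (h.eq_iff _ h4 _ (k.map_target hqk)).2 ⟨h3, (φ.symm ≫ₕ φ').right_inv hh⟩
      rw [k.right_inv hqk] at this
      rw [← this]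
      exact j.map_source h4
    refine ((sT _).pull (h.hk.symm.contMDiffAt hqk)).congr ?_
    have hO : IsOpen (k.target ∩ k.symm ⁻¹' (closure Ω')ᶜ) :=
      k.symm.isOpen_inter_preimage isClosed_closure.isOpen_compl
    filter_upwards [hO.mem_nhds ⟨hqk, hkq⟩] with z hz
    exact h.gluedTensor_right hz.1 (fun hh => hz.2 (subset_closure hh))

end Seam

theorem pull_swap {M N : Type} [TopologicalSpace M] [ChartedSpace E3 M] [TopologicalSpace N]
    [ChartedSpace E3 N] {F : M → N} {T : TensorField N}
    (hT : ∀ x (v w : TangentSpace 𝓘(ℝ, E3) x), T x v w = T x w v) {x : M}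
    (v w : TangentSpace 𝓘(ℝ, E3) x) : pull F T x v w = pull F T x w v :=
  hT (F x) _ _

theorem IsDiffeo.pull_pos {M N : Type} [TopologicalSpace M] [ChartedSpace E3 M]
    [TopologicalSpace N] [ChartedSpace E3 N] {φ : OpenPartialHomeomorph M N} (hφ : IsDiffeo φ)
    {T : TensorField N} (hT : ∀ x (v : TangentSpace 𝓘(ℝ, E3) x), v ≠ 0 → 0 < T x v v) {x : M}
    (hx : x ∈ φ.source) {v : TangentSpace 𝓘(ℝ, E3) x} (hv : v ≠ 0) : 0 < pull φ T x v v :=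
  hT (φ x) _ fun hh => hv (hφ.mfderiv_injective hx (hh.trans (map_zero _).symm))

/-- Cauchy data given by two tensor fields. -/
@[reducible] def CauchyData.ofTensors (Q : Type) [TopologicalSpace Q] [ChartedSpace E3 Q]
    [IsManifold 𝓘(ℝ, E3) ∞ Q] [T2Space Q] [SecondCountableTopology Q] (g h : TensorField Q)
    (hg : ∀ x (v w : TangentSpace 𝓘(ℝ, E3) x), g x v w = g x w v)
    (hh : ∀ x (v w : TangentSpace 𝓘(ℝ, E3) x), h x v w = h x w v)
    (hpos : ∀ x (v : TangentSpace 𝓘(ℝ, E3) x), v ≠ 0 → 0 < g x v v)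
    (sg : ∀ x, SmoothTensorAt g x) (sh : ∀ x, SmoothTensorAt h x) : CauchyData where
  carrier := Q
  g :=
    { inner := g
      symm := hg
      pos := hpos
      isVonNBounded := fun x => isVonNBounded_of_pos (g x) (hpos x)
      contMDiff := sg }
  h := h
  h_symm := hh
  h_smooth := sh

/-- The spaces glued are `Ω` and the exterior of `Ω'`, each enlarged by the collar on which `ψ = φ'
∘ φ⁻¹` is defined. The enlarged sets are open and contain the closed sides of the surface. -/
theorem Fitting.nonempty_glued {A B C : CauchyData} {Ω : Set A.carrier} {Ω' : Set B.carrier}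
    {Ω₀ : Set C.carrier} (F : Fitting A B C Ω Ω' Ω₀) (hΩ : Ω.Nonempty) (hΩ' : (closure Ω')ᶜ.Nonempty) :
    Nonempty (Glued A B Ω Ω') := by
  set ψ := F.φ.symm ≫ₕ F.φ' with hψ
  have hψd : IsDiffeo ψ := F.diffeo_left.symm.trans F.diffeo_right
  have hψmem : ∀ a ∈ ψ.source, a ∈ Ω ↔ ψ a ∈ Ω' := by
    intro a ha
    simp only [hψ, mfld_simps] at ha ⊢
    rw [F.mem_right _ ha.2, ← F.mem_left _ (F.φ.map_target ha.1), F.φ.right_inv ha.1]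
  obtain ⟨Q, _, _, _, _, _, j, k, hj, hk, hjs, hks, hcov, hjk⟩ := exists_glued_manifold ψ hψd
    (F.isOpen_left.union ψ.open_source) (isClosed_closure.isOpen_compl.union ψ.open_target)
    (hΩ.mono Set.subset_union_left) (hΩ'.mono Set.subset_union_left) Set.subset_union_right
    Set.subset_union_right (by
      intro a ha b hb hab
      -- Hausdorffness: a collar point is separated using continuity of `ψ` or of its inverse; if
      -- neither point lies in the collar, `Ω` and the exterior of `Ω'` separate them, as `ψ` takes
      -- `Ω` into `Ω'`.
      by_cases haψ : a ∈ ψ.source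
      · obtain ⟨W₁, W₂, hW₁, hW₂, h1, h2, hd⟩ := t2_separation (fun hh => hab ⟨haψ, hh⟩)
        refine ⟨_, (ψ.continuousAt haψ).preimage_mem_nhds (hW₁.mem_nhds h1), W₂,
          hW₂.mem_nhds h2, fun a' ha' _ hmem => Set.disjoint_left.1 hd ha' hmem⟩
      · have haΩ := ha.resolve_right haψ
        by_cases hbψ : b ∈ ψ.target
        · obtain ⟨O₁, O₂, hO₁, hO₂, h1, h2, hd⟩ := t2_separation
            (show a ≠ ψ.symm b from fun hh => haψ (hh ▸ ψ.map_target hbψ))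
          refine ⟨O₁, hO₁.mem_nhds h1, _, (ψ.symm.continuousAt hbψ).preimage_mem_nhds
            (hO₂.mem_nhds h2), fun a' ha' has hmem => Set.disjoint_left.1 hd ha' ?_⟩
          rwa [Set.mem_preimage, ψ.left_inv has] at hmem
        · refine ⟨Ω, F.isOpen_left.mem_nhds haΩ, _, isClosed_closure.isOpen_compl.mem_nhds
            (hb.resolve_right hbψ), fun a' ha' has hmem => hmem (subset_closure ?_)⟩
          exact (hψmem a' has).1 ha')
  have hs : IsSeam F.φ F.φ' j k Ω Ω' Ω₀ := ⟨F.diffeo_left, F.diffeo_right, hj, hk, F.isOpen_left,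
    F.mem_left, F.mem_right, hjs, hks, hcov, by rwa [hjs, hks]⟩
  have hcl : closure Ω ⊆ j.source := by
    rw [closure_eq_self_union_frontier, hjs]
    exact Set.union_subset_union_right _ F.frontier_left
  have hco : Ω'ᶜ ⊆ k.source := by
    rw [hks]
    intro b hb
    by_cases hb' : b ∈ closure Ω'
    · exact Or.inr (F.frontier_right ⟨hb', fun hh => hb (interior_subset hh)⟩)
    · exact Or.inl hb'
  have hcov' : ∀ q, (q ∈ j.target ∧ j.symm q ∈ Ω) ∨ (q ∈ k.target ∧ k.symm q ∉ Ω') := by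
    intro q
    by_cases h1 : q ∈ j.target
    · by_cases h2 : j.symm q ∈ Ω
      · exact Or.inl ⟨h1, h2⟩
      · have h3 := j.map_target h1
        rw [hjs] at h3
        have h4 := hs.symm_apply h1 (h3.resolve_left h2)
        refine Or.inr ⟨h4.1, ?_⟩
        rwa [← hs.mem_iff (j.map_target h1) (k.map_target h4.1)
          (by rw [j.right_inv h1, k.right_inv h4.1])]
    · have h2 := (Set.eq_univ_iff_forall.1 hcov q).resolve_left h1
      refine Or.inr ⟨h2, fun h3 => h1 ?_⟩
      have h4 := k.map_target h2
      rw [hks] at h4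
      have h5 := h4.resolve_left (fun hh => hh (subset_closure h3))
      have h6 := ψ.map_target h5
      have h7 : ψ.symm (k.symm q) ∈ j.source := by rw [hjs]; exact Or.inr h6
      have := (hs.eq_iff _ h7 _ (k.map_target h2)).2 ⟨h6, ψ.right_inv h5⟩
      rw [k.right_inv h2] at this
      rw [← this]
      exact j.map_source h7
  let g := gluedTensor j k Ω A.g.inner B.g.inner
  let h := gluedTensor j k Ω A.h B.h
  have hcase : ∀ q, (q ∈ j.target ∧ g q = pull j.symm A.g.inner q ∧ h q = pull j.symm A.h q) ∨
      (q ∈ k.target ∧ g q = pull k.symm B.g.inner q ∧ h q = pull k.symm B.h q) := by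
    intro q
    rcases hcov' q with ⟨h1, h2⟩ | ⟨h1, h2⟩
    · exact Or.inl ⟨h1, if_pos ⟨h1, h2⟩, if_pos ⟨h1, h2⟩⟩
    · exact Or.inr ⟨h1, hs.gluedTensor_right h1 h2, hs.gluedTensor_right h1 h2⟩
  have hpos : ∀ q (v : TangentSpace 𝓘(ℝ, E3) q), v ≠ 0 → 0 < g q v v := by
    intro q v hv
    rcases hcase q with ⟨h1, h2, -⟩ | ⟨h1, h2, -⟩
    · rw [h2]
      exact hj.symm.pull_pos A.g.pos h1 hv
    · rw [h2]
      exact hk.symm.pull_pos B.g.pos h1 hv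
  have sg := hs.smoothTensorAt F.pull_left_g F.pull_right_g A.smooth_g B.smooth_g C.smooth_g
  have sh := hs.smoothTensorAt F.pull_left_h F.pull_right_h A.smooth_h B.smooth_h C.smooth_h
  have hgs : ∀ q (v w : TangentSpace 𝓘(ℝ, E3) q), g q v w = g q w v := by
    intro q v w
    rcases hcase q with ⟨h1, h2, -⟩ | ⟨h1, h2, -⟩
    · rw [h2]; exact pull_swap A.g.symm v w
    · rw [h2]; exact pull_swap B.g.symm v w
  have hhs : ∀ q (v w : TangentSpace 𝓘(ℝ, E3) q), h q v w = h q w v := by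
    intro q v w
    rcases hcase q with ⟨h1, -, h2⟩ | ⟨h1, -, h2⟩
    · rw [h2]; exact pull_swap A.h_symm v w
    · rw [h2]; exact pull_swap B.h_symm v w
  refine ⟨⟨CauchyData.ofTensors Q g h hgs hhs hpos sg sh, j, k, hj, hk, hcl, hco, ?_, ?_, ?_, ?_, ?_, ?_, ?_, ?_⟩⟩
  · intro q
    rcases hcov' q with ⟨h1, h2⟩ | ⟨h1, h2⟩
    · exact Or.inl ⟨_, h2, j.right_inv h1⟩
    · exact Or.inr ⟨_, h2, k.right_inv h1⟩
  · exact fun a ha b hb hab => hs.mem_iff ha hb hab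
  · intro a ha
    have h1 := F.frontier_left ha
    have h2 : ψ a ∈ k.source := by rw [hks]; exact Or.inr (ψ.map_source h1)
    exact ⟨ψ a, h2, (hs.eq_iff _ (hcl ha.1) _ h2).2 ⟨h1, rfl⟩⟩
  · intro b hb
    have h1 := F.frontier_right hb
    have h2 : ψ.symm b ∈ j.source := by rw [hjs]; exact Or.inr (ψ.map_target h1)
    refine ⟨ψ.symm b, h2, ((hs.eq_iff _ h2 _ ?_).2 ⟨ψ.map_target h1, ψ.right_inv h1⟩).symm⟩
    rw [hks]
    exact Or.inr h1
  · intro a ha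
    rw [pull_congr_tensor j (T' := pull j.symm A.g.inner)]
    · exact hj.pull_symm_pull _ (hcl ha)
    · exact hs.gluedTensor_left F.pull_left_g F.pull_right_g (j.map_source (hcl ha))
        (by rwa [j.left_inv (hcl ha)])
  · intro a ha
    rw [pull_congr_tensor j (T' := pull j.symm A.h)]
    · exact hj.pull_symm_pull _ (hcl ha)
    · exact hs.gluedTensor_left F.pull_left_h F.pull_right_h (j.map_source (hcl ha))
        (by rwa [j.left_inv (hcl ha)])
  · intro b hb
    rw [pull_congr_tensor k (T' := pull k.symm B.g.inner)]
    · exact hk.pull_symm_pull _ (hco hb)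
    · exact hs.gluedTensor_right (k.map_source (hco hb)) (by rwa [k.left_inv (hco hb)])
  · intro b hb
    rw [pull_congr_tensor k (T' := pull k.symm B.h)]
    · exact hk.pull_symm_pull _ (hco hb)
    · exact hs.gluedTensor_right (k.map_source (hco hb)) (by rwa [k.left_inv (hco hb)])

end Penrose

namespace Penrose

/-! ### The dominant energy condition for glued data -/

/-- The continuous transition map `k.symm ∘ j` takes points of `s` near `a` to points of `t`, so `b`
is in the closure; being interior to `t` would put `a` in the open set `s`, which excludes its
frontier. -/
theorem map_mem_frontier {X Y Q : Type} [TopologicalSpace X] [TopologicalSpace Y]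
    [TopologicalSpace Q] (j : OpenPartialHomeomorph X Q) (k : OpenPartialHomeomorph Y Q)
    {s : Set X} {t : Set Y} (hs : IsOpen s)
    (hst : ∀ a ∈ j.source, ∀ b ∈ k.source, j a = k b → (a ∈ s ↔ b ∈ t)) {a : X} {b : Y}
    (ha : a ∈ j.source) (hb : b ∈ k.source) (hab : j a = k b) (hf : a ∈ frontier s) :
    b ∈ frontier t := by
  have hO : IsOpen (j.source ∩ j ⁻¹' k.target) := j.isOpen_inter_preimage k.open_target
  have haO : a ∈ j.source ∩ j ⁻¹' k.target := ⟨ha, by rw [Set.mem_preimage, hab]; exact k.map_source hb⟩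
  have hbe : k.symm (j a) = b := by rw [hab, k.left_inv hb]
  refine ⟨?_, fun hi => ?_⟩
  · rw [← hbe]
    have hc : ContinuousAt (fun z => k.symm (j z)) a :=
      (k.symm.continuousAt haO.2).comp (j.continuousAt ha)
    refine hc.continuousWithinAt.mem_closure (hO.inter_closure ⟨haO, hf.1⟩) ?_
    rintro z ⟨hz, hzs⟩
    exact (hst z hz.1 _ (k.map_target hz.2) (k.right_inv hz.2).symm).1 hzs
  · have := (hst a ha b hb hab).2 (interior_subset hi)
    rw [hs.frontier_eq] at hf
    exact hf.2 this

namespace Glued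

variable {A B : CauchyData} {Ω : Set A.carrier} {Ω' : Set B.carrier} (W : Glued A B Ω Ω')

theorem exists_frontier_right (hΩ : IsOpen Ω) {a : A.carrier} (ha : a ∈ frontier Ω) :
    ∃ b ∈ frontier Ω', b ∈ W.k.source ∧ W.j a = W.k b := by
  obtain ⟨b, hb, hab⟩ := W.frontier_left a ha
  exact ⟨b, map_mem_frontier W.j W.k hΩ W.mem_iff (W.closure_subset ha.1) hb hab ha, hb, hab⟩

theorem exists_frontier_left (hΩ' : IsOpen Ω') {b : B.carrier} (hb : b ∈ frontier Ω') :
    ∃ a ∈ frontier Ω, a ∈ W.j.source ∧ W.j a = W.k b := by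
  obtain ⟨a, ha, hab⟩ := W.frontier_right b hb
  have hbk : b ∈ W.k.source := W.compl_subset (by rw [hΩ'.frontier_eq] at hb; exact hb.2)
  exact ⟨a, map_mem_frontier W.k W.j hΩ'
    (fun b hb a ha h => (W.mem_iff a ha b hb h.symm).symm) hbk ha hab hb, ha, hab.symm⟩

end Glued

theorem IsDiffeo.pull_symm_eq {M Q : Type} [TopologicalSpace M] [TopologicalSpace Q]
    [ChartedSpace E3 M] [ChartedSpace E3 Q] {i : OpenPartialHomeomorph M Q} (hi : IsDiffeo i)
    {S : TensorField M} {T : TensorField Q} {q : Q} (hq : q ∈ i.target)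
    (h : pull i T (i.symm q) = S (i.symm q)) : pull i.symm S q = T q := by
  rw [← pull_congr_tensor i.symm h]
  exact hi.symm.pull_symm_pull T hq

theorem pull_trans_chart {M Q : Type} [TopologicalSpace M] [TopologicalSpace Q]
    [ChartedSpace E3 M] [ChartedSpace E3 Q] {i : OpenPartialHomeomorph M Q} (hi : IsDiffeo i)
    {e : OpenPartialHomeomorph Q E3} (he : IsDiffeo e) {S : TensorField M} {T : TensorField Q}
    {y : E3} (hy : y ∈ e.target) (hye : e.symm y ∈ i.target)
    (h : pull i T (i.symm (e.symm y)) = S (i.symm (e.symm y))) :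
    pull e.symm T y = pull (i ≫ₕ e).symm S y := by
  have h1 := pull_comp S (hi.symm.mdifferentiableAt hye) (he.symm.mdifferentiableAt hy)
  refine Eq.trans ?_ h1.symm
  exact pull_congr_tensor _ (hi.pull_symm_eq hye h).symm

/-- The dominant energy condition at the points of an open part with the same data. -/
theorem CauchyData.DominantEnergy.transfer {M Q : CauchyData} (hM : M.DominantEnergy)
    {i : OpenPartialHomeomorph M.carrier Q.carrier} (hi : IsDiffeo i) {O : Set M.carrier}
    (hO : IsOpen O) (hOi : O ⊆ i.source) (hg : ∀ x ∈ O, pull i Q.g.inner x = M.g.inner x)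
    (hh : ∀ x ∈ O, pull i Q.h x = M.h x) {e : OpenPartialHomeomorph Q.carrier E3}
    (he : IsDiffeo e) {y : E3} (hy : y ∈ e.target) (hyO : e.symm y ∈ i '' O) :
    currentNorm (Q.components Q.g.inner e) (Q.components Q.h e) y ≤
      energyDensity (Q.components Q.g.inner e) (Q.components Q.h e) y := by
  obtain ⟨x, hx, hxy⟩ := hyO
  have hOo : IsOpen (i.target ∩ i.symm ⁻¹' O) := i.symm.isOpen_inter_preimage hO
  have hxO : e.symm y ∈ i.target ∩ i.symm ⁻¹' O := by
    rw [← hxy]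
    exact ⟨i.map_source (hOi hx), by rw [Set.mem_preimage, i.left_inv (hOi hx)]; exact hx⟩
  have hnear : ∀ᶠ z in 𝓝 y, z ∈ e.target ∧ e.symm z ∈ i.target ∩ i.symm ⁻¹' O :=
    (e.symm.isOpen_inter_preimage hOo).mem_nhds ⟨hy, hxO⟩
  have h1 : Q.components Q.g.inner e =ᶠ[𝓝 y] M.components M.g.inner (i ≫ₕ e) := by
    filter_upwards [hnear] with z hz
    exact CauchyData.components_congr _ (pull_trans_chart hi he hz.1 hz.2.1 (hg _ hz.2.2))
  have h2 : Q.components Q.h e =ᶠ[𝓝 y] M.components M.h (i ≫ₕ e) := by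
    filter_upwards [hnear] with z hz
    exact CauchyData.components_congr _ (pull_trans_chart hi he hz.1 hz.2.1 (hh _ hz.2.2))
  rw [currentNorm_congr h1 h2, energyDensity_congr h1 h2]
  exact hM _ (hi.trans he).mem_maximalAtlas _ ⟨hy, hxO.1⟩

/-- On the open inside and the open exterior the data agree locally with those of `A` or `B`. A seam
point is a limit of inside points, and the inequality between continuous functions passes to the
limit. -/
theorem Glued.dominantEnergy {A B : CauchyData} {Ω : Set A.carrier} {Ω' : Set B.carrier}
    (W : Glued A B Ω Ω') (hΩ : IsOpen Ω) (hΩ' : IsOpen Ω') (hA : A.DominantEnergy)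
    (hB : B.DominantEnergy) : W.Q.DominantEnergy := by
  intro e he y hy
  have hed := isDiffeo_of_mem_maximalAtlas he
  have hin : ∀ z ∈ e.target, e.symm z ∈ W.j '' Ω →
      currentNorm (W.Q.components W.Q.g.inner e) (W.Q.components W.Q.h e) z ≤
      energyDensity (W.Q.components W.Q.g.inner e) (W.Q.components W.Q.h e) z := fun z hz hzΩ =>
    hA.transfer W.diffeo_left hΩ (subset_closure.trans W.closure_subset)
      (fun a ha => W.pull_left_g a (subset_closure ha))
      (fun a ha => W.pull_left_h a (subset_closure ha)) hed hz hzΩ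
  rcases W.cover (e.symm y) with ⟨a, ha, hay⟩ | ⟨b, hb, hby⟩
  · exact hin y hy ⟨a, ha, hay⟩
  by_cases hbc : b ∈ closure Ω'
  · have hbf : b ∈ frontier Ω' := by rw [hΩ'.frontier_eq]; exact ⟨hbc, hb⟩
    obtain ⟨a, ha, haj, hab⟩ := W.exists_frontier_left hΩ' hbf
    have hsrc : e.symm y ∈ e.source := e.map_target hy
    have hcont : ContinuousAt (fun z => e (W.j z)) a := by
      refine ContinuousAt.comp (e.continuousAt ?_) (W.j.continuousAt haj)
      rwa [hab, hby]
    have hO : IsOpen (W.j.source ∩ W.j ⁻¹' e.source) := W.j.isOpen_inter_preimage e.open_source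
    have haO : a ∈ W.j.source ∩ W.j ⁻¹' e.source :=
      ⟨haj, by rw [Set.mem_preimage, hab, hby]; exact hsrc⟩
    have hmem : y ∈ closure (e.target ∩ e.symm ⁻¹' (W.j '' Ω)) := by
      have hya : e (W.j a) = y := by rw [hab, hby, e.right_inv hy]
      rw [← hya]
      refine hcont.continuousWithinAt.mem_closure (hO.inter_closure ⟨haO, ha.1⟩) ?_
      rintro z ⟨hz, hzΩ⟩
      refine ⟨e.map_source hz.2, ?_⟩
      rw [Set.mem_preimage, e.left_inv hz.2]
      exact ⟨z, hzΩ, rfl⟩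
    exact ContinuousWithinAt.closure_le hmem
      (CauchyData.continuousAt_currentNorm_components hed hy).continuousWithinAt
      (CauchyData.continuousAt_energyDensity_components hed hy).continuousWithinAt
      fun z hz => hin z hz.1 hz.2
  · refine hB.transfer W.diffeo_right isClosed_closure.isOpen_compl
      ((Set.compl_subset_compl.2 subset_closure).trans W.compl_subset)
      (fun a ha => W.pull_right_g a fun h => ha (subset_closure h))
      (fun a ha => W.pull_right_h a fun h => ha (subset_closure h)) hed hy ⟨b, hbc, hby⟩

end Penrose

namespace Penrose

/-! ### Lipschitz estimates for Riemannian distances -/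

section Curves

open Manifold Set

variable {E H M E' H' M' : Type} [NormedAddCommGroup E] [NormedSpace ℝ E] [TopologicalSpace H]
  {I : ModelWithCorners ℝ E H} [TopologicalSpace M] [ChartedSpace H M]
  [∀ x : M, ENorm (TangentSpace I x)]
  [NormedAddCommGroup E'] [NormedSpace ℝ E'] [TopologicalSpace H']
  {I' : ModelWithCorners ℝ E' H'} [TopologicalSpace M'] [ChartedSpace H' M']
  [∀ x : M', ENorm (TangentSpace I' x)] [∀ x : M', ENormSMulClass ℝ (TangentSpace I' x)]

theorem riemannianEDist_map_le {F : M → M'} {γ : ℝ → M} {c : ℝ≥0∞} (hc : c ≠ ⊤)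
    (hγ : ContMDiffOn 𝓘(ℝ, ℝ) I 1 γ (Icc 0 1)) (hF : ∀ t ∈ Icc (0 : ℝ) 1, ContMDiffAt I I' 1 F (γ t))
    (hn : ∀ t ∈ Icc (0 : ℝ) 1, ∀ v : TangentSpace I (γ t), ‖mfderiv I I' F (γ t) v‖ₑ ≤ c * ‖v‖ₑ) :
    riemannianEDist I' (F (γ 0)) (F (γ 1)) ≤ c * pathELength I γ 0 1 := by
  have h1 : ContMDiffOn 𝓘(ℝ, ℝ) I' 1 (F ∘ γ) (Icc 0 1) := fun t ht =>
    (hF t ht).comp_contMDiffWithinAt t (hγ t ht)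
  refine (riemannianEDist_le_pathELength h1 rfl rfl zero_le_one).trans ?_
  rw [pathELength_eq_lintegral_mfderivWithin_Icc, pathELength_eq_lintegral_mfderivWithin_Icc,
    ← lintegral_const_mul' _ _ hc]
  refine setLIntegral_mono' measurableSet_Icc fun t ht => ?_
  have hu : UniqueMDiffWithinAt 𝓘(ℝ, ℝ) (Icc (0 : ℝ) 1) t := by
    rw [uniqueMDiffWithinAt_iff_uniqueDiffWithinAt]
    exact uniqueDiffOn_Icc zero_lt_one t ht
  have := mfderiv_comp_mfderivWithin t ((hF t ht).mdifferentiableAt one_ne_zero)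
    ((hγ t ht).mdifferentiableWithinAt one_ne_zero) hu
  rw [this]
  exact hn t ht _

end Curves

theorem eventually_norm_smul_sub_apply_le {X V G : Type} [TopologicalSpace X]
    [NormedAddCommGroup V] [NormedSpace ℝ V] [NormedAddCommGroup G] [NormedSpace ℝ G]
    {a b : X → V →L[ℝ] G} {x : X} (ha : ContinuousAt a x) (hb : ContinuousAt b x) (c : ℝ) {ε : ℝ}
    (hε : 0 < ε) : ∀ᶠ y in 𝓝 x, ∀ v, ‖c • b y v - a y v - (c • b x v - a x v)‖ ≤ ε * ‖v‖ := by
  have hd : ContinuousAt (fun y => c • b y - a y) x := (hb.const_smul c).sub ha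
  filter_upwards [Metric.continuousAt_iff'.1 hd ε hε] with y hy v
  rw [dist_eq_norm] at hy
  exact (c • b y - a y - (c • b x - a x)).le_of_opNorm_le hy.le v

/-- The slack `(c - k) b(v, v)` at `x` is at least `(c - k) m ‖v‖²`, which absorbs a perturbation of
`c b - a` of norm at most `(c - k) m`. -/
theorem eventually_form_le {X V : Type} [TopologicalSpace X] [NormedAddCommGroup V]
    [NormedSpace ℝ V] {a b : X → V →L[ℝ] V →L[ℝ] ℝ} {x : X} (ha : ContinuousAt a x)
    (hb : ContinuousAt b x) {m : ℝ} (hm : 0 < m) (hmb : ∀ v, m * ‖v‖ ^ 2 ≤ b x v v) {k c : ℝ}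
    (hkc : k < c) (hle : ∀ v, a x v v ≤ k * b x v v) : ∀ᶠ y in 𝓝 x, ∀ v, a y v v ≤ c * b y v v := by
  have hε : 0 < (c - k) * m := mul_pos (sub_pos.2 hkc) hm
  filter_upwards [eventually_norm_smul_sub_apply_le ha hb c hε] with y hy v
  have h1 := (c • b y v - a y v - (c • b x v - a x v)).le_of_opNorm_le (hy v) v
  have h2 : (c • b y v - a y v - (c • b x v - a x v)) v =
      c * b y v v - a y v v - (c * b x v v - a x v v) := by
    simp
  rw [Real.norm_eq_abs, h2, mul_assoc, ← pow_two] at h1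
  have h3 := (abs_le.1 h1).1
  have h4 := mul_le_mul_of_nonneg_left (hmb v) (sub_pos.2 hkc).le
  have h5 := hle v
  nlinarith

/-- The components of a tensor field in the frame at `x₀`. -/
def inFrame {M : Type} [TopologicalSpace M] [ChartedSpace E3 M] [IsManifold 𝓘(ℝ, E3) ∞ M]
    (T : TensorField M) (x₀ x : M) : E3 →L[ℝ] E3 →L[ℝ] ℝ :=
  pullForm (T x) ((trivializationAt E3 (TangentSpace 𝓘(ℝ, E3) : M → Type) x₀).symmL ℝ x)

theorem continuousAt_inFrame {M : Type} [TopologicalSpace M] [ChartedSpace E3 M]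
    [IsManifold 𝓘(ℝ, E3) ∞ M] {T : TensorField M} {x : M} (hT : SmoothTensorAt T x) :
    ContinuousAt (inFrame T x) x :=
  (contMDiffAt_of_forall_apply (smoothTensorAt_iff.1 hT)).continuousAt

theorem eventually_tensor_le {M : Type} [TopologicalSpace M] [ChartedSpace E3 M]
    [IsManifold 𝓘(ℝ, E3) ∞ M] {S T : TensorField M} {x : M} (hS : SmoothTensorAt S x)
    (hT : SmoothTensorAt T x) (hpos : ∀ v : TangentSpace 𝓘(ℝ, E3) x, v ≠ 0 → 0 < T x v v) {k c : ℝ}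
    (hkc : k < c) (hle : ∀ v : TangentSpace 𝓘(ℝ, E3) x, S x v v ≤ k * T x v v) :
    ∀ᶠ y in 𝓝 x, ∀ v : TangentSpace 𝓘(ℝ, E3) y, S y v v ≤ c * T y v v := by
  set e := trivializationAt E3 (TangentSpace 𝓘(ℝ, E3) : M → Type) x with he
  have hx : x ∈ e.baseSet := FiberBundle.mem_baseSet_trivializationAt' x
  have hinv : ∀ v : E3, e.symmL ℝ x v = 0 → v = 0 := fun v hv => by
    rw [← e.continuousLinearMapAt_symmL (R := ℝ) hx v, hv, map_zero]
  obtain ⟨m, hm, hmb⟩ := exists_le_form_of_pos (inFrame T x x)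
    (fun v hv => hpos _ fun h => hv (hinv v h))
  have := eventually_form_le (continuousAt_inFrame hS) (continuousAt_inFrame hT) hm hmb hkc
    (fun v => hle _)
  filter_upwards [this, e.open_baseSet.mem_nhds hx] with y hy hye v
  have h1 := hy (e.continuousLinearMapAt ℝ y v)
  have h2 : e.symmL ℝ y (e.continuousLinearMapAt ℝ y v) = v :=
    e.symmL_continuousLinearMapAt hye v
  have h3 : ∀ R : TensorField M, inFrame R x y (e.continuousLinearMapAt ℝ y v)
      (e.continuousLinearMapAt ℝ y v) = R y v v := fun R => by
    conv_rhs => rw [← h2]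
    rfl
  rwa [h3, h3] at h1

namespace CauchyData

open Manifold

/-- The inner products on the tangent spaces. -/
@[reducible] def riemannianBundle (D : CauchyData) :
    Bundle.RiemannianBundle (fun x : D.carrier => TangentSpace 𝓘(ℝ, E3) x) :=
  ⟨D.g.toRiemannianMetric⟩

attribute [local instance] riemannianBundle

theorem isContinuousRiemannianBundle (D : CauchyData) :
    IsContinuousRiemannianBundle E3 (fun x : D.carrier => TangentSpace 𝓘(ℝ, E3) x) :=
  ⟨⟨D.g.inner, D.g.contMDiff.continuous, fun _ _ _ => rfl⟩⟩

attribute [local instance] isContinuousRiemannianBundle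

theorem locallyCompactSpace (D : CauchyData) : LocallyCompactSpace D.carrier :=
  ChartedSpace.locallyCompactSpace E3 D.carrier

attribute [local instance] locallyCompactSpace

theorem edist_eq (D : CauchyData) (x y : D.carrier) :
    D.emetric.edist x y = Manifold.riemannianEDist 𝓘(ℝ, E3) x y := rfl

theorem norm_sq_eq (D : CauchyData) {x : D.carrier} (v : TangentSpace 𝓘(ℝ, E3) x) :
    ‖v‖ ^ 2 = D.g.inner x v v :=
  (real_inner_self_eq_norm_sq v).symm

theorem enorm_mfderiv_le {D D' : CauchyData} {F : D.carrier → D'.carrier} {x : D.carrier}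
    {c : NNReal} {v : TangentSpace 𝓘(ℝ, E3) x}
    (h : pull F D'.g.inner x v v ≤ (c : ℝ) ^ 2 * D.g.inner x v v) :
    ‖mfderiv 𝓘(ℝ, E3) 𝓘(ℝ, E3) F x v‖ₑ ≤ c * ‖v‖ₑ := by
  have h1 : ‖mfderiv 𝓘(ℝ, E3) 𝓘(ℝ, E3) F x v‖ ^ 2 ≤ (c * ‖v‖) ^ 2 := by
    rw [mul_pow, D.norm_sq_eq, D'.norm_sq_eq]
    exact h
  have h2 := le_of_sq_le_sq h1 (by positivity)
  rw [← ofReal_norm, ← ofReal_norm, ← ENNReal.ofReal_coe_nnreal, ← ENNReal.ofReal_mul c.coe_nonneg]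
  exact ENNReal.ofReal_le_ofReal h2

/-- A map whose derivative at `x` does not increase lengths by a factor larger than `√k` is locally
Lipschitz at `x`, with any constant larger than `√k`. -/
theorem exists_lipschitz_nhds {D D' : CauchyData} {F : D.carrier → D'.carrier} {x : D.carrier}
    (hF : ContMDiffAt 𝓘(ℝ, E3) 𝓘(ℝ, E3) ∞ F x) {k : ℝ} {c : NNReal} (hkc : k < (c : ℝ) ^ 2)
    (hle : ∀ v, pull F D'.g.inner x v v ≤ k * D.g.inner x v v) :
    ∃ U ∈ 𝓝 x, ∀ y ∈ U, ∀ z ∈ U, D'.emetric.edist (F y) (F z) ≤ c * D.emetric.edist y z := by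
  have h1 : ∀ᶠ y in 𝓝 x, ContMDiffAt 𝓘(ℝ, E3) 𝓘(ℝ, E3) 1 F y :=
    (contMDiffAt_iff_contMDiffAt_nhds (by simp)).1 (hF.of_le (by norm_cast))
  have h2 := eventually_tensor_le ((D'.smooth_g _).pull hF) (D.smooth_g x) (D.g.pos x) hkc hle
  obtain ⟨r, hr, hrO⟩ := setOfPred_riemannianEDist_lt_subset_nhds 𝓘(ℝ, E3) (h1.and h2)
  -- With radius `r / 3`, two points of the ball are joined by a curve shorter than `2r / 3`, which
  -- stays within `r` of `x`, where the derivative bound holds.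
  have hr3 : (0 : ℝ≥0∞) < ((r / 3 : NNReal) : ℝ≥0∞) := by
    exact_mod_cast div_pos hr (by norm_num : (0 : NNReal) < 3)
  refine ⟨_, eventually_riemannianEDist_lt 𝓘(ℝ, E3) x hr3, fun y hy z hz => ?_⟩
  simp only [edist_eq]
  change riemannianEDist 𝓘(ℝ, E3) x y < _ at hy
  change riemannianEDist 𝓘(ℝ, E3) x z < _ at hz
  have hyz : riemannianEDist 𝓘(ℝ, E3) y z < ((r / 3 + r / 3 : NNReal) : ℝ≥0∞) := by
    rw [ENNReal.coe_add]
    refine (riemannianEDist_triangle (I := 𝓘(ℝ, E3)) (y := x)).trans_lt ?_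
    rw [riemannianEDist_comm]
    exact ENNReal.add_lt_add hy hz
  have key : ∀ L, riemannianEDist 𝓘(ℝ, E3) y z < L → L < ((r / 3 + r / 3 : NNReal) : ℝ≥0∞) →
      riemannianEDist 𝓘(ℝ, E3) (F y) (F z) ≤ c * L := by
    intro L hL hL'
    obtain ⟨γ, h0, h1, hγ, hlen⟩ := exists_lt_of_riemannianEDist_lt hL
    have hin : ∀ t ∈ Set.Icc (0 : ℝ) 1, riemannianEDist 𝓘(ℝ, E3) x (γ t) < r := by
      intro t ht
      have e1 : riemannianEDist 𝓘(ℝ, E3) y (γ t) ≤ pathELength 𝓘(ℝ, E3) γ 0 1 :=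
        (riemannianEDist_le_pathELength (hγ.mono (Set.Icc_subset_Icc_right ht.2)) h0 rfl
          ht.1).trans (pathELength_mono le_rfl ht.2)
      calc riemannianEDist 𝓘(ℝ, E3) x (γ t) ≤ _ + _ :=
            riemannianEDist_triangle (y := y)
        _ < ((r / 3 : NNReal) : ℝ≥0∞) + ((r / 3 + r / 3 : NNReal) : ℝ≥0∞) :=
            ENNReal.add_lt_add hy (e1.trans_lt (hlen.trans hL'))
        _ = r := by
            norm_cast
            ext
            push_cast
            ring
    have := riemannianEDist_map_le (c := c) ENNReal.coe_ne_top hγ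
      (fun t ht => (hrO (hin t ht)).1)
      (fun t ht v => enorm_mfderiv_le ((hrO (hin t ht)).2 v))
    rw [h0, h1] at this
    exact this.trans (by gcongr)
  have hne : (𝓝[>] riemannianEDist 𝓘(ℝ, E3) y z).NeBot := nhdsGT_neBot_of_exists_gt ⟨_, hyz⟩
  have hlim : Filter.Tendsto (fun L : ℝ≥0∞ => (c : ℝ≥0∞) * L)
      (𝓝[>] riemannianEDist 𝓘(ℝ, E3) y z) (𝓝 (c * riemannianEDist 𝓘(ℝ, E3) y z)) :=
    ENNReal.Tendsto.const_mul (Filter.tendsto_id.mono_left nhdsWithin_le_nhds)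
      (Or.inr ENNReal.coe_ne_top)
  refine ge_of_tendsto hlim ?_
  filter_upwards [Ioo_mem_nhdsGT hyz] with L hL using key L hL.1 hL.2

end CauchyData

end Penrose

namespace Penrose

/-! ### Images under locally Lipschitz maps -/

section Hausdorff

open Set

/-- Countably many of the neighbourhoods cover `S`; making them disjoint keeps the constant from
accumulating. `S` need not be measurable, so additivity is applied to the measure restricted to `S`,
on the measurable pieces. -/
theorem hausdorffMeasure_image_le_of_locally {X Y : Type} [EMetricSpace X]
    [SecondCountableTopology X] [MeasurableSpace X] [BorelSpace X] [EMetricSpace Y]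
    [MeasurableSpace Y] [BorelSpace Y] {F : X → Y} {S : Set X} {c : NNReal}
    (h : ∀ x ∈ S, ∃ U ∈ 𝓝 x, LipschitzOnWith c F U) (d : ℕ) :
    μH[d] (F '' S) ≤ (c : ℝ≥0∞) ^ d * μH[d] S := by
  rcases S.eq_empty_or_nonempty with rfl | ⟨x₀, hx₀⟩
  · simp
  choose! U hU hF using h
  obtain ⟨t, htS, htc, hcov⟩ := TopologicalSpace.countable_cover_nhdsWithin (s := S)
    (f := fun x => interior (U x)) fun x hx =>
      mem_nhdsWithin_of_mem_nhds (interior_mem_nhds.2 (hU x hx))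
  have htne : t.Nonempty := by
    by_contra hne
    rw [not_nonempty_iff_eq_empty.1 hne] at hcov
    simpa using hcov hx₀
  obtain ⟨p, hp⟩ := htc.exists_eq_range htne
  have hpS : ∀ n, p n ∈ S := fun n => htS (hp ▸ mem_range_self n)
  set V : ℕ → Set X := disjointed fun n => interior (U (p n)) with hV
  have hVm : ∀ n, MeasurableSet (V n) :=
    MeasurableSet.disjointed fun n => isOpen_interior.measurableSet
  have hVcov : ⋃ n, V n = ⋃ n, interior (U (p n)) := iUnion_disjointed
  have hVU : ∀ n, V n ⊆ U (p n) := fun n => (disjointed_le _ n).trans interior_subset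
  have hSV : S ⊆ ⋃ n, V n := by
    rw [hVcov]
    intro x hx
    obtain ⟨q, hq, hxq⟩ := mem_iUnion₂.1 (hcov hx)
    rw [hp] at hq
    obtain ⟨n, rfl⟩ := hq
    exact mem_iUnion.2 ⟨n, hxq⟩
  calc μH[d] (F '' S) ≤ μH[d] (⋃ n, F '' (V n ∩ S)) := by
        refine measure_mono ?_
        rw [← image_iUnion, ← iUnion_inter, inter_eq_right.2 hSV]
    _ ≤ ∑' n, μH[d] (F '' (V n ∩ S)) := measure_iUnion_le _
    _ ≤ ∑' n, (c : ℝ≥0∞) ^ d * (μH[d] : Measure X).restrict S (V n) := by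
        refine ENNReal.tsum_le_tsum fun n => ?_
        rw [Measure.restrict_apply (hVm n)]
        have := ((hF _ (hpS n)).mono (inter_subset_left.trans (hVU n))).hausdorffMeasure_image_le
          (s := V n ∩ S) (d := d) d.cast_nonneg
        rwa [ENNReal.rpow_natCast] at this
    _ = (c : ℝ≥0∞) ^ d * (μH[d] : Measure X).restrict S (⋃ n, V n) := by
        rw [ENNReal.tsum_mul_left, measure_iUnion (disjoint_disjointed _) hVm]
    _ ≤ _ := by
        refine mul_le_mul' le_rfl ?_
        rw [Measure.restrict_apply (MeasurableSet.iUnion hVm)]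
        exact measure_mono inter_subset_right

theorem hausdorffMeasure_image_le_of_forall_lt {X Y : Type} [EMetricSpace X]
    [SecondCountableTopology X] [MeasurableSpace X] [BorelSpace X] [EMetricSpace Y]
    [MeasurableSpace Y] [BorelSpace Y] {F : X → Y} {S : Set X}
    (h : ∀ c : NNReal, 1 < c → ∀ x ∈ S, ∃ U ∈ 𝓝 x, LipschitzOnWith c F U) (d : ℕ) :
    μH[d] (F '' S) ≤ μH[d] S := by
  have hlim : Filter.Tendsto (fun c : NNReal => (c : ℝ≥0∞) ^ d * μH[d] S) (𝓝[>] 1)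
      (𝓝 (1 * μH[d] S)) := by
    refine ENNReal.Tendsto.mul_const ?_ (Or.inl one_ne_zero)
    have : Filter.Tendsto (fun c : NNReal => (c : ℝ≥0∞) ^ d) (𝓝 1) (𝓝 (((1 : NNReal) : ℝ≥0∞) ^ d)) :=
      ((ENNReal.continuous_pow d).comp ENNReal.continuous_coe).tendsto 1
    simpa using this.mono_left nhdsWithin_le_nhds
  rw [one_mul] at hlim
  refine ge_of_tendsto hlim ?_
  filter_upwards [self_mem_nhdsWithin] with c hc
  exact hausdorffMeasure_image_le_of_locally (h c hc) d

end Hausdorff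

namespace CauchyData

attribute [local instance] emetric

/-- The area as a measure. -/
theorem area_eq (D : CauchyData) (S : Set D.carrier) :
    letI : MeasurableSpace D.carrier := borel D.carrier
    haveI : BorelSpace D.carrier := ⟨rfl⟩
    D.area S = (Measure.addHaarScalarFactor
      (volume : Measure (EuclideanSpace ℝ (Fin 2))) μH[(2 : ℕ)]) • (μH[(2 : ℕ)] : Measure D.carrier) S :=
  rfl

theorem area_mono (D : CauchyData) {S T : Set D.carrier} (h : S ⊆ T) : D.area S ≤ D.area T := by
  rw [area]
  exact measure_mono h

theorem area_empty (D : CauchyData) : D.area ∅ = 0 := by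
  rw [area]
  exact measure_empty

theorem area_union_le (D : CauchyData) (S T : Set D.carrier) :
    D.area (S ∪ T) ≤ D.area S + D.area T := by
  rw [area]
  exact measure_union_le _ _

theorem area_inter_add_diff (D : CauchyData) (S : Set D.carrier) {T : Set D.carrier}
    (hT : MeasurableSet[borel D.carrier] T) : D.area (S ∩ T) + D.area (S \ T) = D.area S := by
  let : MeasurableSpace D.carrier := borel D.carrier
  rw [area]
  exact measure_inter_add_sdiff _ hT

/-- A map which preserves the metric at the points of a set does not increase its area. -/
theorem area_image_le {D D' : CauchyData} {F : D.carrier → D'.carrier} {S : Set D.carrier}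
    (hF : ∀ x ∈ S, ContMDiffAt 𝓘(ℝ, E3) 𝓘(ℝ, E3) ∞ F x)
    (hS : ∀ x ∈ S, pull F D'.g.inner x = D.g.inner x) : D'.area (F '' S) ≤ D.area S := by
  let : MeasurableSpace D.carrier := borel D.carrier
  have : BorelSpace D.carrier := ⟨rfl⟩
  let : MeasurableSpace D'.carrier := borel D'.carrier
  have : BorelSpace D'.carrier := ⟨rfl⟩
  rw [area_eq, area_eq]
  gcongr
  refine hausdorffMeasure_image_le_of_forall_lt (fun c hc x hx => ?_) 2
  obtain ⟨U, hU, h⟩ := exists_lipschitz_nhds (c := c) (hF x hx) (k := 1)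
    (one_lt_pow₀ (by exact_mod_cast hc) two_ne_zero) (fun v => by rw [hS x hx, one_mul])
  exact ⟨U, hU, fun y hy z hz => h y hy z hz⟩

end CauchyData

/-! ### Smooth surfaces have locally finite area -/

/-- The Euclidean space. -/
def flatData : CauchyData :=
  CauchyData.ofTensors E3 (riemannianMetricVectorSpace E3).inner (fun _ => 0)
    (riemannianMetricVectorSpace E3).symm (fun _ _ _ => rfl) (riemannianMetricVectorSpace E3).pos
    (fun x => ((riemannianMetricVectorSpace E3).contMDiff x).of_le le_top)
    (fun _ => smoothTensorAt_iff.2 fun _ _ => contMDiffAt_const)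

theorem flatData_edist (x y : E3) : flatData.emetric.edist x y = edist x y :=
  (IsRiemannianManifold.out (I := 𝓘(ℝ, E3)) x y).symm

/-- Comparison with flat data: the pulled-back form `B` satisfies `B(v, v) ≤ ‖B‖ ‖v‖²`, and `‖B‖ <
(‖B‖ + 1)²`. -/
theorem exists_lipschitz_nhds_of_contMDiffAt {D : CauchyData} {F : E3 → D.carrier} {x : E3}
    (hF : ContMDiffAt 𝓘(ℝ, E3) 𝓘(ℝ, E3) ∞ F x) : ∃ c : NNReal, ∃ U ∈ 𝓝 x, ∀ y ∈ U, ∀ z ∈ U,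
      D.emetric.edist (F y) (F z) ≤ c * edist y z := by
  set B : E3 →L[ℝ] E3 →L[ℝ] ℝ := pull F D.g.inner x with hB
  have hc : ‖B‖ < ((Real.toNNReal (‖B‖ + 1) : NNReal) : ℝ) ^ 2 := by
    have := norm_nonneg B
    rw [Real.coe_toNNReal _ (by linarith)]
    nlinarith
  obtain ⟨U, hU, h⟩ := CauchyData.exists_lipschitz_nhds (D := flatData) (D' := D) (F := F) (x := x)
    hF hc (fun v : E3 => by
      have h1 : B v v ≤ ‖B‖ * ‖v‖ * ‖v‖ := (Real.le_norm_self _).trans (B.le_opNorm₂ v v)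
      have h2 : flatData.g.inner x v v = ‖v‖ ^ 2 := real_inner_self_eq_norm_sq v
      rw [h2, pow_two, ← mul_assoc]
      exact h1)
  exact ⟨Real.toNNReal (‖B‖ + 1), U, hU, fun y hy z hz =>
    (h y hy z hz).trans_eq (by rw [flatData_edist])⟩

end Penrose

namespace Penrose

open Set

/-- A regular level set in `ℝ³` is locally parametrized by a Lipschitz map on a plane. -/
theorem exists_lipschitz_parametrization {f : E3 → ℝ} {a : E3} (hf : ContDiffAt ℝ ∞ f a)
    (hf' : fderiv ℝ f a ≠ 0) : ∃ P : Submodule ℝ E3, Module.finrank ℝ P = 2 ∧ ∃ ψ : P → E3,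
      ψ 0 = a ∧ (∃ K : NNReal, ∃ s ∈ 𝓝 (0 : P), LipschitzOnWith K ψ s) ∧
      ∀ W ∈ 𝓝 (0 : P), ∀ᶠ x in 𝓝 a, f x = f a → x ∈ ψ '' W := by
  have hs : HasStrictFDerivAt f (fderiv ℝ f a) a := hf.hasStrictFDerivAt (by simp)
  have hsurj : (fderiv ℝ f a).range = ⊤ :=
    Module.Dual.range_eq_top_of_ne_zero (f := (fderiv ℝ f a).toLinearMap)
      fun h => hf' (ContinuousLinearMap.coe_injective h)
  refine ⟨(fderiv ℝ f a).ker, ?_, hs.implicitFunction f (fderiv ℝ f a) hsurj (f a), ?_, ?_, ?_⟩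
  · have h1 := (fderiv ℝ f a).toLinearMap.finrank_range_add_finrank_ker
    have h2 : Module.finrank ℝ (fderiv ℝ f a).toLinearMap.range = 1 := by
      rw [hsurj, finrank_top, Module.finrank_self]
    have h3 : Module.finrank ℝ E3 = 3 := by simp
    change Module.finrank ℝ (fderiv ℝ f a).toLinearMap.ker = 2
    omega
  · exact hs.implicitFunction_apply_image hsurj
  · exact (hs.to_implicitFunction hsurj).exists_lipschitzOnWith
  · intro W hW
    have h0 := hs.implicitToOpenPartialHomeomorph_self hsurj
    have hc := (hs.implicitToOpenPartialHomeomorph f (fderiv ℝ f a) hsurj).continuousAt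
      (hs.mem_implicitToOpenPartialHomeomorph_source hsurj)
    have h1 : ∀ᶠ x in 𝓝 a,
        (hs.implicitToOpenPartialHomeomorph f (fderiv ℝ f a) hsurj x).snd ∈ W := by
      refine (continuous_snd.continuousAt.comp hc) ?_
      simpa [h0] using hW
    filter_upwards [h1, hs.eq_implicitFunction hsurj] with x hx hx' hfx
    exact ⟨_, hx, by rw [hfx] at hx'; exact hx'⟩

namespace CauchyData

variable {D : CauchyData}

attribute [local instance] emetric

/-- By the implicit function theorem in a chart, the level set near `p` is the Lipschitz image of a
bounded piece of a plane, which has finite two-dimensional Hausdorff measure. -/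
theorem exists_nhds_area_levelSet_lt_top {f : D.carrier → ℝ} {U : Set D.carrier} (hU : IsOpen U)
    (hf : D.RegularOn f U) {p : D.carrier} (hp : p ∈ U) :
    ∃ V ∈ 𝓝 p, D.area ({x | f x = f p} ∩ V) < ⊤ := by
  set e := chartAt E3 p with he
  have hed : IsDiffeo e := isDiffeo_of_mem_maximalAtlas (IsManifold.chart_mem_maximalAtlas p)
  have hpe : p ∈ e.source := mem_chart_source E3 p
  have hat : e p ∈ e.target := e.map_source hpe
  have hep : e.symm (e p) = p := e.left_inv hpe
  have hfp : ContMDiffAt 𝓘(ℝ, E3) 𝓘(ℝ, ℝ) ∞ f p := hf.1.contMDiffAt (hU.mem_nhds hp)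
  have hsm : ContMDiffAt 𝓘(ℝ, E3) 𝓘(ℝ, E3) ∞ e.symm (e p) := hed.symm.contMDiffAt hat
  have hφ : ContMDiffAt 𝓘(ℝ, E3) 𝓘(ℝ, ℝ) ∞ (f ∘ e.symm) (e p) :=
    ContMDiffAt.comp (e p) (by rwa [hep]) hsm
  have hfd : fderiv ℝ (f ∘ e.symm) (e p) ≠ 0 := by
    intro h0
    refine hf.2 p hp ?_
    have h1 : f =ᶠ[𝓝 p] (f ∘ e.symm) ∘ e := by
      filter_upwards [e.open_source.mem_nhds hpe] with x hx
      simp [e.left_inv hx]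
    have h2 := mfderiv_comp p (hφ.mdifferentiableAt (by simp)) (hed.mdifferentiableAt hpe)
    rw [h1.mfderiv_eq, h2, mfderiv_eq_fderiv, h0]
    exact ContinuousLinearMap.zero_comp _
  obtain ⟨P, hP, ψ, hψ0, ⟨K, s, hs, hK⟩, hψ⟩ :=
    exists_lipschitz_parametrization (contMDiffAt_iff_contDiffAt.1 hφ) hfd
  obtain ⟨c, U₁, hU₁, hc⟩ := exists_lipschitz_nhds_of_contMDiffAt hsm
  have hψc : ContinuousAt ψ 0 := hK.continuousOn.continuousAt hs
  rw [← hψ0] at hU₁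
  set W : Set P := s ∩ ψ ⁻¹' U₁ ∩ Metric.ball 0 1 with hW
  have hW0 : W ∈ 𝓝 (0 : P) :=
    Filter.inter_mem (Filter.inter_mem hs (hψc hU₁)) (Metric.ball_mem_nhds _ one_pos)
  have hL : LipschitzOnWith (c * K) (e.symm ∘ ψ) W := by
    intro y hy z hz
    refine (hc _ hy.1.2 _ hz.1.2).trans ?_
    rw [ENNReal.coe_mul, mul_assoc]
    gcongr
    exact hK hy.1.1 hz.1.1
  refine ⟨e ⁻¹' {x | (f ∘ e.symm) x = (f ∘ e.symm) (e p) → x ∈ ψ '' W} ∩ e.source,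
    Filter.inter_mem (e.continuousAt hpe (hψ W hW0)) (e.open_source.mem_nhds hpe), ?_⟩
  let : MeasurableSpace D.carrier := borel D.carrier
  have : BorelSpace D.carrier := ⟨rfl⟩
  have hWfin : (μH[(2 : ℕ)] : Measure P) W < ⊤ := by
    have hb : (μH[Module.finrank ℝ P] : Measure P) (Metric.ball 0 1) < ⊤ := measure_ball_lt_top
    rw [hP] at hb
    exact (measure_mono inter_subset_right).trans_lt hb
  have h1 := hL.hausdorffMeasure_image_le (d := (2 : ℕ)) (by norm_num)
  refine (D.area_mono (T := (e.symm ∘ ψ) '' W) ?_).trans_lt ?_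
  · rintro x ⟨hx, hxV, hxe⟩
    obtain ⟨w, hw, hwx⟩ := hxV (by simpa [e.left_inv hxe, hep] using hx)
    exact ⟨w, hw, by simp [hwx, e.left_inv hxe]⟩
  · rw [area_eq]
    refine ENNReal.mul_lt_top ENNReal.coe_lt_top (h1.trans_lt ?_)
    refine ENNReal.mul_lt_top ?_ hWfin
    exact ENNReal.rpow_lt_top_of_nonneg (by norm_num) ENNReal.coe_ne_top

theorem eq_zero_of_mem_frontier {f : D.carrier → ℝ} {U Ω : Set D.carrier} (hU : IsOpen U)
    (hf : ContinuousOn f U) (h : Ω ∩ U = {x | f x < 0} ∩ U) {x : D.carrier} (hx : x ∈ frontier Ω)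
    (hxU : x ∈ U) : f x = 0 := by
  have hc := hf.continuousAt (hU.mem_nhds hxU)
  have key : ∀ y ∈ U, y ∈ Ω ↔ f y < 0 := fun y hy =>
    ⟨fun hy' => (h.subset ⟨hy', hy⟩).1, fun hy' => (h.superset ⟨hy', hy⟩).1⟩
  rcases lt_trichotomy (f x) 0 with h0 | h0 | h0
  · refine (hx.2 (mem_interior_iff_mem_nhds.2 ?_)).elim
    filter_upwards [hc.eventually_lt_const h0, hU.mem_nhds hxU] with y hy hyU
      using (key y hyU).2 hy
  · exact h0
  · have h1 : ∀ᶠ y in 𝓝 x, y ∉ Ω := by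
      filter_upwards [hc.eventually_const_lt h0, hU.mem_nhds hxU] with y hy hyU hyΩ
      exact hy.not_gt ((key y hyU).1 hyΩ)
    obtain ⟨y, hy, hyΩ⟩ := mem_closure_iff_nhds.1 hx.1 _ h1
    exact (hy hyΩ).elim

/-- Compactness reduces this to the local bound for level sets. Finiteness is needed later to
subtract areas. -/
theorem SmoothBoundary.area_lt_top {Ω : Set D.carrier} (h : D.SmoothBoundary Ω)
    (hc : IsCompact (frontier Ω)) : D.area (frontier Ω) < ⊤ := by
  refine hc.induction_on (p := fun S => D.area S < ⊤) (by simp [area_empty])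
    (fun s t hst ht => (D.area_mono hst).trans_lt ht)
    (fun s t hs ht => (D.area_union_le s t).trans_lt (ENNReal.add_lt_top.2 ⟨hs, ht⟩)) ?_
  intro p hp
  obtain ⟨U, hU, hpU, f, hf, hfU⟩ := h p hp
  obtain ⟨V, hV, hfin⟩ := exists_nhds_area_levelSet_lt_top hU hf hpU
  have h0 : ∀ x ∈ frontier Ω, x ∈ U → f x = 0 := fun x hx hxU =>
    eq_zero_of_mem_frontier hU hf.1.continuousOn hfU hx hxU
  refine ⟨frontier Ω ∩ (U ∩ V), ?_, (D.area_mono ?_).trans_lt hfin⟩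
  · exact Filter.inter_mem self_mem_nhdsWithin
      (mem_nhdsWithin_of_mem_nhds (Filter.inter_mem (hU.mem_nhds hpU) hV))
  · rintro x ⟨hx, hxU, hxV⟩
    exact ⟨(h0 x hx hxU).trans (h0 p hp hpU).symm, hxV⟩

end CauchyData

end Penrose

/-! ### Smooth and piecewise smooth boundaries -/

namespace Penrose

open Set

namespace CauchyData

variable {D D' : CauchyData}

theorem RegularOn.mono {f : D.carrier → ℝ} {U V : Set D.carrier} (h : D.RegularOn f U)
    (hVU : V ⊆ U) : D.RegularOn f V :=
  ⟨h.1.mono hVU, fun x hx => h.2 x (hVU hx)⟩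

/-- Since `f = (f ∘ φ) ∘ φ⁻¹` locally, a critical point of `f ∘ φ` maps to one of `f`. -/
theorem RegularOn.comp {f : D'.carrier → ℝ} {U : Set D'.carrier} (h : D'.RegularOn f U)
    (hU : IsOpen U) {φ : OpenPartialHomeomorph D.carrier D'.carrier} (hφ : IsDiffeo φ) :
    D.RegularOn (f ∘ φ) (φ.source ∩ φ ⁻¹' U) := by
  refine ⟨h.1.comp (hφ.1.mono inter_subset_left) inter_subset_right, fun x hx h0 => ?_⟩
  have hf : ContMDiffAt 𝓘(ℝ, E3) 𝓘(ℝ, ℝ) ∞ f (φ x) := h.1.contMDiffAt (hU.mem_nhds hx.2)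
  have hfφ : ContMDiffAt 𝓘(ℝ, E3) 𝓘(ℝ, ℝ) ∞ (f ∘ φ) x := hf.comp x (hφ.contMDiffAt hx.1)
  have hxt := φ.map_source hx.1
  refine h.2 (φ x) hx.2 ?_
  have h1 : f =ᶠ[𝓝 (φ x)] (f ∘ φ) ∘ φ.symm := by
    filter_upwards [φ.open_target.mem_nhds hxt] with y hy
    simp [φ.right_inv hy]
  have h2 : ∀ z, z = x → MDifferentiableAt 𝓘(ℝ, E3) 𝓘(ℝ, ℝ) (f ∘ φ) z ∧
      mfderiv 𝓘(ℝ, E3) 𝓘(ℝ, ℝ) (f ∘ φ) z = 0 := by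
    rintro z rfl
    exact ⟨hfφ.mdifferentiableAt (by simp), h0⟩
  obtain ⟨h3, h4⟩ := h2 _ (φ.left_inv hx.1)
  rw [h1.mfderiv_eq, mfderiv_comp (φ x) h3 (hφ.symm.mdifferentiableAt hxt), h4]
  exact ContinuousLinearMap.zero_comp _

/-- `Ω` has smooth boundary near `p`. -/
def SmoothBoundaryAt (D : CauchyData) (Ω : Set D.carrier) (p : D.carrier) : Prop :=
  ∃ U : Set D.carrier, IsOpen U ∧ p ∈ U ∧ ∃ f : D.carrier → ℝ,
    D.RegularOn f U ∧ Ω ∩ U = {x | f x < 0} ∩ U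

/-- `Ω` has piecewise smooth boundary near `p`. -/
def PiecewiseSmoothBoundaryAt (D : CauchyData) (Ω : Set D.carrier) (p : D.carrier) : Prop :=
  ∃ U : Set D.carrier, IsOpen U ∧ p ∈ U ∧
    ∃ S : Set (Set (D.carrier → ℝ)), S.Finite ∧
      (∀ T ∈ S, T.Finite ∧ ∀ f ∈ T, D.RegularOn f U) ∧
      Ω ∩ U = {x | ∃ T ∈ S, ∀ f ∈ T, f x < 0} ∩ U

theorem SmoothBoundaryAt.piecewise {Ω : Set D.carrier} {p : D.carrier}
    (h : D.SmoothBoundaryAt Ω p) : D.PiecewiseSmoothBoundaryAt Ω p := by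
  obtain ⟨U, hU, hp, f, hf, hfU⟩ := h
  refine ⟨U, hU, hp, {{f}}, finite_singleton _, ?_, ?_⟩
  · rintro T rfl
    exact ⟨finite_singleton _, by rintro f' rfl; exact hf⟩
  · simpa using hfU

/-- An empty intersection gives everything (interior points) and an empty union gives nothing
(exterior points). The local condition can thus be used at every point, and combining two regions
needs no discussion of which frontiers the point lies on. -/
theorem piecewiseSmoothBoundaryAt_of_notMem_frontier {Ω : Set D.carrier} {p : D.carrier}
    (h : p ∉ frontier Ω) : D.PiecewiseSmoothBoundaryAt Ω p := by
  by_cases hp : p ∈ closure Ω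
  · refine ⟨interior Ω, isOpen_interior, not_not.1 fun h' => h ⟨hp, h'⟩, {∅}, finite_singleton _,
      ?_, ?_⟩
    · rintro T rfl
      exact ⟨finite_empty, fun f hf => hf.elim⟩
    · simpa using inter_eq_right.2 interior_subset
  · refine ⟨(closure Ω)ᶜ, isClosed_closure.isOpen_compl, hp, ∅, finite_empty,
      fun T hT => hT.elim, ?_⟩
    simpa using (disjoint_compl_right_iff_subset.2 subset_closure).inter_eq

theorem piecewiseSmoothBoundary_iff {Ω : Set D.carrier} :
    D.PiecewiseSmoothBoundary Ω ↔ ∀ p, D.PiecewiseSmoothBoundaryAt Ω p :=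
  ⟨fun h p => by
    by_cases hp : p ∈ frontier Ω
    · exact h p hp
    · exact piecewiseSmoothBoundaryAt_of_notMem_frontier hp, fun h p _ => h p⟩

theorem PiecewiseSmoothBoundaryAt.union {Ω Ω' : Set D.carrier} {p : D.carrier}
    (h : D.PiecewiseSmoothBoundaryAt Ω p) (h' : D.PiecewiseSmoothBoundaryAt Ω' p) :
    D.PiecewiseSmoothBoundaryAt (Ω ∪ Ω') p := by
  obtain ⟨U, hU, hp, S, hS, hST, hSU⟩ := h
  obtain ⟨U', hU', hp', S', hS', hST', hSU'⟩ := h'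
  refine ⟨U ∩ U', hU.inter hU', ⟨hp, hp'⟩, S ∪ S', hS.union hS', ?_, ?_⟩
  · rintro T (hT | hT)
    · exact ⟨(hST T hT).1, fun f hf => ((hST T hT).2 f hf).mono inter_subset_left⟩
    · exact ⟨(hST' T hT).1, fun f hf => ((hST' T hT).2 f hf).mono inter_subset_right⟩
  · ext x
    have h1 : x ∈ U → (x ∈ Ω ↔ ∃ T ∈ S, ∀ f ∈ T, f x < 0) := fun hx => by
      simpa [hx] using Set.ext_iff.1 hSU x
    have h2 : x ∈ U' → (x ∈ Ω' ↔ ∃ T ∈ S', ∀ f ∈ T, f x < 0) := fun hx => by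
      simpa [hx] using Set.ext_iff.1 hSU' x
    refine and_congr_left fun hx => ?_
    rw [mem_union, h1 hx.1, h2 hx.2]
    simp only [mem_union, mem_ofPred_eq, or_and_right, exists_or]

/-- Distributivity: the new conjunctions are the unions `T ∪ T'` of one conjunction from each side.
-/
theorem PiecewiseSmoothBoundaryAt.inter {Ω Ω' : Set D.carrier} {p : D.carrier}
    (h : D.PiecewiseSmoothBoundaryAt Ω p) (h' : D.PiecewiseSmoothBoundaryAt Ω' p) :
    D.PiecewiseSmoothBoundaryAt (Ω ∩ Ω') p := by
  obtain ⟨U, hU, hp, S, hS, hST, hSU⟩ := h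
  obtain ⟨U', hU', hp', S', hS', hST', hSU'⟩ := h'
  refine ⟨U ∩ U', hU.inter hU', ⟨hp, hp'⟩, image2 (· ∪ ·) S S', hS.image2 _ hS', ?_, ?_⟩
  · rintro _ ⟨T, hT, T', hT', rfl⟩
    refine ⟨(hST T hT).1.union (hST' T' hT').1, ?_⟩
    rintro f (hf | hf)
    · exact ((hST T hT).2 f hf).mono inter_subset_left
    · exact ((hST' T' hT').2 f hf).mono inter_subset_right
  · ext x
    have h1 : x ∈ U → (x ∈ Ω ↔ ∃ T ∈ S, ∀ f ∈ T, f x < 0) := fun hx => by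
      simpa [hx] using Set.ext_iff.1 hSU x
    have h2 : x ∈ U' → (x ∈ Ω' ↔ ∃ T ∈ S', ∀ f ∈ T, f x < 0) := fun hx => by
      simpa [hx] using Set.ext_iff.1 hSU' x
    refine and_congr_left fun hx => ?_
    rw [mem_inter_iff, h1 hx.1, h2 hx.2]
    constructor
    · rintro ⟨⟨T, hT, hTf⟩, T', hT', hTf'⟩
      exact ⟨T ∪ T', mem_image2_of_mem hT hT', fun f hf => hf.elim (hTf f) (hTf' f)⟩
    · rintro ⟨_, ⟨T, hT, T', hT', rfl⟩, hf⟩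
      exact ⟨⟨T, hT, fun f h => hf f (Or.inl h)⟩, T', hT', fun f h => hf f (Or.inr h)⟩

theorem SmoothBoundaryAt.transfer {Ω : Set D.carrier} {Ω' : Set D'.carrier}
    {φ : OpenPartialHomeomorph D.carrier D'.carrier} (hφ : IsDiffeo φ) {p : D.carrier}
    (hp : p ∈ φ.source) (h : D'.SmoothBoundaryAt Ω' (φ p))
    (heq : ∀ᶠ x in 𝓝 p, x ∈ Ω ↔ φ x ∈ Ω') : D.SmoothBoundaryAt Ω p := by
  obtain ⟨U, hU, hpU, f, hf, hfU⟩ := h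
  obtain ⟨V, hV, hVo, hpV⟩ := eventually_nhds_iff.1 heq
  refine ⟨φ.source ∩ φ ⁻¹' U ∩ V, (φ.isOpen_inter_preimage hU).inter hVo, ⟨⟨hp, hpU⟩, hpV⟩,
    f ∘ φ, (hf.comp hU hφ).mono inter_subset_left, ?_⟩
  ext x
  refine and_congr_left fun hx => ?_
  rw [hV x hx.2]
  simpa [show φ x ∈ U from hx.1.2] using Set.ext_iff.1 hfU (φ x)

theorem PiecewiseSmoothBoundaryAt.transfer {Ω : Set D.carrier} {Ω' : Set D'.carrier}
    {φ : OpenPartialHomeomorph D.carrier D'.carrier} (hφ : IsDiffeo φ) {p : D.carrier}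
    (hp : p ∈ φ.source) (h : D'.PiecewiseSmoothBoundaryAt Ω' (φ p))
    (heq : ∀ᶠ x in 𝓝 p, x ∈ Ω ↔ φ x ∈ Ω') : D.PiecewiseSmoothBoundaryAt Ω p := by
  obtain ⟨U, hU, hpU, S, hS, hST, hSU⟩ := h
  obtain ⟨V, hV, hVo, hpV⟩ := eventually_nhds_iff.1 heq
  refine ⟨φ.source ∩ φ ⁻¹' U ∩ V, (φ.isOpen_inter_preimage hU).inter hVo, ⟨⟨hp, hpU⟩, hpV⟩,
    (fun T => (fun f => f ∘ φ) '' T) '' S, hS.image _, ?_, ?_⟩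
  · rintro _ ⟨T, hT, rfl⟩
    refine ⟨(hST T hT).1.image _, ?_⟩
    rintro _ ⟨f, hf, rfl⟩
    exact (((hST T hT).2 f hf).comp hU hφ).mono inter_subset_left
  · ext x
    refine and_congr_left fun hx => ?_
    rw [hV x hx.2]
    simpa [show φ x ∈ U from hx.1.2] using Set.ext_iff.1 hSU (φ x)

end CauchyData

end Penrose

/-! ### Lipschitz bounds for functions from bounds on the differential -/

namespace Penrose

open Set Manifold

namespace CauchyData

attribute [local instance] riemannianBundle isContinuousRiemannianBundle locallyCompactSpace

/-- The differential of a function, as a real number. -/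
def differential (D : CauchyData) (F : D.carrier → ℝ) (x : D.carrier)
    (v : TangentSpace 𝓘(ℝ, E3) x) : ℝ :=
  mfderiv 𝓘(ℝ, E3) 𝓘(ℝ, ℝ) F x v

/-- A function whose differential is bounded by `c` is Lipschitz. -/
theorem edist_le_of_mfderiv_le {D : CauchyData} {F : D.carrier → ℝ}
    (hF : ContMDiff 𝓘(ℝ, E3) 𝓘(ℝ, ℝ) 1 F) {c : NNReal} (hc : c ≠ 0)
    (h : ∀ x (v : TangentSpace 𝓘(ℝ, E3) x),
      D.differential F x v ^ 2 ≤ (c : ℝ) ^ 2 * D.g.inner x v v)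
    (x y : D.carrier) : edist (F x) (F y) ≤ c * D.emetric.edist x y := by
  rw [edist_eq, IsRiemannianManifold.out (I := 𝓘(ℝ, ℝ)) (F x) (F y)]
  have hn : ∀ x (v : TangentSpace 𝓘(ℝ, E3) x), ‖mfderiv 𝓘(ℝ, E3) 𝓘(ℝ, ℝ) F x v‖ₑ ≤ c * ‖v‖ₑ := by
    intro x v
    have h1 : |D.differential F x v| ≤ c * ‖v‖ := by
      refine abs_le_of_sq_le_sq ?_ (mul_nonneg c.coe_nonneg (norm_nonneg v))
      rw [mul_pow, D.norm_sq_eq]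
      exact h x v
    rw [enorm_tangentSpace_vectorSpace]
    change ‖D.differential F x v‖ₑ ≤ c * ‖v‖ₑ
    rw [← ofReal_norm, ← ofReal_norm, ← ENNReal.ofReal_coe_nnreal,
      ← ENNReal.ofReal_mul c.coe_nonneg]
    exact ENNReal.ofReal_le_ofReal h1
  rcases eq_or_ne (riemannianEDist 𝓘(ℝ, E3) x y) ⊤ with htop | htop
  · rw [htop, ENNReal.mul_top (by simpa using hc)]
    exact le_top
  have key : ∀ L, riemannianEDist 𝓘(ℝ, E3) x y < L →
      riemannianEDist 𝓘(ℝ, ℝ) (F x) (F y) ≤ c * L := by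
    intro L hL
    obtain ⟨γ, h0, h1, hγ, hlen⟩ := exists_lt_of_riemannianEDist_lt hL
    have := riemannianEDist_map_le (c := c) ENNReal.coe_ne_top hγ
      (fun t _ => hF (γ t)) (fun t _ v => hn _ v)
    rw [h0, h1] at this
    exact this.trans (by gcongr)
  have hne : (𝓝[>] riemannianEDist 𝓘(ℝ, E3) x y).NeBot :=
    nhdsGT_neBot_of_exists_gt ⟨_, htop.lt_top⟩
  have hlim : Filter.Tendsto (fun L : ℝ≥0∞ => (c : ℝ≥0∞) * L)
      (𝓝[>] riemannianEDist 𝓘(ℝ, E3) x y) (𝓝 (c * riemannianEDist 𝓘(ℝ, E3) x y)) :=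
    ENNReal.Tendsto.const_mul (Filter.tendsto_id.mono_left nhdsWithin_le_nhds)
      (Or.inr ENNReal.coe_ne_top)
  refine ge_of_tendsto hlim ?_
  filter_upwards [self_mem_nhdsWithin] with L hL using key L hL

/-- Transplanting a function with compact support by means of a chart. -/
theorem edist_indicator_le {D : CauchyData} {e : OpenPartialHomeomorph D.carrier E3}
    (he : IsDiffeo e) {u : E3 → ℝ} (hu : ContDiff ℝ ∞ u) (hc : HasCompactSupport u)
    (hsupp : tsupport u ⊆ e.target) {L : NNReal} (hL : ∀ y, ‖fderiv ℝ u y‖ ≤ L) {C : NNReal}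
    (hLC : L * C ≠ 0)
    (hg : ∀ y ∈ tsupport u, ∀ v : E3, ‖v‖ ^ 2 ≤ (C : ℝ) ^ 2 * pull e.symm D.g.inner y v v)
    (x y : D.carrier) :
    edist (e.source.indicator (u ∘ e) x) (e.source.indicator (u ∘ e) y) ≤
      (L * C : NNReal) * D.emetric.edist x y := by
  have hK : IsCompact (e.symm '' tsupport u) :=
    hc.isCompact.image_of_continuousOn (e.continuousOn_symm.mono hsupp)
  have hin : ∀ x ∈ e.source, e.source.indicator (u ∘ e) =ᶠ[𝓝 x] u ∘ e := fun x hx => by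
    filter_upwards [e.open_source.mem_nhds hx] with z hz using indicator_of_mem hz _
  have hout : ∀ x ∉ e.symm '' tsupport u, e.source.indicator (u ∘ e) =ᶠ[𝓝 x] fun _ => 0 := by
    intro x hx
    filter_upwards [hK.isClosed.isOpen_compl.mem_nhds hx] with z hz
    by_cases hze : z ∈ e.source
    · rw [indicator_of_mem hze]
      exact image_eq_zero_of_notMem_tsupport (f := u) fun h => hz ⟨e z, h, e.left_inv hze⟩
    · exact indicator_of_notMem hze _
  have hsm : ∀ x ∈ e.source, ContMDiffAt 𝓘(ℝ, E3) 𝓘(ℝ, ℝ) ∞ (u ∘ e) x := fun x hx =>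
    ContMDiffAt.comp x hu.contMDiff.contMDiffAt (he.contMDiffAt hx)
  refine edist_le_of_mfderiv_le ?_ hLC ?_ x y
  · intro x
    by_cases hx : x ∈ e.symm '' tsupport u
    · have hxe : x ∈ e.source := by
        obtain ⟨z, hz, rfl⟩ := hx
        exact e.map_target (hsupp hz)
      exact ((hsm x hxe).of_le (by norm_cast)).congr_of_eventuallyEq (hin x hxe)
    · exact contMDiffAt_const.congr_of_eventuallyEq (hout x hx)
  · intro x v
    by_cases hx : x ∈ e.symm '' tsupport u
    · obtain ⟨z, hz, rfl⟩ := hx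
      have hze : e.symm z ∈ e.source := e.map_target (hsupp hz)
      have hez := e.right_inv (hsupp hz)
      rw [differential, (hin _ hze).mfderiv_eq, mfderiv_comp _ (hu.contMDiff.mdifferentiableAt (by simp))
        (he.mdifferentiableAt hze), mfderiv_eq_fderiv]
      set w : E3 := mfderiv 𝓘(ℝ, E3) 𝓘(ℝ, E3) e (e.symm z) v with hw
      have h1 : |fderiv ℝ u (e (e.symm z)) w| ≤ L * ‖w‖ :=
        ((fderiv ℝ u (e (e.symm z))).le_opNorm w).trans (by gcongr; exact hL _)
      have h2 : pull e.symm D.g.inner z w w = D.g.inner (e.symm z) v v := by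
        have h3 := he.mfderiv_symm_mfderiv hze v
        rw [hez] at h3
        exact congrArg₂ (fun a b => D.g.inner (e.symm z) a b) h3 h3
      have h4 := hg z hz w
      rw [h2] at h4
      calc (fderiv ℝ u (e (e.symm z)) w) ^ 2 ≤ (L * ‖w‖) ^ 2 := sq_le_sq' (abs_le.1 h1).1 (abs_le.1 h1).2
        _ = (L : ℝ) ^ 2 * ‖w‖ ^ 2 := mul_pow _ _ _
        _ ≤ (L : ℝ) ^ 2 * ((C : ℝ) ^ 2 * D.g.inner (e.symm z) v v) := by gcongr
        _ = _ := by push_cast; ring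
    · rw [differential, (hout x hx).mfderiv_eq, mfderiv_const]
      have h0 : (0 : ℝ) ≤ D.g.inner x v v := by
        rw [← D.norm_sq_eq]
        positivity
      change (0 : ℝ) ^ 2 ≤ _
      rw [zero_pow two_ne_zero]
      positivity

end CauchyData

end Penrose

/-! ### Completeness from asymptotic flatness -/

namespace Penrose

open Set

theorem form_eq_sum (B : E3 →L[ℝ] E3 →L[ℝ] ℝ) (v : E3) :
    B v v = ∑ i, ∑ j, B (basisVec i) (basisVec j) * (v i * v j) := by
  conv_lhs => rw [eq_sum_basisVec v]
  simp only [map_sum, sum_apply, map_smul, smul_apply,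
    smul_eq_mul]
  rw [Finset.sum_comm]
  refine Finset.sum_congr rfl fun i _ => ?_
  rw [Finset.mul_sum]
  exact Finset.sum_congr rfl fun j _ => by ring

/-- An entrywise error of `1/6` changes the form by at most the sum over `i, j` of `(vᵢ² + vⱼ²) /
12`, which is `‖v‖² / 2` in dimension three. -/
theorem norm_sq_le_two_mul_form (B : E3 →L[ℝ] E3 →L[ℝ] ℝ)
    (h : ∀ i j, |B (basisVec i) (basisVec j) - (1 : Matrix (Fin 3) (Fin 3) ℝ) i j| ≤ 1 / 6) (v : E3) :
    ‖v‖ ^ 2 ≤ 2 * B v v := by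
  have key : ∀ i j, (1 : Matrix (Fin 3) (Fin 3) ℝ) i j * (v i * v j) - (v i ^ 2 + v j ^ 2) / 12 ≤
      B (basisVec i) (basisVec j) * (v i * v j) := by
    intro i j
    have h1 := abs_le.1 ((abs_mul _ (v i * v j)).trans_le
      (mul_le_mul_of_nonneg_right (h i j) (abs_nonneg (v i * v j))))
    have h2 : |v i * v j| ≤ (v i ^ 2 + v j ^ 2) / 2 := by
      rw [abs_le]
      constructor <;> nlinarith [sq_nonneg (v i + v j), sq_nonneg (v i - v j)]
    nlinarith [h1.1]
  have hsum := Finset.sum_le_sum fun i (_ : i ∈ Finset.univ) =>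
    Finset.sum_le_sum fun j (_ : j ∈ Finset.univ) => key i j
  rw [← form_eq_sum] at hsum
  rw [EuclideanSpace.real_norm_sq_eq]
  simp only [Fin.sum_univ_three, Matrix.one_apply] at hsum ⊢
  simp at hsum
  linarith

namespace AFData

variable (D : AFData)

attribute [local instance] finite_ends

/-- The part of the manifold within radius `R` in the ends. -/
def core (R : ℝ) : Set D.carrier := {p | ∀ i, p ∈ (D.chart i).source → ‖D.chart i p‖ ≤ R}

theorem isDiffeo_chart (i : D.ι) : IsDiffeo (D.chart i) :=
  isDiffeo_of_mem_maximalAtlas (D.chart_mem i)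

variable {D} in
theorem mem_target {i : D.ι} {y : E3} (h : D.radius i < ‖y‖) : y ∈ (D.chart i).target := by
  rw [D.chart_target]
  exact h

variable {D} in
theorem eq_of_mem_source {i j : D.ι} {p : D.carrier} (hi : p ∈ (D.chart i).source)
    (hj : p ∈ (D.chart j).source) : i = j := by
  by_contra h
  exact Set.disjoint_left.1 (D.disjoint_ends i j h) hi hj

theorem core_mono {R R' : ℝ} (h : R ≤ R') : D.core R ⊆ D.core R' :=
  fun _ hp i hi => (hp i hi).trans h

/-- Compactness is given for a single radius only; a larger core adds a compact annulus in each of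
finitely many ends. -/
theorem exists_isCompact_core : ∃ R₀ : ℝ, (∀ i, D.radius i < R₀) ∧
    ∀ R, R₀ ≤ R → IsCompact (D.core R) := by
  obtain ⟨R₀, hR₀, hc⟩ := D.compact_core
  refine ⟨R₀, hR₀, fun R hR => ?_⟩
  have h1 : ∀ i, IsCompact ((D.chart i).symm '' (Metric.closedBall 0 R ∩ {y | R₀ ≤ ‖y‖})) := by
    intro i
    refine IsCompact.image_of_continuousOn ?_ ?_
    · exact (isCompact_closedBall 0 R).inter_right (isClosed_le continuous_const continuous_norm)
    · exact (D.chart i).continuousOn_symm.mono fun y hy => mem_target ((hR₀ i).trans_le hy.2)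
  convert! hc.union (isCompact_iUnion h1) using 1
  ext p
  constructor
  · intro hp
    by_cases h : p ∈ D.core R₀
    · exact Or.inl h
    · simp only [core, mem_ofPred_eq, not_forall, not_le] at h
      obtain ⟨i, hi, hlt⟩ := h
      refine Or.inr (mem_iUnion.2 ⟨i, D.chart i p, ⟨?_, hlt.le⟩, (D.chart i).left_inv hi⟩)
      simpa using hp i hi
  · rintro (hp | hp)
    · exact D.core_mono hR hp
    · obtain ⟨i, y, ⟨hy, hy'⟩, rfl⟩ := mem_iUnion.1 hp
      have hyt : y ∈ (D.chart i).target := mem_target ((hR₀ i).trans_le hy')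
      intro j hj
      obtain rfl := eq_of_mem_source ((D.chart i).map_target hyt) hj
      rw [(D.chart i).right_inv hyt]
      simpa using hy

theorem exists_radius_norm_sq_le (i : D.ι) : ∃ R : ℝ, D.radius i < R ∧ ∀ y : E3, R < ‖y‖ →
    ∀ v : E3, ‖v‖ ^ 2 ≤ 2 * pull (D.chart i).symm D.g.inner y v v := by
  obtain ⟨α, C, R, hα, hR, hflat, -⟩ := D.asymptotically_flat i
  have hlim : Filter.Tendsto (fun t : ℝ => C * t ^ (-α)) Filter.atTop (𝓝 (C * 0)) :=
    (tendsto_rpow_neg_atTop (by linarith)).const_mul C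
  rw [mul_zero] at hlim
  obtain ⟨R', hR'⟩ := Filter.eventually_atTop.1
    (hlim.eventually_le_const (by norm_num : (0 : ℝ) < 1 / 6))
  refine ⟨max R R', hR.trans_le (le_max_left _ _), fun y hy v => ?_⟩
  refine norm_sq_le_two_mul_form _ (fun k l => ?_) v
  exact ((hflat y ((le_max_left _ _).trans_lt hy) k l).1).trans
    (hR' _ ((le_max_right _ _).trans hy.le))

theorem exists_radius_forall_norm_sq_le : ∃ R : ℝ, ∀ i, D.radius i < R ∧ ∀ y : E3, R < ‖y‖ →
    ∀ v : E3, ‖v‖ ^ 2 ≤ 2 * pull (D.chart i).symm D.g.inner y v v := by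
  choose R hR h using D.exists_radius_norm_sq_le
  obtain ⟨S, hS⟩ := (finite_range R).bddAbove
  exact ⟨S, fun i => ⟨(hR i).trans_le (hS (mem_range_self i)), fun y hy =>
    h i y ((hS (mem_range_self i)).trans_lt hy)⟩⟩

/-- Points far out have balls of uniform size with compact closure. -/
theorem exists_isCompact_of_edist_lt : ∃ R : ℝ, ∃ ε : NNReal, 0 < ε ∧ IsCompact (D.core R) ∧
    ∀ p ∉ D.core R, ∃ K, IsCompact K ∧ ∀ q, D.emetric.edist p q < ε → q ∈ K := by
  obtain ⟨R₀, hR₀, hcore⟩ := D.exists_isCompact_core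
  obtain ⟨R₁, hR₁⟩ := D.exists_radius_forall_norm_sq_le
  -- Translates of one bump share one Lipschitz constant, hence a uniform `ε`. The bump at `p` has
  -- value 1 there and varies by less than 1 within distance `ε`, so points that near lie in its
  -- compact support.
  let f : (c : E3) → ContDiffBump c := fun c => ⟨1 / 4, 1 / 2, by norm_num, by norm_num⟩
  obtain ⟨L, hL⟩ := ContDiff.lipschitzWith_of_hasCompactSupport (𝕂 := ℝ)
    (f 0).hasCompactSupport ((f 0).contDiff (n := 1)) (by simp)
  have hft : ∀ c x, f c x = f 0 (x - c) := fun c x => by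
    rw [ContDiffBump.apply, ContDiffBump.apply, sub_zero]
  have hLc : ∀ c, LipschitzWith (L + 1) (f c) := fun c => by
    refine LipschitzWith.weaken (K := L) (fun x y => ?_) (by simp)
    rw [hft c x, hft c y]
    simpa using hL (x - c) (y - c)
  -- The extra `1` keeps the support, of radius `1/2`, in the region where the metric bound holds.
  -- `L + 1` is a positive Lipschitz constant, and the factor `2` bounds Euclidean length by metric
  -- length.
  refine ⟨max R₀ R₁ + 1, (L + 1)⁻¹ * 2⁻¹, by positivity,
    hcore _ ((le_max_left R₀ R₁).trans (by linarith)), fun p hp => ?_⟩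
  simp only [core, mem_ofPred_eq, not_forall, not_le] at hp
  obtain ⟨i, hi, hlt⟩ := hp
  set c := D.chart i p with hc
  have hts : tsupport (f c) = Metric.closedBall c (1 / 2) := (f c).tsupport_eq
  have hfar : ∀ y ∈ tsupport (f c), R₁ < ‖y‖ := by
    intro y hy
    rw [hts, mem_closedBall_iff_norm'] at hy
    have := norm_sub_norm_le c y
    have := le_max_right R₀ R₁
    linarith
  have hsupp : tsupport (f c) ⊆ (D.chart i).target := fun y hy =>
    mem_target ((hR₁ i).1.trans (hfar y hy))
  refine ⟨(D.chart i).symm '' tsupport (f c), (f c).hasCompactSupport.isCompact.image_of_continuousOn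
    ((D.chart i).continuousOn_symm.mono hsupp), fun q hq => ?_⟩
  have hlip := CauchyData.edist_indicator_le (D := D.toCauchyData) (D.isDiffeo_chart i)
    ((f c).contDiff (n := ⊤)) (f c).hasCompactSupport hsupp (L := L + 1)
    (fun y => norm_fderiv_le_of_lipschitz ℝ (hLc c)) (C := 2) (by positivity)
    (fun y hy v => by
      have h1 := (hR₁ i).2 y (hfar y hy) v
      have h2 := sq_nonneg ‖v‖
      push_cast
      linarith) p q
  have hp1 : (D.chart i).source.indicator (f c ∘ D.chart i) p = 1 := by
    rw [indicator_of_mem hi]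
    exact (f c).one_of_mem_closedBall (Metric.mem_closedBall_self (by norm_num))
  have hq0 : (D.chart i).source.indicator (f c ∘ D.chart i) q ≠ 0 := by
    intro h0
    rw [hp1, h0] at hlip
    have h2 : (((L + 1) * 2 : NNReal) : ℝ≥0∞) * D.emetric.edist p q < 1 := by
      calc _ < (((L + 1) * 2 : NNReal) : ℝ≥0∞) * (((L + 1)⁻¹ * 2⁻¹ : NNReal) : ℝ≥0∞) :=
            ENNReal.mul_lt_mul_right (by positivity) ENNReal.coe_ne_top hq
        _ = 1 := by
            rw [← ENNReal.coe_mul, ← ENNReal.coe_one]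
            congr 1
            have : L + 1 ≠ 0 := by positivity
            field_simp
    refine (hlip.trans_lt h2).ne ?_
    rw [edist_dist]
    simp
  have hqs : q ∈ (D.chart i).source := by
    by_contra h
    exact hq0 (indicator_of_notMem h _)
  rw [indicator_of_mem hqs] at hq0
  exact ⟨D.chart i q, subset_tsupport _ hq0, (D.chart i).left_inv hqs⟩

/-- Asymptotically flat manifolds are complete. -/
theorem isComplete : D.IsComplete := by
  let := D.emetric
  have : LocallyCompactSpace D.carrier := ChartedSpace.locallyCompactSpace E3 D.carrier
  obtain ⟨R, ε, hε, hcore, hfar⟩ := D.exists_isCompact_of_edist_lt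
  obtain ⟨δ, hδ, hK⟩ := hcore.exists_isCompact_cthickening
  refine EMetric.complete_of_cauchySeq_tendsto fun u hu => ?_
  have hpos : (0 : ℝ≥0∞) < min (ε : ℝ≥0∞) (ENNReal.ofReal δ) := by
    refine lt_min (by exact_mod_cast hε) (by simpa using hδ)
  obtain ⟨N, hN⟩ := EMetric.cauchySeq_iff.1 hu _ hpos
  -- A tail of the sequence stays near `u N`: either in a compact thickening of the core or in the
  -- compact neighbourhood of a far point. A convergent subsequence then suffices.
  obtain ⟨K, hK, hNK⟩ : ∃ K, IsCompact K ∧ ∀ n, N ≤ n → u n ∈ K := by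
    by_cases h : u N ∈ D.core R
    · refine ⟨_, hK, fun n hn => ?_⟩
      refine Metric.mem_cthickening_of_edist_le _ _ _ _ h ?_
      exact ((hN n hn N le_rfl).trans_le (min_le_right _ _)).le
    · obtain ⟨K, hK, hKq⟩ := hfar _ h
      exact ⟨K, hK, fun n hn => hKq _ ((hN N le_rfl n hn).trans_le (min_le_left _ _))⟩
  obtain ⟨a, -, φ, hφ, hlim⟩ := hK.tendsto_subseq (x := fun n => u (n + N))
    (fun n => hNK _ (Nat.le_add_left _ _))
  refine ⟨a, tendsto_nhds_of_cauchySeq_of_subseq hu (f := fun n => φ n + N) ?_ hlim⟩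
  exact Filter.tendsto_atTop_mono (fun n => Nat.le_add_right _ _) hφ.tendsto_atTop

end AFData

end Penrose

namespace Penrose

open Set

/-! ### Transport of asymptotic ends -/

theorem isOpen_exterior (R : ℝ) : IsOpen {y : E3 | R < ‖y‖} :=
  isOpen_lt continuous_const continuous_norm

theorem AsymptoticallyFlatAt.congr {G K G' K' : E3 → Matrix (Fin 3) (Fin 3) ℝ} {r R : ℝ}
    (h : AsymptoticallyFlatAt G K r) (hG : ∀ y, R < ‖y‖ → G' y = G y)
    (hK : ∀ y, R < ‖y‖ → K' y = K y) : AsymptoticallyFlatAt G' K' R := by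
  obtain ⟨α, C, S, hα, -, hflat, hint⟩ := h
  have hgerm : ∀ y : E3, max R S + 1 < ‖y‖ → G' =ᶠ[𝓝 y] G := fun y hy => by
    filter_upwards [(isOpen_exterior R).mem_nhds
      (show R < ‖y‖ by linarith [le_max_left R S])] with z hz using hG z hz
  -- The definition asks for a radius strictly beyond `R`, hence the `+ 1`.
  refine ⟨α, C, max R S + 1, hα, by linarith [le_max_left R S], fun y hy i j => ?_, ?_⟩
  · have h1 := hflat y (by linarith [le_max_right R S]) i j
    have hR : R < ‖y‖ := by linarith [le_max_left R S]
    refine ⟨by rw [hG y hR]; exact h1.1, fun k => ?_, by rw [hK y hR]; exact h1.2.2⟩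
    have h2 : (fun z => G' z i j) =ᶠ[𝓝 y] fun z => G z i j :=
      (hgerm y hy).mono fun z hz => by simp only [hz]
    rw [pd, h2.fderiv_eq]
    exact h1.2.1 k
  · have h3 : IntegrableOn (scalarCurv G) {y : E3 | max R S + 1 < ‖y‖} :=
      hint.mono_set fun y hy => by
        simp only [mem_ofPred_eq] at hy ⊢
        linarith [le_max_right R S]
    exact h3.congr_fun (fun y hy => (scalarCurv_congr (hgerm y hy)).self_of_nhds.symm)
      (isOpen_exterior _).measurableSet

theorem massFlux_congr {G G' : E3 → Matrix (Fin 3) (Fin 3) ℝ} {R σ : ℝ} (hR : 0 < R) (hσ : R < σ)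
    (hG : ∀ y, R < ‖y‖ → G' y = G y) : massFlux G' σ = massFlux G σ := by
  have hgerm : ∀ (ν : Metric.sphere (0 : E3) 1) (i j k : Fin 3),
      pd k (fun z => G' z i j) (σ • (ν : E3)) = pd k (fun z => G z i j) (σ • (ν : E3)) := by
    intro ν i j k
    have hν : ‖σ • (ν : E3)‖ = σ := by
      rw [norm_smul, norm_eq_of_mem_sphere, mul_one, Real.norm_of_nonneg (hR.trans hσ).le]
    have : (fun z => G' z i j) =ᶠ[𝓝 (σ • (ν : E3))] fun z => G z i j := by
      filter_upwards [(isOpen_exterior R).mem_nhds (show R < ‖σ • (ν : E3)‖ by rwa [hν])] with z hz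
      rw [hG z hz]
    rw [pd, pd, this.fderiv_eq]
  simp only [massFlux, hgerm]

section EndChart

variable {M N : Type} [TopologicalSpace M] [TopologicalSpace N]

/-- The asymptotic chart of an end, restricted and transported by `φ`. -/
def endChart (e : OpenPartialHomeomorph M E3) (φ : OpenPartialHomeomorph M N) (R : ℝ) :
    OpenPartialHomeomorph N E3 :=
  (e.symm.restrOpen {y | R < ‖y‖} (isOpen_exterior R) ≫ₕ φ).symm

variable {e : OpenPartialHomeomorph M E3} {φ : OpenPartialHomeomorph M N} {R : ℝ}

theorem endChart_target (h : ∀ y, R < ‖y‖ → y ∈ e.target ∧ e.symm y ∈ φ.source) :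
    (endChart e φ R).target = {y | R < ‖y‖} := by
  ext y
  exact ⟨fun hy => hy.1.2, fun hy => ⟨⟨(h y hy).1, hy⟩, (h y hy).2⟩⟩

theorem endChart_apply (h : ∀ y, R < ‖y‖ → y ∈ e.target ∧ e.symm y ∈ φ.source) {y : E3}
    (hy : R < ‖y‖) : φ (e.symm y) ∈ (endChart e φ R).source ∧
      endChart e φ R (φ (e.symm y)) = y := by
  have hyt : y ∈ (endChart e φ R).target := by rwa [endChart_target h]
  exact ⟨(endChart e φ R).map_target hyt, (endChart e φ R).right_inv hyt⟩

theorem exists_of_mem_endChart_source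
    (h : ∀ y, R < ‖y‖ → y ∈ e.target ∧ e.symm y ∈ φ.source) {q : N}
    (hq : q ∈ (endChart e φ R).source) : ∃ y, R < ‖y‖ ∧ φ (e.symm y) = q := by
  refine ⟨endChart e φ R q, ?_, (endChart e φ R).left_inv hq⟩
  have := (endChart e φ R).map_source hq
  rwa [endChart_target h] at this

variable [ChartedSpace E3 M] [ChartedSpace E3 N]

theorem isDiffeo_endChart (he : IsDiffeo e) (hφ : IsDiffeo φ) (R : ℝ) : IsDiffeo (endChart e φ R) :=
  ((he.symm.restr _).trans hφ).symm

theorem pull_endChart (he : IsDiffeo e) (hφ : IsDiffeo φ)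
    (h : ∀ y, R < ‖y‖ → y ∈ e.target ∧ e.symm y ∈ φ.source) {S : TensorField M} {T : TensorField N}
    {y : E3} (hy : R < ‖y‖) (hST : pull φ T (e.symm y) = S (e.symm y)) :
    pull (endChart e φ R).symm T y = pull e.symm S y := by
  exact (pull_comp T (hφ.mdifferentiableAt (h y hy).2)
    (he.symm.mdifferentiableAt (h y hy).1)).trans (pull_congr_tensor e.symm hST)

end EndChart

end Penrose

/-! ### Ends inside and outside a region -/

namespace Penrose

open Set

namespace AFData

variable {D : AFData} {Ω : Set D.carrier} {i : D.ι}

/-- A radius outside of which an end lies in `Ω`. -/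
def endRadius (h : D.ContainsEnd Ω i) : ℝ := max h.choose (D.radius i)

theorem endRadius_pos (h : D.ContainsEnd Ω i) : 0 < endRadius h :=
  (D.radius_pos i).trans_le (le_max_right _ _)

theorem endRadius_spec (h : D.ContainsEnd Ω i) {y : E3} (hy : endRadius h < ‖y‖) :
    y ∈ (D.chart i).target ∧ (D.chart i).symm y ∈ Ω := by
  have hyt : y ∈ (D.chart i).target := mem_target ((le_max_right _ _).trans_lt hy)
  exact ⟨hyt, h.choose_spec y hyt ((le_max_left _ _).trans_lt hy)⟩

theorem notMem_closure_of_endRadius_lt (h : D.ContainsEnd Ωᶜ i) {y : E3}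
    (hy : endRadius h < ‖y‖) : (D.chart i).symm y ∉ closure Ω := by
  have hyt := (endRadius_spec h hy).1
  intro hcl
  have ho : IsOpen ((D.chart i).source ∩ D.chart i ⁻¹' {y | endRadius h < ‖y‖}) :=
    (D.chart i).isOpen_inter_preimage (isOpen_exterior _)
  obtain ⟨z, ⟨hz, hzy⟩, hzΩ⟩ := mem_closure_iff.1 hcl _ ho
    ⟨(D.chart i).map_target hyt, by rwa [mem_preimage, (D.chart i).right_inv hyt]⟩
  have h1 := (endRadius_spec h hzy).2
  rw [(D.chart i).left_inv hz] at h1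
  exact h1 hzΩ

theorem ContainsEnd.mono {Ω' : Set D.carrier} (h : D.ContainsEnd Ω i) (hΩ : Ω ⊆ Ω') :
    D.ContainsEnd Ω' i :=
  h.imp fun _ hR y hy hy' => hΩ (hR y hy hy')

theorem ContainsEnd.inter {Ω' : Set D.carrier} (h : D.ContainsEnd Ω i)
    (h' : D.ContainsEnd Ω' i) : D.ContainsEnd (Ω ∩ Ω') i := by
  obtain ⟨R, hR⟩ := h
  obtain ⟨R', hR'⟩ := h'
  exact ⟨max R R', fun y hy hy' => ⟨hR y hy ((le_max_left _ _).trans_lt hy'),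
    hR' y hy ((le_max_right _ _).trans_lt hy')⟩⟩

/-- Every end lies inside or outside of `Ω`. -/
def SeparatesEnds (D : AFData) (Ω : Set D.carrier) : Prop :=
  ∀ i, D.ContainsEnd Ω i ∨ D.ContainsEnd Ωᶜ i

theorem IsRegion.separatesEnds (h : D.IsRegion Ω) : D.SeparatesEnds Ω := fun i => by
  by_cases hi : i = D.chosen
  · exact Or.inr (hi ▸ h.2.2)
  · exact Or.inl (h.2.1 i hi)

theorem exists_endRadius_lt (Ω : Set D.carrier) : ∃ R : ℝ,
    (∀ i (hi : D.ContainsEnd Ω i), endRadius hi < R) ∧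
    ∀ i (hi : D.ContainsEnd Ωᶜ i), endRadius hi < R := by
  classical
  have := D.finite_ends
  let f : D.ι → ℝ := fun i => if hi : D.ContainsEnd Ω i then endRadius hi else 0
  let f' : D.ι → ℝ := fun i => if hi : D.ContainsEnd Ωᶜ i then endRadius hi else 0
  obtain ⟨S, hS⟩ := (finite_range f).bddAbove
  obtain ⟨S', hS'⟩ := (finite_range f').bddAbove
  refine ⟨max S S' + 1, fun i hi => ?_, fun i hi => ?_⟩
  · have h1 := hS (mem_range_self i)
    simp only [f, dif_pos hi] at h1
    linarith [le_max_left S S']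
  · have h1 := hS' (mem_range_self i)
    simp only [f', dif_pos hi] at h1
    linarith [le_max_right S S']

/-- Far out, each end lies wholly inside `Ω` or wholly off its closure, so the frontier is a closed
subset of a compact core. -/
theorem IsRegion.isCompact_frontier (h : D.IsRegion Ω) : IsCompact (frontier Ω) := by
  obtain ⟨R₀, -, hc⟩ := D.exists_isCompact_core
  obtain ⟨R, hR, hR'⟩ := exists_endRadius_lt Ω
  refine (hc _ (le_max_left R₀ R)).of_isClosed_subset isClosed_frontier fun p hp i hi => ?_
  by_contra! hlt
  have hlt := (le_max_right R₀ R).trans_lt hlt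
  have hpe := (D.chart i).left_inv hi
  rcases h.separatesEnds i with hi' | hi'
  · have h1 := (endRadius_spec hi' ((hR i hi').trans hlt)).2
    rw [hpe] at h1
    rw [h.1.frontier_eq] at hp
    exact hp.2 h1
  · have h1 := notMem_closure_of_endRadius_lt hi' ((hR' i hi').trans hlt)
    rw [hpe] at h1
    exact h1 hp.1

end AFData

/-! ### The asymptotic ends of the glued manifold -/

namespace Glued

open AFData

variable {A B : AFData} {Ω : Set A.carrier} {Ω' : Set B.carrier}
  (W : Glued A.toCauchyData B.toCauchyData Ω Ω')

theorem subset_source : Ω ⊆ W.j.source := subset_closure.trans W.closure_subset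

theorem left_spec (i : {i // A.ContainsEnd Ω i}) (y : E3) (hy : endRadius i.2 < ‖y‖) :
    y ∈ (A.chart i).target ∧ (A.chart i).symm y ∈ W.j.source :=
  ⟨(endRadius_spec i.2 hy).1, W.subset_source (endRadius_spec i.2 hy).2⟩

theorem right_spec (i : {i // B.ContainsEnd Ω'ᶜ i}) (y : E3) (hy : endRadius i.2 < ‖y‖) :
    y ∈ (B.chart i).target ∧ (B.chart i).symm y ∈ W.k.source :=
  ⟨(endRadius_spec i.2 hy).1, W.compl_subset (endRadius_spec i.2 hy).2⟩

/-- The ends of the glued manifold. -/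
abbrev Ends (_ : Glued A.toCauchyData B.toCauchyData Ω Ω') : Type :=
  {i // A.ContainsEnd Ω i} ⊕ {i // B.ContainsEnd Ω'ᶜ i}

/-- The radii of the ends of the glued manifold. -/
def endRadius : W.Ends → ℝ :=
  Sum.elim (fun i => AFData.endRadius i.2) fun i => AFData.endRadius i.2

/-- The asymptotic coordinates of the ends of the glued manifold. -/
def asymptoticChart : W.Ends → OpenPartialHomeomorph W.Q.carrier E3 :=
  Sum.elim (fun i => endChart (A.chart i) W.j (AFData.endRadius i.2))
    fun i => endChart (B.chart i) W.k (AFData.endRadius i.2)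

theorem isDiffeo_asymptoticChart (i : W.Ends) : IsDiffeo (W.asymptoticChart i) := by
  rcases i with i | i
  · exact isDiffeo_endChart (A.isDiffeo_chart i) W.diffeo_left _
  · exact isDiffeo_endChart (B.isDiffeo_chart i) W.diffeo_right _

theorem asymptoticChart_target (i : W.Ends) :
    (W.asymptoticChart i).target = {y | W.endRadius i < ‖y‖} := by
  rcases i with i | i
  · exact endChart_target (W.left_spec i)
  · exact endChart_target (W.right_spec i)

theorem exists_of_mem_left {i : {i // A.ContainsEnd Ω i}} {q : W.Q.carrier}
    (hq : q ∈ (W.asymptoticChart (Sum.inl i)).source) : ∃ a ∈ Ω, a ∈ (A.chart i).source ∧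
      AFData.endRadius i.2 < ‖A.chart i a‖ ∧ W.j a = q ∧
      W.asymptoticChart (Sum.inl i) q = A.chart i a := by
  obtain ⟨y, hy, rfl⟩ := exists_of_mem_endChart_source (W.left_spec i) hq
  have h1 := endRadius_spec i.2 hy
  refine ⟨_, h1.2, (A.chart i).map_target h1.1, ?_, rfl, ?_⟩
  · rwa [(A.chart i).right_inv h1.1]
  · rw [(A.chart i).right_inv h1.1]
    exact (endChart_apply (W.left_spec i) hy).2

theorem exists_of_mem_right {i : {i // B.ContainsEnd Ω'ᶜ i}} {q : W.Q.carrier}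
    (hq : q ∈ (W.asymptoticChart (Sum.inr i)).source) : ∃ b ∉ Ω', b ∈ (B.chart i).source ∧
      AFData.endRadius i.2 < ‖B.chart i b‖ ∧ W.k b = q ∧
      W.asymptoticChart (Sum.inr i) q = B.chart i b := by
  obtain ⟨y, hy, rfl⟩ := exists_of_mem_endChart_source (W.right_spec i) hq
  have h1 := endRadius_spec i.2 hy
  refine ⟨_, h1.2, (B.chart i).map_target h1.1, ?_, rfl, ?_⟩
  · rwa [(B.chart i).right_inv h1.1]
  · rw [(B.chart i).right_inv h1.1]
    exact (endChart_apply (W.right_spec i) hy).2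

theorem asymptoticChart_left {i : {i // A.ContainsEnd Ω i}} {a : A.carrier}
    (ha : a ∈ (A.chart i).source) (hr : AFData.endRadius i.2 < ‖A.chart i a‖) :
    W.j a ∈ (W.asymptoticChart (Sum.inl i)).source ∧
      W.asymptoticChart (Sum.inl i) (W.j a) = A.chart i a := by
  have h := endChart_apply (W.left_spec i) hr
  rwa [(A.chart i).left_inv ha] at h

theorem asymptoticChart_right {i : {i // B.ContainsEnd Ω'ᶜ i}} {b : B.carrier}
    (hb : b ∈ (B.chart i).source) (hr : AFData.endRadius i.2 < ‖B.chart i b‖) :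
    W.k b ∈ (W.asymptoticChart (Sum.inr i)).source ∧
      W.asymptoticChart (Sum.inr i) (W.k b) = B.chart i b := by
  have h := endChart_apply (W.right_spec i) hr
  rwa [(B.chart i).left_inv hb] at h

theorem left_ne_right {a : A.carrier} (ha : a ∈ Ω) {b : B.carrier} (hb : b ∉ Ω') :
    W.j a ≠ W.k b := fun h =>
  hb ((W.mem_iff a (W.subset_source ha) b (W.compl_subset hb) h).1 ha)

theorem disjoint_asymptoticChart (i i' : W.Ends) (h : i ≠ i') :
    Disjoint (W.asymptoticChart i).source (W.asymptoticChart i').source := by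
  refine Set.disjoint_left.2 fun q hq hq' => ?_
  rcases i with i | i <;> rcases i' with i' | i'
  · obtain ⟨a, ha, has, -, rfl, -⟩ := W.exists_of_mem_left hq
    obtain ⟨a', ha', has', -, haa, -⟩ := W.exists_of_mem_left hq'
    obtain rfl := W.j.injOn (W.subset_source ha') (W.subset_source ha) haa
    exact h (congrArg _ (Subtype.ext (eq_of_mem_source has has')))
  · obtain ⟨a, ha, -, -, rfl, -⟩ := W.exists_of_mem_left hq
    obtain ⟨b, hb, -, -, hab, -⟩ := W.exists_of_mem_right hq'
    exact W.left_ne_right ha hb hab.symm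
  · obtain ⟨b, hb, -, -, rfl, -⟩ := W.exists_of_mem_right hq
    obtain ⟨a, ha, -, -, hab, -⟩ := W.exists_of_mem_left hq'
    exact W.left_ne_right ha hb hab
  · obtain ⟨b, hb, hbs, -, rfl, -⟩ := W.exists_of_mem_right hq
    obtain ⟨b', hb', hbs', -, hbb, -⟩ := W.exists_of_mem_right hq'
    obtain rfl := W.k.injOn (W.compl_subset hb') (W.compl_subset hb) hbb
    exact h (congrArg _ (Subtype.ext (eq_of_mem_source hbs hbs')))

/-- The glued core is the union of the images of the two cores cut to the closed inside and the
closed outside. Ends of `A` outside `Ω`, and of `B` inside `Ω'`, disappear and impose no bound. -/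
theorem exists_compact_core (hΩ : IsOpen Ω) (hΩ' : IsOpen Ω') (hA : A.SeparatesEnds Ω) (hB : B.SeparatesEnds Ω') :
    ∃ R : ℝ, (∀ i, W.endRadius i < R) ∧ IsCompact {q : W.Q.carrier | ∀ i,
      q ∈ (W.asymptoticChart i).source → ‖W.asymptoticChart i q‖ ≤ R} := by
  obtain ⟨RA, -, hcA⟩ := A.exists_isCompact_core
  obtain ⟨RB, -, hcB⟩ := B.exists_isCompact_core
  obtain ⟨SA, hSA, hSA'⟩ := exists_endRadius_lt Ω
  obtain ⟨SB, hSB, hSB'⟩ := exists_endRadius_lt Ω'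
  set R := max (max RA RB) (max SA SB) with hR
  have hRA : RA ≤ R := (le_max_left _ _).trans (le_max_left _ _)
  have hRB : RB ≤ R := (le_max_right _ _).trans (le_max_left _ _)
  have hA1 : SA ≤ R := (le_max_left _ _).trans (le_max_right _ _)
  have hB1 : SB ≤ R := (le_max_right _ _).trans (le_max_right _ _)
  refine ⟨R, ?_, ?_⟩
  · rintro (i | i)
    · exact (hSA i i.2).trans_le hA1
    · exact (hSB' i i.2).trans_le hB1
  have hcomp : IsCompact (W.j '' (A.core R ∩ closure Ω) ∪ W.k '' (B.core R ∩ Ω'ᶜ)) := by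
    refine IsCompact.union ?_ ?_
    · exact ((hcA R hRA).inter_right isClosed_closure).image_of_continuousOn
        (W.j.continuousOn.mono (inter_subset_right.trans W.closure_subset))
    · exact ((hcB R hRB).inter_right hΩ'.isClosed_compl).image_of_continuousOn
        (W.k.continuousOn.mono (inter_subset_right.trans W.compl_subset))
  convert hcomp using 1
  ext q
  constructor
  · intro hq
    rcases W.cover q with ⟨a, ha, rfl⟩ | ⟨b, hb, rfl⟩
    · refine Or.inl ⟨a, ⟨fun i hi => ?_, subset_closure ha⟩, rfl⟩
      by_contra! hlt
      rcases hA i with hi' | hi'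
      · obtain ⟨h1, h2⟩ := W.asymptoticChart_left (i := ⟨i, hi'⟩) hi
          (((hSA i hi').trans_le hA1).trans hlt)
        have h3 := hq _ h1
        rw [h2] at h3
        exact hlt.not_ge h3
      · have h1 := (endRadius_spec hi' (((hSA' i hi').trans_le hA1).trans hlt)).2
        rw [(A.chart i).left_inv hi] at h1
        exact h1 ha
    · refine Or.inr ⟨b, ⟨fun i hi => ?_, hb⟩, rfl⟩
      by_contra! hlt
      rcases hB i with hi' | hi'
      · have h1 := (endRadius_spec hi' (((hSB i hi').trans_le hB1).trans hlt)).2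
        rw [(B.chart i).left_inv hi] at h1
        exact hb h1
      · obtain ⟨h1, h2⟩ := W.asymptoticChart_right (i := ⟨i, hi'⟩) hi
          (((hSB' i hi').trans_le hB1).trans hlt)
        have h3 := hq _ h1
        rw [h2] at h3
        exact hlt.not_ge h3
  · rintro (⟨a, ⟨hac, ha⟩, rfl⟩ | ⟨b, ⟨hbc, hb⟩, rfl⟩) (i | i) hi
    · obtain ⟨a', ha', has', -, haa, h1⟩ := W.exists_of_mem_left hi
      obtain rfl := W.j.injOn (W.subset_source ha') (W.closure_subset ha) haa
      rw [h1]
      exact hac i has'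
    -- A point of the closed inside cannot lie in an end of `B`: on the seam it would correspond to
    -- a frontier point of `Ω'`, whereas beyond its radius that end avoids `closure Ω'`.
    · exfalso
      obtain ⟨b, hb, hbs, hbr, hab, -⟩ := W.exists_of_mem_right hi
      by_cases haΩ : a ∈ Ω
      · exact W.left_ne_right haΩ hb hab.symm
      · have haf : a ∈ frontier Ω := by
          rw [hΩ.frontier_eq]
          exact ⟨ha, haΩ⟩
        obtain ⟨b', hb', hbk', hab'⟩ := W.exists_frontier_right hΩ haf
        obtain rfl := W.k.injOn hbk' (W.compl_subset hb) (hab'.symm.trans hab.symm)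
        have h1 := notMem_closure_of_endRadius_lt i.2 hbr
        rw [(B.chart i).left_inv hbs] at h1
        exact h1 hb'.1
    · obtain ⟨a, ha, -, -, hab, -⟩ := W.exists_of_mem_left hi
      exact (W.left_ne_right ha hb hab).elim
    · obtain ⟨b', hb', hbs', -, hbb, h1⟩ := W.exists_of_mem_right hi
      obtain rfl := W.k.injOn (W.compl_subset hb') (W.compl_subset hb) hbb
      rw [h1]
      exact hbc i hbs'

theorem components_left {i : {i // A.ContainsEnd Ω i}} {y : E3} (hy : AFData.endRadius i.2 < ‖y‖) :
    W.Q.components W.Q.g.inner (W.asymptoticChart (Sum.inl i)) y =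
        A.components A.g.inner (A.chart i) y ∧
      W.Q.components W.Q.h (W.asymptoticChart (Sum.inl i)) y = A.components A.h (A.chart i) y := by
  have h := subset_closure (endRadius_spec i.2 hy).2
  exact ⟨CauchyData.components_congr _ (pull_endChart (A.isDiffeo_chart i) W.diffeo_left
      (W.left_spec i) hy (W.pull_left_g _ h)),
    CauchyData.components_congr _ (pull_endChart (A.isDiffeo_chart i) W.diffeo_left
      (W.left_spec i) hy (W.pull_left_h _ h))⟩

theorem components_right {i : {i // B.ContainsEnd Ω'ᶜ i}} {y : E3}
    (hy : AFData.endRadius i.2 < ‖y‖) :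
    W.Q.components W.Q.g.inner (W.asymptoticChart (Sum.inr i)) y =
        B.components B.g.inner (B.chart i) y ∧
      W.Q.components W.Q.h (W.asymptoticChart (Sum.inr i)) y = B.components B.h (B.chart i) y := by
  have h := (endRadius_spec i.2 hy).2
  exact ⟨CauchyData.components_congr _ (pull_endChart (B.isDiffeo_chart i) W.diffeo_right
      (W.right_spec i) hy (W.pull_right_g _ h)),
    CauchyData.components_congr _ (pull_endChart (B.isDiffeo_chart i) W.diffeo_right
      (W.right_spec i) hy (W.pull_right_h _ h))⟩

/-- The glued data as asymptotically flat data, with the chosen end of the outer part. -/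
def afData (hΩ : IsOpen Ω) (hΩ' : IsOpen Ω') (hA : A.SeparatesEnds Ω) (hB : B.SeparatesEnds Ω')
    (hc : B.ContainsEnd Ω'ᶜ B.chosen) : AFData where
  toCauchyData := W.Q
  ι := W.Ends
  finite_ends :=
    have := A.finite_ends
    have := B.finite_ends
    inferInstance
  chosen := Sum.inr ⟨B.chosen, hc⟩
  chart := W.asymptoticChart
  radius := W.endRadius
  radius_pos := by
    rintro (i | i)
    · exact endRadius_pos i.2
    · exact endRadius_pos i.2
  chart_mem i := (W.isDiffeo_asymptoticChart i).mem_maximalAtlas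
  chart_target := W.asymptoticChart_target
  disjoint_ends := W.disjoint_asymptoticChart
  compact_core := W.exists_compact_core hΩ hΩ' hA hB
  asymptotically_flat := by
    rintro (i | i)
    · exact (A.asymptotically_flat i).congr (fun y hy => (W.components_left hy).1)
        fun y hy => (W.components_left hy).2
    · exact (B.asymptotically_flat i).congr (fun y hy => (W.components_right hy).1)
        fun y hy => (W.components_right hy).2

/-- The fluxes through large spheres coincide, and a limit depends only on them. -/
theorem mass_afData (hΩ : IsOpen Ω) (hΩ' : IsOpen Ω') (hA : A.SeparatesEnds Ω)
    (hB : B.SeparatesEnds Ω') (hc : B.ContainsEnd Ω'ᶜ B.chosen) :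
    (W.afData hΩ hΩ' hA hB hc).mass = B.mass := by
  have h : ∀ᶠ σ in Filter.atTop, massFlux (W.Q.components W.Q.g.inner
      (W.asymptoticChart (Sum.inr ⟨B.chosen, hc⟩))) σ =
      massFlux (B.components B.g.inner (B.chart B.chosen)) σ := by
    filter_upwards [Filter.eventually_gt_atTop (AFData.endRadius hc)] with σ hσ
    exact massFlux_congr (endRadius_pos hc) hσ fun y hy =>
      (W.components_right (i := ⟨B.chosen, hc⟩) hy).1
  exact congrArg Filter.lim (Filter.map_congr h)

end Glued

end Penrose

/-! ### Comparison of enclosing areas -/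

namespace Penrose

open Set

namespace Glued

section Area

variable {A B : CauchyData} {Ω : Set A.carrier} {Ω' : Set B.carrier} (W : Glued A B Ω Ω')

/-- The inverse of `j` preserves the metric at the points of `j '' S`, so it does not increase area.
-/
theorem area_left_le {S : Set A.carrier} (hS : S ⊆ closure Ω) : A.area S ≤ W.Q.area (W.j '' S) := by
  have hSs := hS.trans W.closure_subset
  have h := CauchyData.area_image_le (D := W.Q) (D' := A) (F := W.j.symm) (S := W.j '' S) ?_ ?_
  · rwa [(W.j.leftInvOn.mono hSs).image_image] at h
  · rintro _ ⟨a, ha, rfl⟩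
    exact W.diffeo_left.symm.contMDiffAt (W.j.map_source (hSs ha))
  · rintro _ ⟨a, ha, rfl⟩
    refine W.diffeo_left.pull_symm_eq (W.j.map_source (hSs ha)) ?_
    rw [W.j.left_inv (hSs ha)]
    exact W.pull_left_g a (hS ha)

theorem area_right_le {S : Set B.carrier} (hS : S ⊆ Ω'ᶜ) : B.area S ≤ W.Q.area (W.k '' S) := by
  have hSs := hS.trans W.compl_subset
  have h := CauchyData.area_image_le (D := W.Q) (D' := B) (F := W.k.symm) (S := W.k '' S) ?_ ?_
  · rwa [(W.k.leftInvOn.mono hSs).image_image] at h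
  · rintro _ ⟨b, hb, rfl⟩
    exact W.diffeo_right.symm.contMDiffAt (W.k.map_source (hSs hb))
  · rintro _ ⟨b, hb, rfl⟩
    refine W.diffeo_right.pull_symm_eq (W.k.map_source (hSs hb)) ?_
    rw [W.k.left_inv (hSs hb)]
    exact W.pull_right_g b (hS hb)

theorem area_image_right_le {S : Set B.carrier} (hS : S ⊆ Ω'ᶜ) :
    W.Q.area (W.k '' S) ≤ B.area S :=
  CauchyData.area_image_le (fun _ hb => W.diffeo_right.contMDiffAt (W.compl_subset (hS hb)))
    fun _ hb => W.pull_right_g _ (hS hb)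

theorem isOpen_image_exterior : IsOpen (W.k '' (closure Ω')ᶜ) :=
  W.k.isOpen_image_of_subset_source isClosed_closure.isOpen_compl
    ((compl_subset_compl.2 subset_closure).trans W.compl_subset)

theorem notMem_image_exterior (hΩ : IsOpen Ω) {a : A.carrier} (ha : a ∈ closure Ω) :
    W.j a ∉ W.k '' (closure Ω')ᶜ := by
  rintro ⟨b, hb, hab⟩
  have hbk : b ∈ W.k.source := W.compl_subset fun h => hb (subset_closure h)
  by_cases haΩ : a ∈ Ω
  · exact hb (subset_closure ((W.mem_iff a (W.closure_subset ha) b hbk hab.symm).1 haΩ))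
  · have haf : a ∈ frontier Ω := by
      rw [hΩ.frontier_eq]
      exact ⟨ha, haΩ⟩
    obtain ⟨b', hb', hbk', hab'⟩ := W.exists_frontier_right hΩ haf
    obtain rfl := W.k.injOn hbk' hbk (hab'.symm.trans hab.symm)
    exact hb hb'.1

/-- The part of a set of the glued manifold in the inner manifold. -/
def inner (Θ : Set W.Q.carrier) : Set A.carrier := Ω ∩ (W.j.source ∩ W.j ⁻¹' Θ)

/-- The union of the inside of the outer manifold and of the part of a set of the glued manifold
in the outer manifold. -/
def outer (Θ : Set W.Q.carrier) : Set B.carrier := Ω' ∪ W.k.source ∩ W.k ⁻¹' Θ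

variable {Θ : Set W.Q.carrier}

theorem isOpen_inner (hΩ : IsOpen Ω) (hΘ : IsOpen Θ) : IsOpen (W.inner Θ) :=
  hΩ.inter (W.j.isOpen_inter_preimage hΘ)

theorem isOpen_outer (hΩ' : IsOpen Ω') (hΘ : IsOpen Θ) : IsOpen (W.outer Θ) :=
  hΩ'.union (W.k.isOpen_inter_preimage hΘ)

theorem frontier_inner_subset (hΩ : IsOpen Ω) (hΘ : IsOpen Θ) : frontier (W.inner Θ) ⊆
    (closure Ω ∩ W.j ⁻¹' frontier Θ) ∪ (frontier Ω ∩ W.j ⁻¹' Θ) := by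
  intro a ha
  have hacl : a ∈ closure Ω := closure_mono inter_subset_left ha.1
  have has := W.closure_subset hacl
  have hja : W.j a ∈ closure Θ := by
    refine closure_mono ?_ (mem_closure_image (W.j.continuousAt has) ha.1)
    rintro _ ⟨z, hz, rfl⟩
    exact hz.2.2
  rw [(W.isOpen_inner hΩ hΘ).frontier_eq] at ha
  by_cases hjΘ : W.j a ∈ Θ
  · refine Or.inr ⟨?_, hjΘ⟩
    rw [hΩ.frontier_eq]
    exact ⟨hacl, fun haΩ => ha.2 ⟨haΩ, has, hjΘ⟩⟩
  · refine Or.inl ⟨hacl, ?_⟩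
    rw [mem_preimage, hΘ.frontier_eq]
    exact ⟨hja, hjΘ⟩

theorem frontier_outer_subset (hΩ' : IsOpen Ω') (hΘ : IsOpen Θ) : frontier (W.outer Θ) ⊆
    (frontier Ω' \ (W.k.source ∩ W.k ⁻¹' Θ)) ∪ ((closure Ω')ᶜ ∩ W.k ⁻¹' frontier Θ) := by
  intro b hb
  rw [(W.isOpen_outer hΩ' hΘ).frontier_eq] at hb
  have hbΩ : b ∉ Ω' := fun h => hb.2 (Or.inl h)
  have hbk := W.compl_subset hbΩ
  have hbΘ : W.k b ∉ Θ := fun h => hb.2 (Or.inr ⟨hbk, h⟩)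
  by_cases hbc : b ∈ closure Ω'
  · refine Or.inl ⟨?_, fun h => hbΘ h.2⟩
    rw [hΩ'.frontier_eq]
    exact ⟨hbc, hbΩ⟩
  · refine Or.inr ⟨hbc, ?_⟩
    have h1 : b ∈ closure (W.k.source ∩ W.k ⁻¹' Θ) := by
      have := hb.1
      rw [outer, closure_union] at this
      exact this.resolve_left hbc
    rw [mem_preimage, hΘ.frontier_eq]
    refine ⟨closure_mono ?_ (mem_closure_image (W.k.continuousAt hbk) h1), hbΘ⟩
    rintro _ ⟨z, hz, rfl⟩
    exact hz.2

theorem piecewiseSmoothBoundary_inner (hA : ∀ p, A.PiecewiseSmoothBoundaryAt Ω p)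
    (hΘ : W.Q.PiecewiseSmoothBoundary Θ) : A.PiecewiseSmoothBoundary (W.inner Θ) := by
  rw [CauchyData.piecewiseSmoothBoundary_iff] at hΘ
  intro p hp
  have hps := W.closure_subset (closure_mono inter_subset_left hp.1)
  refine (hA p).inter ((hΘ (W.j p)).transfer W.diffeo_left hps ?_)
  filter_upwards [W.j.open_source.mem_nhds hps] with x hx using ⟨fun h => h.2, fun h => ⟨hx, h⟩⟩

theorem piecewiseSmoothBoundary_outer (hΩ' : IsOpen Ω')
    (hB : ∀ p, B.PiecewiseSmoothBoundaryAt Ω' p) (hΘo : IsOpen Θ)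
    (hΘ : W.Q.PiecewiseSmoothBoundary Θ) : B.PiecewiseSmoothBoundary (W.outer Θ) := by
  rw [CauchyData.piecewiseSmoothBoundary_iff] at hΘ
  intro p hp
  rw [(W.isOpen_outer hΩ' hΘo).frontier_eq] at hp
  have hps := W.compl_subset fun h => hp.2 (Or.inl h)
  refine (hB p).union ((hΘ (W.k p)).transfer W.diffeo_right hps ?_)
  filter_upwards [W.k.open_source.mem_nhds hps] with x hx using ⟨fun h => h.2, fun h => ⟨hx, h⟩⟩

/-- Let `X` and `Y` be the areas of the parts of the surface in `B` covered and not covered by `Θ`,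
and `Z` the area of `∂Θ` in the exterior. The outer region has boundary area at most `Y + Z`, so
outer-minimality gives `X + Y ≤ Y + Z`, hence `X ≤ Z`. The boundary of the inner region consists of
parts of `∂Θ` off the exterior and of the covered part of the seam, whose area is at most `X` and so
is paid for by the exterior part of `∂Θ`. -/
theorem area_frontier_inner_le (hΩ : IsOpen Ω) (hΩ' : IsOpen Ω') (hΘ : IsOpen Θ)
    (hfin : B.area (frontier Ω') ≠ ⊤)
    (hmin : B.area (frontier Ω') ≤ B.area (frontier (W.outer Θ))) :
    A.area (frontier (W.inner Θ)) ≤ W.Q.area (frontier Θ) := by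
  have hko : IsOpen (W.k.source ∩ W.k ⁻¹' Θ) := W.k.isOpen_inter_preimage hΘ
  have hfr : frontier Ω' ⊆ Ω'ᶜ := by
    rw [hΩ'.frontier_eq]
    exact fun _ h => h.2
  set X := B.area (frontier Ω' ∩ (W.k.source ∩ W.k ⁻¹' Θ)) with hX
  set Y := B.area (frontier Ω' \ (W.k.source ∩ W.k ⁻¹' Θ)) with hY
  set Z := B.area ((closure Ω')ᶜ ∩ W.k ⁻¹' frontier Θ) with hZ
  have hXY : X + Y = B.area (frontier Ω') :=
    B.area_inter_add_diff _ (MeasurableSpace.measurableSet_generateFrom hko)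
  -- Cancelling `Y` in `[0, ∞]` is where the finite area of the surface enters.
  have hYfin : Y ≠ ⊤ := fun h => hfin (by rw [← hXY, h, add_top])
  have hXZ : X ≤ Z := by
    have h1 := (B.area_mono (W.frontier_outer_subset hΩ' hΘ)).trans (B.area_union_le _ _)
    have h2 := (hXY.le.trans hmin).trans h1
    rw [add_comm] at h2
    exact (ENNReal.add_le_add_iff_left hYfin).1 h2
  set O := W.k '' (closure Ω')ᶜ with hO
  have hsplit : W.Q.area (frontier Θ ∩ O) + W.Q.area (frontier Θ \ O) = W.Q.area (frontier Θ) :=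
    W.Q.area_inter_add_diff _ (MeasurableSpace.measurableSet_generateFrom W.isOpen_image_exterior)
  have hZO : Z ≤ W.Q.area (frontier Θ ∩ O) := by
    refine (W.area_right_le (inter_subset_left.trans (compl_subset_compl.2 subset_closure))).trans
      (W.Q.area_mono ?_)
    rintro _ ⟨b, hb, rfl⟩
    exact ⟨hb.2, b, hb.1, rfl⟩
  have hin : A.area (closure Ω ∩ W.j ⁻¹' frontier Θ) ≤ W.Q.area (frontier Θ \ O) := by
    refine (W.area_left_le inter_subset_left).trans (W.Q.area_mono ?_)
    rintro _ ⟨a, ha, rfl⟩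
    exact ⟨ha.2, W.notMem_image_exterior hΩ ha.1⟩
  have hseam : A.area (frontier Ω ∩ W.j ⁻¹' Θ) ≤ X := by
    refine (W.area_left_le (inter_subset_left.trans frontier_subset_closure)).trans
      (le_trans (W.Q.area_mono ?_) (W.area_image_right_le (inter_subset_left.trans hfr)))
    rintro _ ⟨a, ha, rfl⟩
    obtain ⟨b, hb, hbk, hab⟩ := W.exists_frontier_right hΩ ha.1
    have haΘ : W.j a ∈ Θ := ha.2
    exact ⟨b, ⟨hb, hbk, by rwa [mem_preimage, ← hab]⟩, hab.symm⟩
  calc A.area (frontier (W.inner Θ))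
      ≤ A.area (closure Ω ∩ W.j ⁻¹' frontier Θ) + A.area (frontier Ω ∩ W.j ⁻¹' Θ) :=
        (A.area_mono (W.frontier_inner_subset hΩ hΘ)).trans (A.area_union_le _ _)
    _ ≤ W.Q.area (frontier Θ \ O) + W.Q.area (frontier Θ ∩ O) :=
        add_le_add hin ((hseam.trans hXZ).trans hZO)
    _ = W.Q.area (frontier Θ) := by rw [add_comm, hsplit]

end Area

section Regions

open AFData

variable {A B : AFData} {Ω : Set A.carrier} {Ω' : Set B.carrier}
  (W : Glued A.toCauchyData B.toCauchyData Ω Ω')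

/-- Every competitor `Θ` in the glued manifold yields the competitor `W.inner Θ` in `A` of no larger
area; `W.outer Θ` is the region of `B` against which outer-minimality is tested. -/
theorem enclosingArea_le (hΩ : A.IsRegion Ω) (hΩ' : B.IsRegion Ω')
    (hA : ∀ p, A.PiecewiseSmoothBoundaryAt Ω p) (hB : B.SmoothBoundary Ω')
    (hmin : B.OuterMinimising Ω') :
    A.enclosingArea ≤ (W.afData hΩ.1 hΩ'.1 hΩ.separatesEnds hΩ'.separatesEnds
      hΩ'.2.2).enclosingArea := by
  refine le_iInf fun Θ => le_iInf fun hΘ => le_iInf fun hΘp => ?_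
  have hΘo : IsOpen Θ := hΘ.1
  have hB' : ∀ p, B.PiecewiseSmoothBoundaryAt Ω' p :=
    CauchyData.piecewiseSmoothBoundary_iff.1 fun p hp =>
      CauchyData.SmoothBoundaryAt.piecewise (hB p hp)
  have hin : A.IsRegion (W.inner Θ) := by
    refine ⟨W.isOpen_inner hΩ.1 hΘo, fun i hi => ?_, ?_⟩
    · have hiΩ := hΩ.2.1 i hi
      obtain ⟨R, hR⟩ := hΘ.2.1 (Sum.inl ⟨i, hiΩ⟩) Sum.inl_ne_inr
      refine hiΩ.inter ⟨max R (AFData.endRadius hiΩ), fun y hy hyR => ?_⟩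
      have hyr := (le_max_right _ _).trans_lt hyR
      refine ⟨(W.left_spec ⟨i, hiΩ⟩ y hyr).2, hR y ?_ ((le_max_left _ _).trans_lt hyR)⟩
      exact (W.asymptoticChart_target (Sum.inl ⟨i, hiΩ⟩)).superset hyr
    · exact ContainsEnd.mono hΩ.2.2 (compl_subset_compl.2 inter_subset_left)
  have hout : B.IsRegion (W.outer Θ) := by
    refine ⟨W.isOpen_outer hΩ'.1 hΘo, fun i hi => ?_, ?_⟩
    · exact ContainsEnd.mono (hΩ'.2.1 i hi) subset_union_left
    · have hc := hΩ'.2.2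
      obtain ⟨R, hR⟩ := hΘ.2.2
      have hcompl : (W.outer Θ)ᶜ = Ω'ᶜ ∩ (W.k.source ∩ W.k ⁻¹' Θ)ᶜ := compl_union _ _
      rw [hcompl]
      refine hc.inter ⟨max R (AFData.endRadius hc), fun y hy hyR h => ?_⟩
      have hyr := (le_max_right _ _).trans_lt hyR
      refine hR y ?_ ((le_max_left _ _).trans_lt hyR) h.2
      exact (W.asymptoticChart_target (Sum.inr ⟨B.chosen, hc⟩)).superset hyr
  have hfin : B.area (frontier Ω') < ⊤ := hB.area_lt_top hΩ'.isCompact_frontier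
  refine le_trans (iInf_le_of_le _ (iInf_le_of_le hin (iInf_le _
    (W.piecewiseSmoothBoundary_inner hA hΘp)))) ?_
  exact W.area_frontier_inner_le hΩ.1 hΩ'.1 hΘo hfin.ne
    (hmin _ hout (W.piecewiseSmoothBoundary_outer hΩ'.1 hB' hΘo hΘp) subset_union_left)

end Regions

end Glued

end Penrose

/-! ### A fill-in against an extension -/

namespace Penrose

open Set

theorem symm_mem_frontier {X Y : Type} [TopologicalSpace X] [TopologicalSpace Y]
    {φ : OpenPartialHomeomorph X Y} {s : Set X} {t : Set Y} (ht : IsOpen t)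
    (h : ∀ x ∈ φ.source, φ x ∈ t ↔ x ∈ s) {y : Y} (hy : y ∈ φ.target) (hyt : y ∈ frontier t) :
    φ.symm y ∈ frontier s := by
  refine map_mem_frontier φ.symm (OpenPartialHomeomorph.refl X) ht ?_ hy (mem_univ _) rfl hyt
  rintro z hz x - hzx
  have hzx : φ.symm z = x := hzx
  rw [← hzx, ← h _ (φ.map_target hz), φ.right_inv hz]

theorem CauchyData.SmoothBoundaryAt.of_symm {D D' : CauchyData} {Ω : Set D.carrier}
    {Ω' : Set D'.carrier} {φ : OpenPartialHomeomorph D.carrier D'.carrier} (hφ : IsDiffeo φ)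
    (hmem : ∀ x ∈ φ.source, φ x ∈ Ω' ↔ x ∈ Ω) (hΩ' : IsOpen Ω') (h : D.SmoothBoundary Ω)
    {p : D'.carrier} (hp : p ∈ φ.target) (hpf : p ∈ frontier Ω') : D'.SmoothBoundaryAt Ω' p := by
  refine CauchyData.SmoothBoundaryAt.transfer hφ.symm hp (h _ (symm_mem_frontier hΩ' hmem hp hpf)) ?_
  filter_upwards [φ.open_target.mem_nhds hp] with y hy
  rw [← hmem _ (φ.map_target hy), φ.right_inv hy]

namespace AFData

theorem exists_mem_of_containsEnd {D : AFData} {Ω : Set D.carrier} {i : D.ι}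
    (h : D.ContainsEnd Ω i) : ∃ p, p ∈ Ω ∧ p ∉ closure Ωᶜ := by
  have h' : D.ContainsEnd Ωᶜᶜ i := by rwa [compl_compl]
  obtain ⟨y, hy⟩ := NormedSpace.exists_lt_norm ℝ E3 (endRadius h')
  have hn := notMem_closure_of_endRadius_lt h' hy
  exact ⟨(D.chart i).symm y, not_not.1 fun h => hn (subset_closure h), hn⟩

theorem nonneg_penroseMass (D : AFData) : 0 ≤ D.penroseMass :=
  EReal.coe_ennreal_nonneg _

theorem penroseMass_mono {D D' : AFData} (h : D.enclosingArea ≤ D'.enclosingArea) :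
    D.penroseMass ≤ D'.penroseMass := by
  rw [penroseMass, penroseMass, EReal.coe_ennreal_le_coe_ennreal_iff]
  gcongr

/-- With no other end to enclose, the empty region is admissible and has empty boundary. -/
theorem penroseMass_eq_zero (D : AFData) [Subsingleton D.ι] : D.penroseMass = 0 := by
  have h : D.enclosingArea = 0 := by
    refine le_antisymm (iInf_le_of_le ∅ (iInf_le_of_le ?_ (iInf_le_of_le ?_ ?_))) bot_le
    · exact ⟨isOpen_empty, fun i hi => (hi (Subsingleton.elim _ _)).elim, 0, fun y _ _ h => h⟩
    · intro p hp
      simp at hp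
    · rw [frontier_empty, CauchyData.area_empty]
  rw [penroseMass, h, ENNReal.zero_div, ENNReal.zero_rpow_of_pos (by norm_num)]
  rfl

/-- The mass is nonnegative, by the inequality for two disjoint copies of the data. -/
theorem mass_nonneg (hConj : MultiEndPenroseConjecture) (B : AFData) (hB : B.DominantEnergy) :
    (0 : EReal) ≤ B.mass := by
  -- Gluing the whole of one copy to the complement of `∅` in the other along an empty collar
  -- produces the disjoint union.
  let φ : OpenPartialHomeomorph B.carrier B.carrier :=
    (OpenPartialHomeomorph.refl B.carrier).restrOpen ∅ isOpen_empty
  have hφ : ∀ x ∈ φ.source, False := fun x hx => hx.2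
  have hd : IsDiffeo φ :=
    ⟨fun x hx => (hφ x hx).elim, fun x hx => (hφ _ (φ.map_target hx)).elim⟩
  have F : Fitting B.toCauchyData B.toCauchyData B.toCauchyData univ ∅ ∅ :=
    { isOpen_left := isOpen_univ
      φ := φ
      φ' := φ
      diffeo_left := hd
      diffeo_right := hd
      mem_left := fun x hx => (hφ x hx).elim
      mem_right := fun x hx => (hφ x hx).elim
      pull_left_g := fun x hx => (hφ x hx).elim
      pull_left_h := fun x hx => (hφ x hx).elim
      pull_right_g := fun x hx => (hφ x hx).elim
      pull_right_h := fun x hx => (hφ x hx).elim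
      frontier_left := by simp
      frontier_right := by simp }
  have huniv : ∀ i, B.ContainsEnd univ i := fun i => ⟨0, fun y _ _ => mem_univ _⟩
  have hempty : ∀ i, B.ContainsEnd ∅ᶜ i := fun i => by
    rw [compl_empty]
    exact huniv i
  obtain ⟨p, -⟩ := exists_mem_of_containsEnd (huniv B.chosen)
  obtain ⟨W⟩ := F.nonempty_glued ⟨p, mem_univ p⟩ ⟨p, by simp⟩
  have hmass := W.mass_afData isOpen_univ isOpen_empty (fun i => Or.inl (huniv i))
    (fun i => Or.inr (hempty i)) (hempty _)
  set Q := W.afData isOpen_univ isOpen_empty (fun i => Or.inl (huniv i))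
    (fun i => Or.inr (hempty i)) (hempty _) with hQ
  rw [← hmass]
  exact Q.nonneg_penroseMass.trans (hConj Q Q.isComplete
    (W.dominantEnergy isOpen_univ isOpen_empty hB hB)
    ⟨Sum.inl ⟨B.chosen, huniv _⟩, Sum.inr ⟨B.chosen, hempty _⟩, Sum.inl_ne_inr⟩)

end AFData

/-- The fill-in matches `D` outside the surface and the extension matches it inside, which is
exactly what the gluing requires. The conjecture for the glued data is then read off from its mass,
that of `B`, and its enclosing area, at least that of `A`. -/
theorem IsFillIn.penroseMass_le_mass (hConj : MultiEndPenroseConjecture) {D A B : AFData}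
    {Ω : Set D.carrier} {Ωa : Set A.carrier} {Ωb : Set B.carrier} (hΩ : IsOpen Ω)
    (hsmooth : D.SmoothBoundary Ω) (hA : IsFillIn D Ω A Ωa) (hB : IsExtension D Ω B Ωb)
    (hmin : B.OuterMinimising Ωb) : A.penroseMass ≤ B.mass := by
  obtain ⟨-, hdA, hrA, φ, hφ₁, hφ₂, hφs, hφt, hφm, hφd⟩ := hA
  obtain ⟨-, hdB, hrB, φ', hφ'₁, hφ'₂, hφ's, hφ't, hφ'm, hφ'd⟩ := hB
  -- A second end of `A` gives both a point of `Ωa` and a second end of the glued data; without one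
  -- the left side is zero.
  rcases subsingleton_or_nontrivial A.ι with hι | hι
  · rw [A.penroseMass_eq_zero]
    exact B.mass_nonneg hConj hdB
  have hfA : ∀ a ∈ frontier Ωa, a ∈ φ.target := fun a ha => hφt (by
    rw [hrA.1.frontier_eq] at ha
    exact ha.2)
  have hfB : ∀ b ∈ frontier Ωb, b ∈ φ'.target := fun b hb => hφ't hb.1
  have F : Fitting A.toCauchyData B.toCauchyData D.toCauchyData Ωa Ωb Ω :=
    { isOpen_left := hrA.1
      φ := φ
      φ' := φ'
      diffeo_left := ⟨hφ₁, hφ₂⟩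
      diffeo_right := ⟨hφ'₁, hφ'₂⟩
      mem_left := hφm
      mem_right := hφ'm
      pull_left_g := fun x _ hx => by ext v w; exact (hφd x hx v w).1
      pull_left_h := fun x _ hx => by ext v w; exact (hφd x hx v w).2
      pull_right_g := fun x _ hx => by ext v w; exact (hφ'd x hx v w).1
      pull_right_h := fun x _ hx => by ext v w; exact (hφ'd x hx v w).2
      -- Frontier points correspond to frontier points of `Ω`, which lie both off `Ω` and in its
      -- closure, hence in the domains of both identifications.
      frontier_left := fun a ha =>
        ⟨hfA a ha, hφ's (symm_mem_frontier hrA.1 hφm (hfA a ha) ha).1⟩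
      frontier_right := fun b hb => ⟨hfB b hb, hφs (by
        have := symm_mem_frontier hrB.1 hφ'm (hfB b hb) hb
        rw [hΩ.frontier_eq] at this
        exact this.2)⟩ }
  obtain ⟨i, hi⟩ := exists_ne A.chosen
  obtain ⟨a, ha, -⟩ := AFData.exists_mem_of_containsEnd (hrA.2.1 i hi)
  obtain ⟨b, -, hb⟩ := AFData.exists_mem_of_containsEnd hrB.2.2
  rw [compl_compl] at hb
  obtain ⟨W⟩ := F.nonempty_glued ⟨a, ha⟩ ⟨b, hb⟩
  have hsA : ∀ p, A.PiecewiseSmoothBoundaryAt Ωa p :=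
    CauchyData.piecewiseSmoothBoundary_iff.1 fun p hp =>
      (CauchyData.SmoothBoundaryAt.of_symm ⟨hφ₁, hφ₂⟩ hφm hrA.1 hsmooth (hfA p hp) hp).piecewise
  have hsB : B.SmoothBoundary Ωb := fun p hp =>
    CauchyData.SmoothBoundaryAt.of_symm ⟨hφ'₁, hφ'₂⟩ hφ'm hrB.1 hsmooth (hfB p hp) hp
  have hmass := W.mass_afData hrA.1 hrB.1 hrA.separatesEnds hrB.separatesEnds hrB.2.2
  have harea := W.enclosingArea_le hrA hrB hsA hsB hmin
  set Q := W.afData hrA.1 hrB.1 hrA.separatesEnds hrB.separatesEnds hrB.2.2 with hQ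
  rw [← hmass]
  exact (AFData.penroseMass_mono harea).trans (hConj Q Q.isComplete
    (W.dominantEnergy hrA.1 hrB.1 hdA hdB)
    ⟨Sum.inl ⟨i, hrA.2.1 i hi⟩, Sum.inr ⟨B.chosen, hrB.2.2⟩, Sum.inl_ne_inr⟩)

end Penrose

end

theorem theorem5 (hConj : Penrose.MultiEndPenroseConjecture)
    (D : Penrose.AFData) (hcomplete : D.IsComplete) (hdec : D.DominantEnergy)
    (Ω : Set D.carrier) (hΩ : D.IsRegion Ω) (hsmooth : D.SmoothBoundary Ω)
    (hmin : D.OuterMinimising Ω) :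
    Penrose.innerMass D Ω ≤ Penrose.outerMass D Ω := by
  refine sSup_le ?_
  rintro _ ⟨A, Ωa, hA, rfl⟩
  refine le_sInf ?_
  rintro _ ⟨B, Ωb, hB, hmin', rfl⟩
  exact hA.penroseMass_le_mass hConj hΩ.1 hsmooth hB hmin'
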